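/- Let $(M,\Omega)$ be a symplectic manifold (smooth, without boundary, Hausdorff and second countable) and let $\pi\colon M\to\mathbb{C}$ be a smooth proper submersion. Let $F=\pi^{-1}(0)$, a closed submanifold of $M$, and let $\Omega_F=\Omega|_F$. Assume that $(M,\pi,\Omega)$ is a Hamiltonian fibration with fibre $(F,\Omega_F)$, that is, the restriction of $\Omega$ to each fibre $\pi^{-1}(z)$ is symplectic and $(\pi^{-1}(z),\Omega|_{\pi^{-1}(z)})$ is symplectomorphic to $(F,\Omega_F)$. Let $f=f(r)$ be a smooth function on $[0,\infty)$ with $f(0)=0$ and $f''\ge 0$, and suppose that, in polar coordinates $(r,\theta)$, the $2$-form $d(f\,d\theta)$ on $\mathbb{C}\setminus\{0\}$ is the restriction of a symplectic form $\omega$ on $\mathbb{C}$. Then there is a symplectic embedding $$\varphi\colon (M,\Omega)\hookrightarrow (F\times\mathbb{C},\ \mathrm{pr}_1^*\Omega_F+\mathrm{pr}_2^*\omega),$$ that is, a smooth embedding with $\varphi^*(\mathrm{pr}_1^*\Omega_F+\mathrm{pr}_2^*\omega)=\Omega$, which is a smooth homotopy equivalence (it has a smooth inverse up to smooth homotopy)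 and is the identity from $\pi^{-1}(0)$ to $F\times\{0\}$, that is, $\varphi(x)=(x,0)$ for all $x\in F$. -/

import Mathlib

open scoped Manifold ContDiff

noncomputable section

/-! ### Differential forms on manifolds without boundary -/

section Forms

variable {E : Type*} [NormedAddCommGroup E] [NormedSpace ℝ E]
  {H : Type*} [TopologicalSpace H] {M : Type*} [TopologicalSpace M] [ChartedSpace H M]
  {E' : Type*} [NormedAddCommGroup E'] [NormedSpace ℝ E']
  {H' : Type*} [TopologicalSpace H'] {M' : Type*} [TopologicalSpace M'] [ChartedSpace H' M']
  {k : ℕ}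

/-- Differential `k`-forms on `M` (no regularity is imposed here): a choice, for every point `x`,
of an alternating `k`-linear form on the tangent space `T_x M`. -/
abbrev DiffForm (I : ModelWithCorners ℝ E H) (M : Type*) [TopologicalSpace M] [ChartedSpace H M]
    (k : ℕ) : Type _ :=
  ∀ x : M, TangentSpace I x [⋀^Fin k]→L[ℝ] ℝ

/-- The pullback `f^*α` of a differential form along a map `f : M → M'`:
`(f^*α)_x (v₁, …, v_k) = α_{f x} (df_x v₁, …, df_x v_k)`. -/
def DiffForm.pullback (I : ModelWithCorners ℝ E H) (I' : ModelWithCorners ℝ E' H')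
    (f : M → M') (α : DiffForm I' M' k) : DiffForm I M k :=
  fun x => (α (f x)).compContinuousLinearMap (mfderiv I I' f x)

/-- The expression of a differential form in the preferred chart at `x₀`: the pullback of the form
along the inverse of the chart, which is a form on the target of the chart, an open subset of the
model vector space when `M` has no boundary. -/
def DiffForm.inChart (I : ModelWithCorners ℝ E H) (α : DiffForm I M k) (x₀ : M) :
    E → E [⋀^Fin k]→L[ℝ] ℝ :=
  DiffForm.pullback 𝓘(ℝ, E) I (extChartAt I x₀).symm α

/-- A differential form on a manifold without boundary is smooth if it is smooth in charts. -/
def DiffForm.IsSmooth (I : ModelWithCorners ℝ E H) (α : DiffForm I M k) : Prop :=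
  ∀ x₀ : M, ContDiffOn ℝ ∞ (α.inChart I x₀) (extChartAt I x₀).target

/-- A differential form on a manifold without boundary is closed if its exterior derivative
vanishes in charts. -/
def DiffForm.IsClosedForm (I : ModelWithCorners ℝ E H) (α : DiffForm I M k) : Prop :=
  ∀ x₀ : M, ∀ y ∈ (extChartAt I x₀).target, extDeriv (α.inChart I x₀) y = 0

/-- A symplectic form on a manifold without boundary: a smooth, closed, non-degenerate
`2`-form. -/
structure IsSymplecticForm (I : ModelWithCorners ℝ E H) (α : DiffForm I M 2) : Prop where
  smooth : DiffForm.IsSmooth I α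
  closed : DiffForm.IsClosedForm I α
  nondegenerate : ∀ (x : M) (v : TangentSpace I x),
    (∀ w : TangentSpace I x, α x ![v, w] = 0) → v = 0

/-- The split form `pr₁^*α + pr₂^*β` on a product manifold. -/
def DiffForm.prodSum (I : ModelWithCorners ℝ E H) (I' : ModelWithCorners ℝ E' H')
    (α : DiffForm I M k) (β : DiffForm I' M' k) : DiffForm (I.prod I') (M × M') k :=
  fun p => DiffForm.pullback (I.prod I') I (Prod.fst : M × M' → M) α p +
    DiffForm.pullback (I.prod I') I' (Prod.snd : M × M' → M') β p

/-! ### Smooth homotopy equivalences -/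

/-- Two maps are smoothly homotopic if there is a smooth map `h` with `h (0, x) = f x` and
`h (1, x) = g x`. The time parameter runs over `ℝ`; as `[0, 1]` is a smooth image of `ℝ` under a
function fixing `0` and `1`, this is the same as asking for a smooth homotopy on
`[0, 1] × M`. -/
def SmoothlyHomotopic (I : ModelWithCorners ℝ E H) (I' : ModelWithCorners ℝ E' H')
    (f g : M → M') : Prop :=
  ∃ h : ℝ × M → M', ContMDiff (𝓘(ℝ, ℝ).prod I) I' ∞ h ∧
    ∀ x, h (0, x) = f x ∧ h (1, x) = g x

/-- A smooth homotopy equivalence: a smooth map with a smooth inverse up to smooth homotopy. -/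
def IsSmoothHomotopyEquiv (I : ModelWithCorners ℝ E H) (I' : ModelWithCorners ℝ E' H')
    (f : M → M') : Prop :=
  ContMDiff I I' ∞ f ∧ ∃ g : M' → M, ContMDiff I' I ∞ g ∧
    SmoothlyHomotopic I I (g ∘ f) id ∧ SmoothlyHomotopic I' I' (f ∘ g) id

/-! ### Hamiltonian fibrations over the complex plane -/

/-- `(M, p, Ω)` is a Hamiltonian fibration over `ℂ` with fibre the closed (that is, compact without
boundary) symplectic manifold `(F, αF)`: `p : M → ℂ` is a proper submersion and `Ω` is a (smooth)
closed `2`-form on `M` whose restriction to each fibre `p ⁻¹ {z}` is symplectic, the fibre with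
the restricted form being symplectomorphic to `(F, αF)`. The symplectomorphism with the
submanifold `p ⁻¹ {z}` is given as a smooth embedding `F → M` with image `p ⁻¹ {z}` that pulls
`Ω` back to `αF`. -/
structure IsHamiltonianFibration (I : ModelWithCorners ℝ E H) (I' : ModelWithCorners ℝ E' H')
    [CompactSpace M'] (p : M → ℂ) (Ω : DiffForm I M 2) (αF : DiffForm I' M' 2) : Prop where
  fibre_symplectic : IsSymplecticForm I' αF
  submersion : Manifold.IsSubmersion I 𝓘(ℝ, ℂ) ∞ p
  proper : IsProperMap p
  smooth : DiffForm.IsSmooth I Ω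
  closed : DiffForm.IsClosedForm I Ω
  fibre : ∀ z : ℂ, ∃ j : M' → M, Manifold.IsSmoothEmbedding I' I ∞ j ∧
    Set.range j = p ⁻¹' {z} ∧ DiffForm.pullback I' I j Ω = αF

end Forms

/-! ### Radial forms on the plane -/

/-- The angular `1`-form `dθ = Im (dz / z) = (x dy - y dx) / (x² + y²)` on `ℂ ∖ {0}`. -/
def dTheta (z : ℂ) : ℂ →L[ℝ] ℝ :=
  Complex.imCLM ∘L ContinuousLinearMap.mul ℝ ℂ z⁻¹

/-- The `2`-form `d(f dθ)` on `ℂ ∖ {0}`, where `f = f(r)` is a function of the radius. -/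
def dRadialTheta (f : ℝ → ℝ) : ℂ → ℂ [⋀^Fin 2]→L[ℝ] ℝ :=
  extDeriv fun z : ℂ =>
    ContinuousAlternatingMap.ofSubsingleton ℝ ℂ ℝ (0 : Fin 1) (f ‖z‖ • dTheta z)

end

/-! The `Ω`-orthogonal complement of the vertical spaces is a connection on `p : M → ℂ`. It lifts
constant fields `z` on `ℂ` to fields `V z` with `Ω (V z, ·) = r · Im (z̄ dp)`, where `r` is a
nowhere vanishing function on `M` (`exists_horizontal_lift`). Properness of `p` makes the lifts
complete, so parallel transport along the rays from the origin gives a diffeomorphism `Φ : F × ℂ →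
M` with inverse `Ψ`, `p ∘ Φ = pr₂` and `Φ (x, 0) = ι x` (`exists_trivialization`).

By Cartan's formula, a closed `2`-form on `F × ℂ` killed by the radial field `R` is invariant under
scaling of `ℂ`, hence zero if its restriction to `F × {0}` is zero
(`closed_form_eq_zero_of_radial`). So `Φ^*Ω` equals `pr₁^*Ω_F + C^*(2 dx ∧ dy)` for any smooth `C :
F × ℂ → ℂ` that vanishes on `F × {0}` and gives the same contraction with `R`. With `ρ = r ∘ Φ > 0`
and `C = √H · z` this is the equation `2H + R H = ρ`, solved by `H (x, z) = ∫₀¹ t ρ (x, tz) dt`. If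
`ρ < 0`, take `|ρ|` and conjugate `z`. As `|C|²` increases strictly along rays, `C` is injective on
each `{x} × ℂ`.

The same construction on `ℂ` gives `A = √k · z` pulling `2 dx ∧ dy` back to `σ`. Here `f'' ≥ 0`
makes the density of `σ` positive and bounds `f'` below by `f' 1 > 0` on `[1, ∞)`, so `A` is onto
and `S = A⁻¹` is defined on all of `ℂ` (`exists_area_normalization`).

The embedding is `φ = (pr₁ ∘ Ψ, S ∘ C ∘ Ψ)`. It is injective, its differential is injective because
`Ω` is nondegenerate, and the dimensions agree. Its homotopy inverse is `ι ∘ pr₁`.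

Smooth dependence of flows on parameters and smoothness of `H` both rest on one fact: `γ ↦ V ∘ γ` on
continuous functions on a compact space is as smooth as `V`. -/

open Set Filter Topology

set_option linter.unusedSectionVars false

/-! ### Superposition operators on spaces of continuous functions -/

section Superposition

universe u v

variable {K : Type*} [TopologicalSpace K] [CompactSpace K]

/-- The pointwise application of a continuous bilinear map to continuous functions. -/
noncomputable def ContinuousMap.bilinearCLM {E F G : Type*} [NormedAddCommGroup E]
    [NormedSpace ℝ E] [NormedAddCommGroup F] [NormedSpace ℝ F] [NormedAddCommGroup G]
    [NormedSpace ℝ G] (B : G →L[ℝ] E →L[ℝ] F) : C(K, G) →L[ℝ] C(K, E) →L[ℝ] C(K, F) :=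
  LinearMap.mkContinuous₂
    (LinearMap.mk₂ ℝ (fun (A : C(K, G)) (δ : C(K, E)) => (⟨fun k => B (A k) (δ k), by fun_prop⟩ : C(K, F)))
      (by intros; ext; simp) (by intros; ext; simp) (by intros; ext; simp) (by intros; ext; simp))
    ‖B‖ (by
      intro A δ
      rw [ContinuousMap.norm_le _ (by positivity)]
      intro k
      refine (B.le_opNorm₂ (A k) (δ k)).trans ?_
      gcongr
      · exact A.norm_coe_le_norm k
      · exact δ.norm_coe_le_norm k)

lemma ContinuousMap.contDiff_bilinearCLM {E F G : Type*} [NormedAddCommGroup E]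
    [NormedSpace ℝ E] [NormedAddCommGroup F] [NormedSpace ℝ F] [NormedAddCommGroup G]
    [NormedSpace ℝ G] (B : G →L[ℝ] E →L[ℝ] F) {n : WithTop ℕ∞} :
    ContDiff ℝ n (fun A : C(K, G) => ContinuousMap.bilinearCLM B A) :=
  ContinuousLinearMap.contDiff _

/-- Postcomposition with `V'` is continuous in the sup norm, so the mean value inequality on a ball
around `γ k` bounds the error by `ε ‖γ' - γ‖` uniformly in `k`. -/
lemma ContinuousMap.hasFDerivAt_comp {E F : Type*} [NormedAddCommGroup E] [NormedSpace ℝ E]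
    [NormedAddCommGroup F] [NormedSpace ℝ F] (V : C(E, F)) (V' : C(E, E →L[ℝ] F))
    (h : ∀ x, HasFDerivAt V (V' x) x) (γ : C(K, E)) :
    HasFDerivAt (fun γ : C(K, E) => V.comp γ)
      (ContinuousMap.bilinearCLM (ContinuousLinearMap.id ℝ (E →L[ℝ] F)) (V'.comp γ)) γ := by
  refine HasFDerivAt.of_isLittleO (Asymptotics.isLittleO_iff.2 fun ε hε => ?_)
  obtain ⟨δ, hδ, hball⟩ := (Metric.continuous_iff (f := fun γ : C(K, E) => V'.comp γ)).1
    (by exact ContinuousMap.continuous_postcomp V') γ ε hε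
  filter_upwards [Metric.ball_mem_nhds γ hδ] with γ' hγ'
  rw [ContinuousMap.norm_le _ (by positivity)]
  intro k
  have key : ∀ y ∈ Metric.ball (γ k) δ, ‖V' y - V' (γ k)‖ ≤ ε := by
    intro y hy
    -- Shifting `γ` by the constant `y - γ k` gives a function within `δ` of `γ` whose value at `k`
    -- is `y`. This turns the estimate on functions into one on points.
    have h1 := hball (γ + ContinuousMap.const K (y - γ k)) (by
      rw [dist_eq_norm, add_sub_cancel_left]
      refine lt_of_le_of_lt ((ContinuousMap.norm_le _ (norm_nonneg (y - γ k))).2 fun _ => le_rfl) ?_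
      simpa [dist_eq_norm] using hy)
    have h2 := (ContinuousMap.dist_lt_iff hε).1 h1 k
    simpa [dist_eq_norm] using h2.le
  have hk : γ' k ∈ Metric.ball (γ k) δ :=
    lt_of_le_of_lt (ContinuousMap.dist_apply_le_dist k) hγ'
  have := (convex_ball (γ k) δ).norm_image_sub_le_of_norm_hasFDerivWithin_le'
    (fun y _ => (h y).hasFDerivWithinAt) key (Metric.mem_ball_self hδ) hk
  refine this.trans ?_
  gcongr
  exact (γ' - γ).norm_coe_le_norm k

/-- The derivative at `γ` is multiplication by `V' ∘ γ`, itself a superposition operator of one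
order less. The target passes from `F` to `E →L[ℝ] F`, so the induction quantifies over `F` in a
universe that contains that of `E`. -/
lemma ContinuousMap.contDiff_comp_aux {E : Type u} [NormedAddCommGroup E] [NormedSpace ℝ E]
    (n : ℕ) : ∀ {F : Type (max u v)} [NormedAddCommGroup F] [NormedSpace ℝ F] (V : C(E, F)),
    ContDiff ℝ n V → ContDiff ℝ n (fun γ : C(K, E) => V.comp γ) := by
  induction n with
  | zero =>
    intro F _ _ V _
    exact contDiff_zero.2 (ContinuousMap.continuous_postcomp V)
  | succ n ih =>
    intro F _ _ V hV
    have hV1 := hV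
    push_cast at hV ⊢
    rw [contDiff_succ_iff_fderiv] at hV
    obtain ⟨hd, -, hV'⟩ := hV
    let V' : C(E, E →L[ℝ] F) := ⟨fderiv ℝ V, hV'.continuous⟩
    refine contDiff_succ_iff_hasFDerivAt.2 ⟨_, ?_,
      fun γ => ContinuousMap.hasFDerivAt_comp V V' (fun x => (hd x).hasFDerivAt) γ⟩
    exact (ContinuousLinearMap.contDiff _).comp (ih V' hV')

/-- The superposition operator `γ ↦ V ∘ γ` on continuous functions is as smooth as `V`. -/
theorem ContinuousMap.contDiff_comp {E : Type u} [NormedAddCommGroup E] [NormedSpace ℝ E]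
    {F : Type v} [NormedAddCommGroup F] [NormedSpace ℝ F] (n : ℕ) (V : C(E, F))
    (hV : ContDiff ℝ n V) : ContDiff ℝ n (fun γ : C(K, E) => V.comp γ) := by
  -- Lifting `F` puts it in the universe that the induction requires.
  let e : ULift.{u} F ≃L[ℝ] F := ContinuousLinearEquiv.ulift
  let W : C(E, ULift.{u} F) := (⟨e.symm, e.symm.continuous⟩ : C(F, ULift.{u} F)).comp V
  have hW : ContDiff ℝ n W := e.symm.contDiff.comp hV
  have := (ContinuousLinearMap.contDiff (n := n)
    (ContinuousLinearMap.compLeftContinuous ℝ K (e : ULift.{u} F →L[ℝ] F))).comp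
    (ContinuousMap.contDiff_comp_aux (K := K) n W hW)
  exact this

end Superposition

/-! ### Smooth dependence of solutions of differential equations on parameters -/

section Parameters

variable {E P : Type*} [NormedAddCommGroup E] [NormedSpace ℝ E]
  [NormedAddCommGroup P] [NormedSpace ℝ P]

/-- The primitive vanishing at `0`, as an operator on continuous functions on `[-2, 2]`. -/
noncomputable def primitiveCLM : C(Icc (-2 : ℝ) 2, E) →L[ℝ] C(Icc (-2 : ℝ) 2, E) :=
  LinearMap.mkContinuous
    { toFun := fun γ => ⟨fun t => ∫ s in (0 : ℝ)..t, IccExtend (by norm_num) γ s, by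
        have : Continuous (IccExtend (by norm_num : (-2 : ℝ) ≤ 2) γ) := γ.continuous.Icc_extend'
        exact (intervalIntegral.continuous_primitive (fun a b => this.intervalIntegrable a b)
          0).comp continuous_subtype_val⟩
      map_add' := fun γ δ => by
        ext t
        have h1 : Continuous (IccExtend (by norm_num : (-2 : ℝ) ≤ 2) γ) := γ.continuous.Icc_extend'
        have h2 : Continuous (IccExtend (by norm_num : (-2 : ℝ) ≤ 2) δ) := δ.continuous.Icc_extend'
        exact intervalIntegral.integral_add (h1.intervalIntegrable _ _) (h2.intervalIntegrable _ _)
      map_smul' := fun c γ => by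
        ext t
        exact intervalIntegral.integral_smul c _ }
    2 (by
      intro γ
      rw [ContinuousMap.norm_le _ (by positivity)]
      intro t
      have h := intervalIntegral.norm_integral_le_of_norm_le_const (a := 0) (b := (t : ℝ))
        (f := IccExtend (by norm_num : (-2 : ℝ) ≤ 2) γ) (C := ‖γ‖)
        (fun s _ => γ.norm_coe_le_norm _)
      refine h.trans ?_
      rw [sub_zero, mul_comm]
      gcongr
      exact abs_le.2 t.2)

lemma primitiveCLM_apply (γ : C(Icc (-2 : ℝ) 2, E)) (t : Icc (-2 : ℝ) 2) :
    primitiveCLM γ t = ∫ s in (0 : ℝ)..t, IccExtend (by norm_num : (-2 : ℝ) ≤ 2) γ s := rfl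

/-- Solutions on `[-2, 2]` of the equations `γ' = V(γ) z`, depending smoothly on the initial value
and on the small parameter `z`. -/
theorem exists_contDiffAt_solution [CompleteSpace E] [CompleteSpace P] {n : ℕ} (hn : n ≠ 0)
    (V : E → P →L[ℝ] E) (hV : ContDiff ℝ n V) (x₀ : E) :
    ∃ Γ : E × P → C(Icc (-2 : ℝ) 2, E), ContDiffAt ℝ n Γ (x₀, 0) ∧
      Γ (x₀, 0) = ContinuousMap.const _ x₀ ∧
      ∀ᶠ q in 𝓝 (x₀, (0 : P)), IccExtend (by norm_num : (-2 : ℝ) ≤ 2) (Γ q) 0 = q.1 ∧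
        ∀ t ∈ Ioo (-2 : ℝ) 2, HasDerivAt (IccExtend (by norm_num : (-2 : ℝ) ≤ 2) (Γ q))
          (V (IccExtend (by norm_num : (-2 : ℝ) ≤ 2) (Γ q) t) q.2) t := by
  let Vc : C(E, P →L[ℝ] E) := ⟨V, hV.continuous⟩
  let B := ContinuousMap.bilinearCLM (K := Icc (-2 : ℝ) 2) (ContinuousLinearMap.id ℝ (P →L[ℝ] E))
  let c₁ : E →L[ℝ] C(Icc (-2 : ℝ) 2, E) := ContinuousLinearMap.const ℝ _
  let c₂ : P →L[ℝ] C(Icc (-2 : ℝ) 2, P) := ContinuousLinearMap.const ℝ _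
  -- Zeros of `f` solve `γ t = x + ∫₀ᵗ V(γ) z`. At `z = 0` the integral drops out, so the partial
  -- derivative in `γ` is the identity and the implicit function theorem applies on the whole
  -- interval: a small `z` replaces a short time.
  let f : (E × P) × C(Icc (-2 : ℝ) 2, E) → C(Icc (-2 : ℝ) 2, E) := fun u =>
    u.2 - c₁ u.1.1 - primitiveCLM (B (Vc.comp u.2) (c₂ u.1.2))
  let u₀ : (E × P) × C(Icc (-2 : ℝ) 2, E) := ((x₀, 0), c₁ x₀)
  have hN : ContDiff ℝ n fun γ : C(Icc (-2 : ℝ) 2, E) => Vc.comp γ :=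
    ContinuousMap.contDiff_comp n Vc hV
  have hf : ContDiff ℝ n f := by
    refine (contDiff_snd.sub (c₁.contDiff.comp (contDiff_fst.comp contDiff_fst))).sub ?_
    have hB : ContDiff ℝ n fun u : (E × P) × C(Icc (-2 : ℝ) 2, E) => B (Vc.comp u.2) :=
      (ContinuousMap.contDiff_bilinearCLM _).comp (hN.comp contDiff_snd)
    refine (primitiveCLM (E := E)).contDiff.comp (hB.clm_apply ?_)
    exact c₂.contDiff.comp (contDiff_snd.comp contDiff_fst)
  have hn1 : (n : WithTop ℕ∞) ≠ 0 := by exact_mod_cast hn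
  have hinr : fderiv ℝ f u₀ ∘L .inr ℝ (E × P) C(Icc (-2 : ℝ) 2, E) =
      ContinuousLinearMap.id ℝ C(Icc (-2 : ℝ) 2, E) := by
    have h1 : HasFDerivAt (fun γ => f ((x₀, 0), γ))
        (fderiv ℝ f u₀ ∘L .inr ℝ (E × P) C(Icc (-2 : ℝ) 2, E)) (c₁ x₀) :=
      ((hf.differentiable hn1) u₀).hasFDerivAt.comp (c₁ x₀) (hasFDerivAt_prodMk_right _ _)
    have h2 : HasFDerivAt (fun γ => f ((x₀, 0), γ))
        (ContinuousLinearMap.id ℝ C(Icc (-2 : ℝ) 2, E)) (c₁ x₀) := by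
      have : (fun γ => f ((x₀, 0), γ)) = fun γ => γ - c₁ x₀ := by
        funext γ
        simp [f]
      rw [this]
      exact (hasFDerivAt_id _).sub_const _
    exact h1.unique h2
  have hinv : (fderiv ℝ f u₀ ∘L .inr ℝ (E × P) C(Icc (-2 : ℝ) 2, E)).IsInvertible := by
    rw [hinr]
    exact ⟨ContinuousLinearEquiv.refl ℝ _, rfl⟩
  have hfu : f u₀ = 0 := by simp [f, u₀]
  refine ⟨hf.contDiffAt.implicitFunction hn1 hinv, hf.contDiffAt.contDiffAt_implicitFunction hn1 hinv,
    hf.contDiffAt.implicitFunction_apply_self hn1 hinv, ?_⟩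
  filter_upwards [hf.contDiffAt.eventually_apply_implicitFunction hn1 hinv] with q hq
  rw [hfu] at hq
  set γ := hf.contDiffAt.implicitFunction hn1 hinv q
  have hγ : ∀ t : Icc (-2 : ℝ) 2, γ t = q.1 + ∫ s in (0 : ℝ)..t,
      V (IccExtend (by norm_num : (-2 : ℝ) ≤ 2) γ s) q.2 := by
    intro t
    have := congrArg (fun δ : C(Icc (-2 : ℝ) 2, E) => δ t) hq
    simp only [f, ContinuousMap.sub_apply, ContinuousMap.zero_apply, primitiveCLM_apply] at this
    rw [sub_eq_zero, sub_eq_iff_eq_add'] at this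
    exact this
  have hcont : Continuous (IccExtend (by norm_num : (-2 : ℝ) ≤ 2) γ) := γ.continuous.Icc_extend'
  have hext : ∀ t ∈ Icc (-2 : ℝ) 2, IccExtend (by norm_num : (-2 : ℝ) ≤ 2) γ t =
      q.1 + ∫ s in (0 : ℝ)..t, V (IccExtend (by norm_num : (-2 : ℝ) ≤ 2) γ s) q.2 := by
    intro t ht
    rw [IccExtend_of_mem _ _ ht, hγ]
  refine ⟨by rw [hext 0 (by norm_num)]; simp, fun t ht => ?_⟩
  have hcV : Continuous fun s => V (IccExtend (by norm_num : (-2 : ℝ) ≤ 2) γ s) q.2 :=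
    (hV.continuous.comp hcont).clm_apply continuous_const
  have hd : HasDerivAt (fun t => q.1 + ∫ s in (0 : ℝ)..t,
      V (IccExtend (by norm_num : (-2 : ℝ) ≤ 2) γ s) q.2)
      (V (IccExtend (by norm_num : (-2 : ℝ) ≤ 2) γ t) q.2) t :=
    (intervalIntegral.integral_hasDerivAt_right (hcV.intervalIntegrable _ _)
      (hcV.stronglyMeasurableAtFilter _ _) hcV.continuousAt).const_add _
  refine hd.congr_of_eventuallyEq ?_
  filter_upwards [Ioo_mem_nhds ht.1 ht.2] with s hs
  exact hext s (Ioo_subset_Icc_self hs)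

end Parameters

/-! ### Vector fields in charts -/

section Charts

variable {E : Type*} [NormedAddCommGroup E] [NormedSpace ℝ E]
  {M : Type*} [TopologicalSpace M] [ChartedSpace E M] [IsManifold 𝓘(ℝ, E) ∞ M]

lemma mfderiv_extChartAt_mfderiv_symm {x₀ : M} {y : E} (hy : y ∈ (extChartAt 𝓘(ℝ, E) x₀).target)
    (v : E) :
    mfderiv 𝓘(ℝ, E) 𝓘(ℝ, E) (extChartAt 𝓘(ℝ, E) x₀) ((extChartAt 𝓘(ℝ, E) x₀).symm y)
      (mfderiv 𝓘(ℝ, E) 𝓘(ℝ, E) (extChartAt 𝓘(ℝ, E) x₀).symm y v) = v := by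
  have h := mfderiv_extChartAt_comp_mfderivWithin_extChartAt_symm hy
  simp only [modelWithCornersSelf_coe, range_id, mfderivWithin_univ] at h
  exact congrArg (fun L : E →L[ℝ] E => L v) h

lemma mfderiv_symm_mfderiv_extChartAt {x₀ : M} {y : E} (hy : y ∈ (extChartAt 𝓘(ℝ, E) x₀).target)
    (v : TangentSpace 𝓘(ℝ, E) ((extChartAt 𝓘(ℝ, E) x₀).symm y)) :
    mfderiv 𝓘(ℝ, E) 𝓘(ℝ, E) (extChartAt 𝓘(ℝ, E) x₀).symm y
      (mfderiv 𝓘(ℝ, E) 𝓘(ℝ, E) (extChartAt 𝓘(ℝ, E) x₀) ((extChartAt 𝓘(ℝ, E) x₀).symm y) v) =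
        v := by
  have h := mfderivWithin_extChartAt_symm_comp_mfderiv_extChartAt hy
  simp only [modelWithCornersSelf_coe, range_id, mfderivWithin_univ] at h
  exact congrArg (fun L : TangentSpace 𝓘(ℝ, E) ((extChartAt 𝓘(ℝ, E) x₀).symm y) →L[ℝ]
    TangentSpace 𝓘(ℝ, E) ((extChartAt 𝓘(ℝ, E) x₀).symm y) => L v) h

lemma contMDiffAt_extChartAt_symm {x₀ : M} {y : E} (hy : y ∈ (extChartAt 𝓘(ℝ, E) x₀).target) :
    ContMDiffAt 𝓘(ℝ, E) 𝓘(ℝ, E) ∞ (extChartAt 𝓘(ℝ, E) x₀).symm y :=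
  (contMDiffOn_extChartAt_symm x₀).contMDiffAt ((isOpen_extChartAt_target x₀).mem_nhds hy)

lemma mdifferentiableAt_symm_chart {x₀ : M} {y : E} (hy : y ∈ (extChartAt 𝓘(ℝ, E) x₀).target) :
    MDifferentiableAt 𝓘(ℝ, E) 𝓘(ℝ, E) (extChartAt 𝓘(ℝ, E) x₀).symm y :=
  (contMDiffAt_extChartAt_symm hy).mdifferentiableAt (by simp)

/-- The expression of a vector field in the preferred chart at `x₀`. -/
noncomputable def fieldInChart (X : ∀ x : M, TangentSpace 𝓘(ℝ, E) x) (x₀ : M) (y : E) : E :=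
  mfderiv 𝓘(ℝ, E) 𝓘(ℝ, E) (extChartAt 𝓘(ℝ, E) x₀) ((extChartAt 𝓘(ℝ, E) x₀).symm y)
    (X ((extChartAt 𝓘(ℝ, E) x₀).symm y))

lemma mfderiv_symm_fieldInChart (X : ∀ x : M, TangentSpace 𝓘(ℝ, E) x) {x₀ : M} {y : E}
    (hy : y ∈ (extChartAt 𝓘(ℝ, E) x₀).target) :
    mfderiv 𝓘(ℝ, E) 𝓘(ℝ, E) (extChartAt 𝓘(ℝ, E) x₀).symm y (fieldInChart (E := E) X x₀ y) =
      X ((extChartAt 𝓘(ℝ, E) x₀).symm y) :=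
  mfderiv_symm_mfderiv_extChartAt hy _

/-- A vector field is smooth if and only if it is smooth in charts. -/
lemma contMDiff_field_iff (X : ∀ x : M, TangentSpace 𝓘(ℝ, E) x) :
    ContMDiff 𝓘(ℝ, E) 𝓘(ℝ, E).tangent ∞ (fun x => (⟨x, X x⟩ : TangentBundle 𝓘(ℝ, E) M)) ↔
      ∀ x₀, ContDiffOn ℝ ∞ (fieldInChart X x₀) (extChartAt 𝓘(ℝ, E) x₀).target := by
  have key : ∀ x₀ : M, ContMDiffOn 𝓘(ℝ, E) 𝓘(ℝ, E).tangent ∞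
      (fun x => (⟨x, X x⟩ : TangentBundle 𝓘(ℝ, E) M)) (chartAt E x₀).source ↔
      ContDiffOn ℝ ∞ (fieldInChart X x₀) (extChartAt 𝓘(ℝ, E) x₀).target := by
    intro x₀
    have h1 := (trivializationAt E (TangentSpace 𝓘(ℝ, E)) x₀).contMDiffOn_section_baseSet_iff
      (IB := 𝓘(ℝ, E)) (n := ∞) (s := X)
    rw [TangentBundle.trivializationAt_baseSet] at h1
    rw [h1]
    have h2 : ∀ x ∈ (chartAt E x₀).source,
        ((trivializationAt E (TangentSpace 𝓘(ℝ, E)) x₀) ⟨x, X x⟩).2 =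
        mfderiv 𝓘(ℝ, E) 𝓘(ℝ, E) (extChartAt 𝓘(ℝ, E) x₀) x (X x) := by
      intro x hx
      have a := TangentBundle.continuousLinearMapAt_trivializationAt (I := 𝓘(ℝ, E)) hx
      have b := (trivializationAt E (TangentSpace 𝓘(ℝ, E)) x₀).continuousLinearMapAt_apply_of_mem
        ℝ (b := x) hx (X x)
      exact b.symm.trans (congrArg (fun L : TangentSpace 𝓘(ℝ, E) x →L[ℝ] E => L (X x)) a)
    constructor
    · intro h
      rw [← contMDiffOn_iff_contDiffOn]
      have h3 := h.comp (contMDiffOn_extChartAt_symm x₀) (fun y hy => by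
        simpa using (extChartAt 𝓘(ℝ, E) x₀).map_target hy)
      refine h3.congr fun y hy => ?_
      have hy' : (extChartAt 𝓘(ℝ, E) x₀).symm y ∈ (chartAt E x₀).source := by
        simpa using (extChartAt 𝓘(ℝ, E) x₀).map_target hy
      exact (h2 _ hy').symm
    · intro h
      rw [← contMDiffOn_iff_contDiffOn] at h
      have h3 := h.comp (contMDiffOn_extChartAt (x := x₀)) (fun x hx =>
        (extChartAt 𝓘(ℝ, E) x₀).map_source (by simpa using hx))
      refine h3.congr fun x hx => ?_
      rw [h2 x hx]
      simp only [fieldInChart, Function.comp_def]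
      rw [(extChartAt 𝓘(ℝ, E) x₀).left_inv (by simpa using hx)]
  constructor
  · exact fun h x₀ => (key x₀).1 h.contMDiffOn
  · exact fun h x₀ => ((key x₀).2 (h x₀)).contMDiffAt
      ((chartAt E x₀).open_source.mem_nhds (mem_chart_source E x₀))

end Charts

/-! ### Local flows of vector fields depending linearly on a parameter -/

section LocalTransport

variable {E : Type*} [NormedAddCommGroup E] [NormedSpace ℝ E] [FiniteDimensional ℝ E]
  {M : Type*} [TopologicalSpace M] [ChartedSpace E M] [IsManifold 𝓘(ℝ, E) ∞ M]
  {P : Type*} [NormedAddCommGroup P] [NormedSpace ℝ P] [FiniteDimensional ℝ P]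

/-- A family of vector fields on `M` depending linearly on a parameter is smooth. -/
def SmoothFieldFamily (V : ∀ x : M, P →L[ℝ] TangentSpace 𝓘(ℝ, E) x) : Prop :=
  ∀ z, ContMDiff 𝓘(ℝ, E) 𝓘(ℝ, E).tangent ∞ (fun x => (⟨x, V x z⟩ : TangentBundle 𝓘(ℝ, E) M))

lemma isMIntegralCurveOn_symm_comp {X : ∀ x : M, TangentSpace 𝓘(ℝ, E) x} {x₀ : M} {c : ℝ → E}
    {a b : ℝ} (hc : ∀ t ∈ Ioo a b, c t ∈ (extChartAt 𝓘(ℝ, E) x₀).target ∧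
      HasDerivAt c (fieldInChart X x₀ (c t)) t) :
    IsMIntegralCurveOn (I := 𝓘(ℝ, E)) ((extChartAt 𝓘(ℝ, E) x₀).symm ∘ c) X (Ioo a b) := by
  intro t ht
  obtain ⟨h1, h2⟩ := hc t ht
  have h3 := (mdifferentiableAt_symm_chart h1).hasMFDerivAt.comp t h2.hasFDerivAt.hasMFDerivAt
  refine HasMFDerivAt.hasMFDerivWithinAt ?_
  refine h3.congr_mfderiv ?_
  refine ContinuousLinearMap.ext_ring ?_
  have h4 := mfderiv_symm_fieldInChart X h1
  change mfderiv 𝓘(ℝ, E) 𝓘(ℝ, E) (extChartAt 𝓘(ℝ, E) x₀).symm (c t)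
    ((1 : ℝ) • (fieldInChart X x₀ (c t))) = (1 : ℝ) • X ((extChartAt 𝓘(ℝ, E) x₀).symm (c t))
  rw [one_smul, one_smul]
  exact h4

/-- The expression of a smooth family of vector fields in a chart. -/
noncomputable def familyInChart (V : ∀ x : M, P →L[ℝ] TangentSpace 𝓘(ℝ, E) x) (x₀ : M) (y : E) :
    P →L[ℝ] E :=
  (mfderiv 𝓘(ℝ, E) 𝓘(ℝ, E) (extChartAt 𝓘(ℝ, E) x₀) ((extChartAt 𝓘(ℝ, E) x₀).symm y)).comp
    (V ((extChartAt 𝓘(ℝ, E) x₀).symm y))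

lemma SmoothFieldFamily.contDiffOn {V : ∀ x : M, P →L[ℝ] TangentSpace 𝓘(ℝ, E) x}
    (hV : SmoothFieldFamily V) (x₀ : M) :
    ContDiffOn ℝ ∞ (familyInChart V x₀) (extChartAt 𝓘(ℝ, E) x₀).target :=
  contDiffOn_clm_apply.2 fun z => (contMDiff_field_iff _).1 (hV z) x₀

/-- Solutions of the equations `γ' = V(γ) z` exist on a fixed interval for small `z`, and depend
smoothly on the initial point and on `z`. -/
theorem SmoothFieldFamily.exists_local_transport {V : ∀ x : M, P →L[ℝ] TangentSpace 𝓘(ℝ, E) x}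
    (hV : SmoothFieldFamily V) (x₀ : M) {n : ℕ} (hn : n ≠ 0) :
    ∃ ξ : M × P → M, ContMDiffAt (𝓘(ℝ, E).prod 𝓘(ℝ, P)) 𝓘(ℝ, E) n ξ (x₀, 0) ∧
      ∀ᶠ q in 𝓝 (x₀, (0 : P)), ∃ γ : ℝ → M, γ 0 = q.1 ∧ γ 1 = ξ q ∧
        IsMIntegralCurveOn (I := 𝓘(ℝ, E)) γ (fun x => V x q.2) (Ioo (-2) 2) := by
  have hlt : (-2 : ℝ) ≤ 2 := by norm_num
  set φ := extChartAt 𝓘(ℝ, E) x₀ with hφ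
  have htar : φ.target ∈ 𝓝 (φ x₀) := extChartAt_target_mem_nhds x₀
  obtain ⟨r, hr, hball⟩ := Metric.nhds_basis_closedBall.mem_iff.1 htar
  -- The cutoff extends the field from the chart to all of `E` without changing it on the ball of
  -- radius `r / 2`.
  let χ : ContDiffBump (φ x₀) := ⟨r / 2, r, by positivity, by linarith⟩
  let W : E → P →L[ℝ] E := fun y => χ y • familyInChart V x₀ y
  have hW : ContDiff ℝ n W := by
    refine contDiff_iff_contDiffAt.2 fun y => ?_
    by_cases hy : y ∈ φ.target
    · exact χ.contDiff.contDiffAt.smul (((hV.contDiffOn x₀).contDiffAt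
        ((isOpen_extChartAt_target x₀).mem_nhds hy)).of_le (by exact_mod_cast le_top))
    · have : y ∉ tsupport χ := by
        rw [χ.tsupport_eq]
        exact fun h => hy (hball h)
      have h0 : W =ᶠ[𝓝 y] fun _ => 0 := by
        filter_upwards [notMem_tsupport_iff_eventuallyEq.1 this] with z hz
        simp [W, hz]
      exact contDiffAt_const.congr_of_eventuallyEq h0
  obtain ⟨Γ, hΓ, hΓ₀, hev⟩ := exists_contDiffAt_solution hn W hW (φ x₀)
  let q' : M × P → E × P := fun q => (φ q.1, q.2)
  have hq' : ContMDiffAt (𝓘(ℝ, E).prod 𝓘(ℝ, P)) 𝓘(ℝ, E × P) n q' (x₀, 0) := by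
    rw [modelWithCornersSelf_prod, ← chartedSpaceSelf_prod]
    exact ((contMDiffAt_extChartAt).comp (x₀, (0 : P)) contMDiffAt_fst).prodMk contMDiffAt_snd
  have hΓ1 : ContMDiffAt (𝓘(ℝ, E).prod 𝓘(ℝ, P)) 𝓘(ℝ, C(Icc (-2 : ℝ) 2, E)) n (Γ ∘ q') (x₀, 0) :=
    ContMDiffAt.comp (x₀, (0 : P)) hΓ.contMDiffAt hq'
  let e : C(Icc (-2 : ℝ) 2, E) →L[ℝ] E := ContinuousMap.evalCLM ℝ ⟨1, by norm_num, by norm_num⟩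
  have he : ContMDiffAt (𝓘(ℝ, E).prod 𝓘(ℝ, P)) 𝓘(ℝ, E) n (fun q => e (Γ (q' q))) (x₀, 0) :=
    ContMDiffAt.comp (x₀, (0 : P)) e.contMDiff.contMDiffAt hΓ1
  have he0 : e (Γ (q' (x₀, 0))) = φ x₀ := by simp [q', hΓ₀, e]
  refine ⟨fun q => φ.symm (e (Γ (q' q))), ?_, ?_⟩
  · refine ContMDiffAt.comp (x₀, (0 : P)) (g := φ.symm) ?_ he
    rw [he0]
    exact (contMDiffAt_extChartAt_symm (mem_of_mem_nhds htar)).of_le (by exact_mod_cast le_top)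
  -- `Γ` is continuous into the sup norm and constant in time at the base point, so nearby solutions
  -- stay where `χ = 1` and solve the original equation.
  · have h1 : ∀ᶠ q in 𝓝 (x₀, (0 : P)), Γ (q' q) ∈ Metric.ball (ContinuousMap.const _ (φ x₀)) (r / 2) := by
      refine hΓ1.continuousAt.eventually (Metric.isOpen_ball.mem_nhds ?_)
      simp only [Function.comp_apply, q', hΓ₀]
      exact Metric.mem_ball_self (by positivity)
    have h2 : ∀ᶠ q : M × P in 𝓝 (x₀, (0 : P)), q.1 ∈ φ.source :=
      continuousAt_fst.eventually (extChartAt_source_mem_nhds (I := 𝓘(ℝ, E)) x₀)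
    filter_upwards [h1, h2, hq'.continuousAt.eventually hev] with q hq1 hq2 hq3
    obtain ⟨hq3, hq4⟩ := hq3
    set c := IccExtend hlt (Γ (q' q))
    have hcball : ∀ t, c t ∈ Metric.ball (φ x₀) (r / 2) := fun t =>
      lt_of_le_of_lt (ContinuousMap.dist_apply_le_dist
        (f := Γ (q' q)) (g := ContinuousMap.const _ (φ x₀)) (projIcc _ _ hlt t)) hq1
    refine ⟨φ.symm ∘ c, ?_, ?_, ?_⟩
    · simp only [Function.comp_apply, hq3, q']
      exact φ.left_inv hq2
    · simp only [Function.comp_apply, c, e]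
      rw [IccExtend_of_mem _ _ (⟨by norm_num, by norm_num⟩ : (1 : ℝ) ∈ Icc (-2 : ℝ) 2)]
      rfl
    · refine isMIntegralCurveOn_symm_comp fun t ht => ⟨hball ?_, ?_⟩
      · exact Metric.ball_subset_closedBall (Metric.ball_subset_ball (by linarith) (hcball t))
      · have := hq4 t ht
        have hχ : χ (c t) = 1 := χ.one_of_mem_closedBall (Metric.ball_subset_closedBall (hcball t))
        simp only [W] at this
        rw [hχ, one_smul] at this
        exact this

end LocalTransport

/-! ### Global flows and completeness -/

section GlobalTransport

variable {E : Type*} [NormedAddCommGroup E] [NormedSpace ℝ E] [FiniteDimensional ℝ E]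
  {M : Type*} [TopologicalSpace M] [ChartedSpace E M] [IsManifold 𝓘(ℝ, E) ∞ M] [T2Space M]
  {P : Type*} [NormedAddCommGroup P] [NormedSpace ℝ P] [FiniteDimensional ℝ P]
  {V : ∀ x : M, P →L[ℝ] TangentSpace 𝓘(ℝ, E) x}

/-- A complete smooth linear family of vector fields has a smooth transport map: the point reached
at time `1` depends smoothly on the initial point and the parameter. -/
theorem SmoothFieldFamily.exists_transport (hV : SmoothFieldFamily V)
    (hcomplete : ∀ m z, ∃ γ : ℝ → M, γ 0 = m ∧ IsMIntegralCurve (I := 𝓘(ℝ, E)) γ fun x => V x z) :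
    ∃ Ξ : M × P → M, ContMDiff (𝓘(ℝ, E).prod 𝓘(ℝ, P)) 𝓘(ℝ, E) ∞ Ξ ∧
      ∀ z (γ : ℝ → M), IsMIntegralCurve (I := 𝓘(ℝ, E)) γ (fun x => V x z) →
        γ 1 = Ξ (γ 0, z) := by
  choose G hG0 hG using hcomplete
  have hV1 : ∀ z, ContMDiff 𝓘(ℝ, E) 𝓘(ℝ, E).tangent 1
      (fun x => (⟨x, V x z⟩ : TangentBundle 𝓘(ℝ, E) M)) :=
    fun z => (hV z).of_le (by exact_mod_cast le_top)
  have huniq : ∀ z (γ : ℝ → M), IsMIntegralCurve (I := 𝓘(ℝ, E)) γ (fun x => V x z) →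
      γ = G (γ 0) z := fun z γ hγ =>
    isMIntegralCurve_Ioo_eq_of_contMDiff_boundaryless (t₀ := 0) (hV1 z) hγ (hG _ _) (hG0 _ _).symm
  -- By linearity in `z`, scaling the parameter is scaling the time. Hence smoothness near `z = 0`
  -- is smoothness for short times.
  have hscale : ∀ m z s t, G m (s • z) t = G m z (t * s) := by
    intro m z s t
    have h1 := (hG m z).comp_mul s
    have h2 : (s • fun x => V x z) = fun x => V x (s • z) := by
      funext x
      exact ((V x).map_smul s z).symm
    rw [h2] at h1
    have h3 := huniq _ _ h1
    simp only [Function.comp_apply, zero_mul, hG0] at h3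
    rw [← h3]
    rfl
  have hadd : ∀ m z s t, G m z (t + s) = G (G m z s) z t := by
    intro m z s t
    have h3 := huniq _ _ ((hG m z).comp_add s)
    simp only [Function.comp_apply, zero_add] at h3
    rw [← h3]
    rfl
  refine ⟨fun q => G q.1 q.2 1, ?_, fun z γ hγ => congrFun (huniq z γ hγ) 1⟩
  set Ξ : M × P → M := fun q => G q.1 q.2 1 with hΞ
  refine contMDiff_infty.2 fun n' => ?_
  -- The order is raised by one because the local theorem needs a nonzero order.
  suffices h : ContMDiff (𝓘(ℝ, E).prod 𝓘(ℝ, P)) 𝓘(ℝ, E) ((n' + 1 : ℕ) : WithTop ℕ∞) Ξ from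
    h.of_le (by exact_mod_cast Nat.le_succ n')
  set n := n' + 1 with hn
  have : IsManifold 𝓘(ℝ, E) n M := IsManifold.of_le (n := ∞) (by exact_mod_cast le_top)
  have hlocal : ∀ x : M, ContMDiffAt (𝓘(ℝ, E).prod 𝓘(ℝ, P)) 𝓘(ℝ, E) n Ξ (x, 0) := by
    intro x
    obtain ⟨ξ, hξ, hev⟩ := hV.exists_local_transport x (n := n) (by omega)
    refine hξ.congr_of_eventuallyEq ?_
    filter_upwards [hev] with q hq
    obtain ⟨γ, h0, h1, hγ⟩ := hq
    rw [← h1]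
    exact (isMIntegralCurveOn_Ioo_eqOn_of_contMDiff_boundaryless (t₀ := 0) (by norm_num)
      (hV1 q.2) hγ ((hG q.1 q.2).isMIntegralCurveOn _) (by rw [h0, hG0]) (by norm_num)).symm
  rintro ⟨m₀, z₀⟩
  have hK : IsCompact (G m₀ z₀ '' Icc 0 1) :=
    isCompact_Icc.image (hG m₀ z₀).continuous
  -- Compactness of the trajectory on `[0, 1]` gives one bound on the parameter valid at all its
  -- points.
  have hunif : ∀ᶠ z in 𝓝 (0 : P), ∀ x ∈ G m₀ z₀ '' Icc 0 1,
      ContMDiffAt (𝓘(ℝ, E).prod 𝓘(ℝ, P)) 𝓘(ℝ, E) n Ξ (x, z) :=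
    hK.eventually_forall_of_forall_eventually fun x _ =>
      (continuous_swap.tendsto ((0 : P), x)).eventually
        ((contMDiffAt_iff_contMDiffAt_nhds (by simp)).1 (hlocal x))
  have hlim : Tendsto (fun N : ℕ => ((N : ℝ) + 1)⁻¹ • z₀) atTop (𝓝 0) := by
    have := (tendsto_one_div_add_atTop_nhds_zero_nat (𝕜 := ℝ)).smul_const z₀
    simpa using this
  obtain ⟨N, hN⟩ := (hlim.eventually hunif).exists
  set s : ℝ := ((N : ℝ) + 1)⁻¹ with hs
  have hs0 : 0 < s := by positivity
  have hNs : ((N + 1 : ℕ) : ℝ) * s = 1 := by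
    rw [hs]; push_cast; field_simp
  -- The time-one map is the composition of `N + 1` flows with the small parameter `s • z`, each
  -- smooth at the point already reached.
  have hstep : ∀ i : ℕ, i ≤ N + 1 → ContMDiffAt (𝓘(ℝ, E).prod 𝓘(ℝ, P)) 𝓘(ℝ, E) n
      (fun q : M × P => G q.1 q.2 (i * s)) (m₀, z₀) := by
    intro i
    induction i with
    | zero =>
      intro _
      simp only [Nat.cast_zero, zero_mul, hG0]
      exact contMDiffAt_fst
    | succ i ih =>
      intro hi
      have h1 := ih (by omega)
      have heq : (fun q : M × P => G q.1 q.2 ((i + 1 : ℕ) * s)) =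
          fun q => Ξ (G q.1 q.2 (i * s), s • q.2) := by
        funext q
        simp only [hΞ]
        rw [hscale, one_mul, ← hadd]
        congr 1
        push_cast
        ring
      rw [heq]
      refine ContMDiffAt.comp (m₀, z₀) (g := Ξ) (hN _ ⟨i * s, ⟨by positivity, ?_⟩, rfl⟩)
        (h1.prodMk ?_)
      · rw [← hNs]
        gcongr
        omega
      · exact ((s • ContinuousLinearMap.id ℝ P).contMDiff.contMDiffAt).comp (m₀, z₀) contMDiffAt_snd
  have := hstep (N + 1) le_rfl
  rw [hNs] at this
  exact this

lemma SmoothFieldFamily.smul {V : ∀ x : M, P →L[ℝ] TangentSpace 𝓘(ℝ, E) x}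
    (hV : SmoothFieldFamily V) {g : M → ℝ} (hg : ContMDiff 𝓘(ℝ, E) 𝓘(ℝ, ℝ) ∞ g) :
    SmoothFieldFamily (fun x => g x • V x) :=
  fun z => hg.smul_section (hV z)

/-- A smooth linear family of vector fields vanishing outside a compact set is complete. -/
theorem SmoothFieldFamily.complete_of_compact (hV : SmoothFieldFamily V) {K : Set M}
    (hK : IsCompact K) (hVK : ∀ x ∉ K, V x = 0) (m : M) (z : P) :
    ∃ γ : ℝ → M, γ 0 = m ∧ IsMIntegralCurve (I := 𝓘(ℝ, E)) γ fun x => V x z := by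
  have hunif : ∀ᶠ z in 𝓝 (0 : P), ∀ x ∈ K, ∃ γ : ℝ → M, γ 0 = x ∧
      IsMIntegralCurveOn (I := 𝓘(ℝ, E)) γ (fun x => V x z) (Ioo (-2) 2) := by
    refine hK.eventually_forall_of_forall_eventually fun x _ => ?_
    obtain ⟨ξ, -, hev⟩ := hV.exists_local_transport x (n := 1) one_ne_zero
    filter_upwards [(continuous_swap.tendsto ((0 : P), x)).eventually hev] with q hq
    obtain ⟨γ, h0, -, hγ⟩ := hq
    exact ⟨γ, h0, hγ⟩
  have hlim : Tendsto (fun N : ℕ => ((N : ℝ) + 1)⁻¹ • z) atTop (𝓝 0) := by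
    have := (tendsto_one_div_add_atTop_nhds_zero_nat (𝕜 := ℝ)).smul_const z
    simpa using this
  obtain ⟨N, hN⟩ := (hlim.eventually hunif).exists
  have hN1 : (0 : ℝ) < (N : ℝ) + 1 := by positivity
  -- On `K` the flow of `z / (N + 1)` exists on `(-2, 2)`, so that of `z` exists for time `2 / (N +
  -- 1)`. Off `K` the curves are constant. A uniform existence time implies completeness.
  refine exists_isMIntegralCurve_of_isMIntegralCurveOn (ε := 2 * ((N : ℝ) + 1)⁻¹)
    ((hV z).of_le (by exact_mod_cast le_top)) (by positivity) (fun x => ?_) m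
  by_cases hx : x ∈ K
  · obtain ⟨γ, h0, hγ⟩ := hN x hx
    refine ⟨γ ∘ (· * ((N : ℝ) + 1)), by simp [h0], ?_⟩
    have h1 := hγ.comp_mul ((N : ℝ) + 1)
    have h2 : (((N : ℝ) + 1) • fun x => V x (((N : ℝ) + 1)⁻¹ • z)) = fun x => V x z := by
      funext x
      have := (V x).map_smul ((N : ℝ) + 1) (((N : ℝ) + 1)⁻¹ • z)
      rw [smul_inv_smul₀ hN1.ne'] at this
      exact this.symm
    rw [h2] at h1
    refine h1.mono fun t ht => ?_
    have e : 2 * ((N : ℝ) + 1)⁻¹ * ((N : ℝ) + 1) = 2 := by field_simp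
    constructor
    · have := mul_lt_mul_of_pos_right ht.1 hN1
      linarith
    · have := mul_lt_mul_of_pos_right ht.2 hN1
      linarith
  · refine ⟨fun _ => x, rfl, (isMIntegralCurve_const ?_).isMIntegralCurveOn _⟩
    rw [hVK x hx]
    rfl

lemma hasDerivAt_comp_integralCurve {F : Type*} [NormedAddCommGroup F] [NormedSpace ℝ F]
    {X : ∀ x : M, TangentSpace 𝓘(ℝ, E) x} {γ : ℝ → M} {t : ℝ}
    (hγ : HasMFDerivAt 𝓘(ℝ, ℝ) 𝓘(ℝ, E) γ t ((1 : ℝ →L[ℝ] ℝ).smulRight (X (γ t)))) {p : M → F}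
    (hp : MDifferentiableAt 𝓘(ℝ, E) 𝓘(ℝ, F) p (γ t)) :
    HasDerivAt (fun t => p (γ t)) (mfderiv 𝓘(ℝ, E) 𝓘(ℝ, F) p (γ t) (X (γ t)) : F) t := by
  let L : ℝ →L[ℝ] F := (mfderiv 𝓘(ℝ, E) 𝓘(ℝ, F) p (γ t)).comp
    ((1 : ℝ →L[ℝ] ℝ).smulRight (X (γ t)))
  have h1 : HasFDerivAt (fun t => p (γ t)) L t := (hp.hasMFDerivAt.comp t hγ).hasFDerivAt
  have h2 : L 1 = mfderiv 𝓘(ℝ, E) 𝓘(ℝ, F) p (γ t) (X (γ t)) := by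
    change mfderiv 𝓘(ℝ, E) 𝓘(ℝ, F) p (γ t) ((1 : ℝ) • X (γ t)) = _
    rw [one_smul]
  exact h1.hasDerivAt.congr_deriv h2

/-- A smooth linear family of vector fields lifting the constant vector fields along a proper map
is complete. -/
theorem SmoothFieldFamily.complete_of_proper {p : M → P} (hV : SmoothFieldFamily V)
    (hp : ContMDiff 𝓘(ℝ, E) 𝓘(ℝ, P) ∞ p) (hproper : IsProperMap p)
    (hpV : ∀ x z, mfderiv 𝓘(ℝ, E) 𝓘(ℝ, P) p x (V x z) = z) (m : M) (z : P) :
    ∃ γ : ℝ → M, γ 0 = m ∧ IsMIntegralCurve (I := 𝓘(ℝ, E)) γ fun x => V x z := by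
  rw [exists_isMIntegralCurve_iff_exists_isMIntegralCurveOn_Ioo
    ((hV z).of_le (by exact_mod_cast le_top))]
  intro a
  -- The image under `p` of the cut-off curve has speed at most `‖z‖`. Up to time `|a|` it therefore
  -- stays in the ball of radius `R`, where the cutoff is `1` and the field is the original one.
  let R : ℝ := ‖p m‖ + |a| * ‖z‖ + 1
  have hR : 0 < R := by positivity
  let χ : ContDiffBump (0 : P) := ⟨R, R + 1, hR, by linarith⟩
  have hχp : ContMDiff 𝓘(ℝ, E) 𝓘(ℝ, ℝ) ∞ (fun x => χ (p x)) := χ.contDiff.contMDiff.comp hp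
  have hK : IsCompact (p ⁻¹' Metric.closedBall 0 (R + 1)) :=
    hproper.isCompact_preimage (isCompact_closedBall _ _)
  obtain ⟨γ, h0, hγ⟩ := (hV.smul hχp).complete_of_compact hK (fun x hx => by
    have : χ (p x) = 0 := χ.zero_of_le_dist (by
      simp only [mem_preimage, Metric.mem_closedBall, not_le] at hx
      exact hx.le)
    simp [this]) m z
  have hpd : ∀ t, HasDerivAt (fun t => p (γ t)) (χ (p (γ t)) • z) t := by
    intro t
    have h1 := hasDerivAt_comp_integralCurve (X := fun x => (χ (p x) • V x) z) (hγ t)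
      ((hp (γ t)).mdifferentiableAt (by simp))
    have h2 := (mfderiv 𝓘(ℝ, E) 𝓘(ℝ, P) p (γ t)).map_smul (χ (p (γ t))) (V (γ t) z)
    rw [hpV] at h2
    exact h1.congr_deriv h2
  have hbound : ∀ t, ‖p (γ t) - p m‖ ≤ ‖z‖ * |t| := by
    intro t
    have := convex_univ.norm_image_sub_le_of_norm_hasDerivWithin_le (C := ‖z‖) (x := 0) (y := t)
      (fun s _ => (hpd s).hasDerivWithinAt) (fun s _ => by
        rw [norm_smul, Real.norm_of_nonneg χ.nonneg]
        exact mul_le_of_le_one_left (norm_nonneg _) χ.le_one) (mem_univ _) (mem_univ _)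
    simpa [h0] using this
  refine ⟨γ, h0, fun t ht => ?_⟩
  have hχ1 : χ (p (γ t)) = 1 := by
    refine χ.one_of_mem_closedBall ?_
    rw [mem_closedBall_zero_iff]
    have h1 := hbound t
    have h2 : ‖p (γ t)‖ ≤ ‖p (γ t) - p m‖ + ‖p m‖ := by
      simpa using norm_add_le (p (γ t) - p m) (p m)
    have h3 : |t| ≤ |a| := (abs_lt.2 ht).le.trans (le_abs_self a)
    have h4 : ‖z‖ * |t| ≤ |a| * ‖z‖ := by
      rw [mul_comm]; gcongr
    change _ ≤ ‖p m‖ + |a| * ‖z‖ + 1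
    linarith
  have h5 : (χ (p (γ t)) • V (γ t)) z = V (γ t) z := by rw [hχ1, one_smul]
  have h6 := hγ t
  simp only [h5] at h6
  exact h6.hasMFDerivWithinAt

end GlobalTransport

/-! ### Duality for nondegenerate 2-forms on a vector space -/

section Sharp

variable {E : Type*} [NormedAddCommGroup E] [NormedSpace ℝ E]

lemma form_swap (η : E [⋀^Fin 2]→L[ℝ] ℝ) (v w : E) : η ![v, w] = -η ![w, v] := by
  have h1 := η.map_swap ![w, v] (i := 0) (j := 1) (by simp)
  have h2 : ![w, v] ∘ ⇑(Equiv.swap (0 : Fin 2) 1) = ![v, w] := by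
    ext i
    fin_cases i <;> rfl
  rw [h2] at h1
  exact h1

/-- The bilinear form underlying a `2`-form on a vector space. -/
noncomputable def formFlat (η : E [⋀^Fin 2]→L[ℝ] ℝ) : E →L[ℝ] E →L[ℝ] ℝ :=
  LinearMap.mkContinuous₂
    (LinearMap.mk₂ ℝ (fun v w => η ![v, w])
      (fun v v' w => η.map_vecCons_add ![w] v v')
      (fun c v w => η.map_vecCons_smul ![w] c v)
      (fun v w w' => by
        have h : ∀ u, η ![v, u] = -η ![u, v] := form_swap η v
        rw [h, h, h, show η ![w + w', v] = _ from η.map_vecCons_add ![v] w w']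
        exact neg_add _ _)
      (fun c v w => by
        have h : ∀ u, η ![v, u] = -η ![u, v] := form_swap η v
        rw [h, h, show η ![c • w, v] = _ from η.map_vecCons_smul ![v] c w]
        exact (smul_neg _ _).symm))
    ‖η‖ (fun v w => by
      have := η.le_opNorm ![v, w]
      simpa [Fin.prod_univ_two, mul_assoc] using this)

@[simp] lemma formFlat_apply (η : E [⋀^Fin 2]→L[ℝ] ℝ) (v w : E) :
    formFlat η v w = η ![v, w] := rfl

lemma form_self (η : E [⋀^Fin 2]→L[ℝ] ℝ) (v : E) : η ![v, v] = 0 :=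
  η.map_eq_zero_of_eq _ (i := 0) (j := 1) (by simp) (by simp)

lemma contDiffOn_form_apply {E' : Type*} [NormedAddCommGroup E'] [NormedSpace ℝ E']
    {α : E' → E [⋀^Fin 2]→L[ℝ] ℝ} {s : Set E'} {n : WithTop ℕ∞} (hα : ContDiffOn ℝ n α s)
    (u : Fin 2 → E) : ContDiffOn ℝ n (fun y => α y u) s := by
  have h1 : IsBoundedLinearMap ℝ (fun η : E [⋀^Fin 2]→L[ℝ] ℝ => η u) :=
    IsLinearMap.with_bound ⟨fun _ _ => rfl, fun _ _ => rfl⟩ (∏ i, ‖u i‖)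
      (fun η => by rw [mul_comm]; exact η.le_opNorm u)
  exact h1.contDiff.comp_contDiffOn hα

variable [FiniteDimensional ℝ E]

lemma contDiffOn_formFlat {E' : Type*} [NormedAddCommGroup E'] [NormedSpace ℝ E']
    {α : E' → E [⋀^Fin 2]→L[ℝ] ℝ} {s : Set E'} {n : WithTop ℕ∞} (hα : ContDiffOn ℝ n α s) :
    ContDiffOn ℝ n (fun y => formFlat (α y)) s :=
  contDiffOn_clm_apply.2 fun v => contDiffOn_clm_apply.2 fun w => contDiffOn_form_apply hα ![v, w]

/-- A `2`-form on a vector space is nondegenerate. -/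
def FormNondegenerate (η : E [⋀^Fin 2]→L[ℝ] ℝ) : Prop := ∀ v, (∀ w, η ![v, w] = 0) → v = 0

lemma FormNondegenerate.exists_equiv {η : E [⋀^Fin 2]→L[ℝ] ℝ} (hη : FormNondegenerate η) :
    ∃ e : E ≃L[ℝ] (E →L[ℝ] ℝ), (e : E →L[ℝ] (E →L[ℝ] ℝ)) = formFlat η := by
  have hinj : Function.Injective (formFlat η : E →ₗ[ℝ] (E →L[ℝ] ℝ)) := by
    rw [← LinearMap.ker_eq_bot, LinearMap.ker_eq_bot']
    intro v hv
    refine hη v fun w => ?_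
    have := congrArg (fun L : E →L[ℝ] ℝ => L w) hv
    simpa using this
  have hdim : Module.finrank ℝ E = Module.finrank ℝ (E →L[ℝ] ℝ) := by
    rw [← (LinearMap.toContinuousLinearMap (𝕜 := ℝ) (E := E) (F' := ℝ)).finrank_eq]
    exact (Subspace.dual_finrank_eq (K := ℝ) (V := E)).symm
  refine ⟨(LinearEquiv.ofInjectiveOfFinrankEq _ hinj hdim).toContinuousLinearEquiv, ?_⟩
  ext v w
  rfl

/-- The vector dual to a linear form under a nondegenerate `2`-form. -/
noncomputable def formSharp (η : E [⋀^Fin 2]→L[ℝ] ℝ) (ℓ : E →L[ℝ] ℝ) : E :=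
  (formFlat η).inverse ℓ

lemma FormNondegenerate.apply_sharp {η : E [⋀^Fin 2]→L[ℝ] ℝ} (hη : FormNondegenerate η)
    (ℓ : E →L[ℝ] ℝ) (w : E) : η ![formSharp η ℓ, w] = ℓ w := by
  obtain ⟨e, he⟩ := hη.exists_equiv
  rw [← formFlat_apply, formSharp, ← he, ContinuousLinearMap.inverse_equiv]
  simp

lemma FormNondegenerate.eq_sharp {η : E [⋀^Fin 2]→L[ℝ] ℝ} (hη : FormNondegenerate η)
    {ℓ : E →L[ℝ] ℝ} {v : E} (h : ∀ w, η ![v, w] = ℓ w) : v = formSharp η ℓ := by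
  rw [← sub_eq_zero]
  refine hη _ fun w => ?_
  rw [← formFlat_apply, map_sub, sub_apply, formFlat_apply, formFlat_apply,
    h, hη.apply_sharp, sub_self]

/-- Inversion of continuous linear maps is smooth at every invertible map, and nondegeneracy in
finite dimension makes `formFlat` invertible. -/
lemma contDiffOn_formSharp {E' : Type*} [NormedAddCommGroup E'] [NormedSpace ℝ E']
    {α : E' → E [⋀^Fin 2]→L[ℝ] ℝ} {ℓ : E' → E →L[ℝ] ℝ} {s : Set E'} {n : WithTop ℕ∞}
    (hα : ContDiffOn ℝ n α s) (hℓ : ContDiffOn ℝ n ℓ s) (hnd : ∀ y ∈ s, FormNondegenerate (α y)) :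
    ContDiffOn ℝ n (fun y => formSharp (α y) (ℓ y)) s := by
  refine ContDiffOn.clm_apply (fun y hy => ?_) hℓ
  obtain ⟨e, he⟩ := (hnd y hy).exists_equiv
  have h : ContDiffAt ℝ n (ContinuousLinearMap.inverse : (E →L[ℝ] E →L[ℝ] ℝ) → _)
      (formFlat (α y)) := he ▸ contDiffAt_map_inverse e
  exact h.comp_contDiffWithinAt y (contDiffOn_formFlat hα y hy)

end Sharp

/-! ### Hamiltonian vector fields and their smoothness -/

section Dual

variable {E : Type*} [NormedAddCommGroup E] [NormedSpace ℝ E] [FiniteDimensional ℝ E]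
  {M : Type*} [TopologicalSpace M] [ChartedSpace E M] [IsManifold 𝓘(ℝ, E) ∞ M]
  {Ω : DiffForm 𝓘(ℝ, E) M 2}

lemma DiffForm.pullback_apply_two {E : Type*} [NormedAddCommGroup E] [NormedSpace ℝ E]
    {H : Type*} [TopologicalSpace H] {I : ModelWithCorners ℝ E H}
    {M : Type*} [TopologicalSpace M] [ChartedSpace H M]
    {E' : Type*} [NormedAddCommGroup E'] [NormedSpace ℝ E']
    {H' : Type*} [TopologicalSpace H'] {I' : ModelWithCorners ℝ E' H'}
    {M' : Type*} [TopologicalSpace M'] [ChartedSpace H' M']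
    (f : M → M') (α : DiffForm I' M' 2) (x : M) (v w : TangentSpace I x) :
    DiffForm.pullback I I' f α x ![v, w] = α (f x) ![mfderiv I I' f x v, mfderiv I I' f x w] := by
  change α (f x) (mfderiv I I' f x ∘ ![v, w]) = _
  congr 1
  ext i
  fin_cases i <;> rfl

/-- The vector field dual to the differential of a function under a symplectic form. -/
noncomputable def hamiltonianField (Ω : DiffForm 𝓘(ℝ, E) M 2) (g : M → ℝ) (x : M) :
    TangentSpace 𝓘(ℝ, E) x :=
  formSharp (E := E) (Ω x) (mfderiv 𝓘(ℝ, E) 𝓘(ℝ, ℝ) g x)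

lemma IsSymplecticForm.apply_hamiltonianField (hΩ : IsSymplecticForm 𝓘(ℝ, E) Ω) (g : M → ℝ) (x : M)
    (w : TangentSpace 𝓘(ℝ, E) x) :
    Ω x ![hamiltonianField Ω g x, w] = mfderiv 𝓘(ℝ, E) 𝓘(ℝ, ℝ) g x w :=
  FormNondegenerate.apply_sharp (E := E) (hΩ.nondegenerate x) _ w

lemma IsSymplecticForm.inChart_nondegenerate (hΩ : IsSymplecticForm 𝓘(ℝ, E) Ω) {x₀ : M} {y : E}
    (hy : y ∈ (extChartAt 𝓘(ℝ, E) x₀).target) :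
    FormNondegenerate (DiffForm.inChart 𝓘(ℝ, E) Ω x₀ y) := by
  intro v hv
  have h1 := hΩ.nondegenerate _
    (mfderiv 𝓘(ℝ, E) 𝓘(ℝ, E) (extChartAt 𝓘(ℝ, E) x₀).symm y v) (fun w => by
      have h2 := hv (mfderiv 𝓘(ℝ, E) 𝓘(ℝ, E) (extChartAt 𝓘(ℝ, E) x₀)
        ((extChartAt 𝓘(ℝ, E) x₀).symm y) w)
      have h3 := DiffForm.pullback_apply_two (I := 𝓘(ℝ, E)) (I' := 𝓘(ℝ, E))
        (extChartAt 𝓘(ℝ, E) x₀).symm Ω y v (mfderiv 𝓘(ℝ, E) 𝓘(ℝ, E) (extChartAt 𝓘(ℝ, E) x₀)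
        ((extChartAt 𝓘(ℝ, E) x₀).symm y) w)
      rw [mfderiv_symm_mfderiv_extChartAt hy] at h3
      exact h3.symm.trans h2)
  have h3 := mfderiv_extChartAt_mfderiv_symm hy v
  rw [h1] at h3
  exact h3.symm.trans (map_zero (mfderiv 𝓘(ℝ, E) 𝓘(ℝ, E) (extChartAt 𝓘(ℝ, E) x₀)
        ((extChartAt 𝓘(ℝ, E) x₀).symm y)))

lemma mfderiv_comp_symm_chart {F : Type*} [NormedAddCommGroup F] [NormedSpace ℝ F] {g : M → F}
    {x₀ : M} {y : E} (hy : y ∈ (extChartAt 𝓘(ℝ, E) x₀).target)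
    (hg : MDifferentiableAt 𝓘(ℝ, E) 𝓘(ℝ, F) g ((extChartAt 𝓘(ℝ, E) x₀).symm y)) (w : E) :
    fderiv ℝ (g ∘ (extChartAt 𝓘(ℝ, E) x₀).symm) y w =
      mfderiv 𝓘(ℝ, E) 𝓘(ℝ, F) g ((extChartAt 𝓘(ℝ, E) x₀).symm y)
        (mfderiv 𝓘(ℝ, E) 𝓘(ℝ, E) (extChartAt 𝓘(ℝ, E) x₀).symm y w) := by
  rw [← mfderiv_eq_fderiv, mfderiv_comp y hg (mdifferentiableAt_symm_chart hy)]
  rfl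

/-- Both sides have the same pairing with every vector under the form in the chart, and
nondegeneracy makes the dual vector unique. -/
lemma IsSymplecticForm.hamiltonianField_inChart (hΩ : IsSymplecticForm 𝓘(ℝ, E) Ω) {g : M → ℝ}
    (hg : MDifferentiable 𝓘(ℝ, E) 𝓘(ℝ, ℝ) g) {x₀ : M} {y : E}
    (hy : y ∈ (extChartAt 𝓘(ℝ, E) x₀).target) :
    fieldInChart (hamiltonianField Ω g) x₀ y =
      formSharp (DiffForm.inChart 𝓘(ℝ, E) Ω x₀ y)
        (fderiv ℝ (g ∘ (extChartAt 𝓘(ℝ, E) x₀).symm) y) := by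
  refine (hΩ.inChart_nondegenerate hy).eq_sharp fun w => ?_
  rw [mfderiv_comp_symm_chart hy (hg _), ← hΩ.apply_hamiltonianField g]
  have h3 := DiffForm.pullback_apply_two (I := 𝓘(ℝ, E)) (I' := 𝓘(ℝ, E))
    (extChartAt 𝓘(ℝ, E) x₀).symm Ω y (fieldInChart (E := E) (hamiltonianField Ω g) x₀ y) w
  rw [mfderiv_symm_fieldInChart _ hy] at h3
  exact h3

lemma ContMDiff.contDiffOn_comp_symm_chart {F : Type*} [NormedAddCommGroup F] [NormedSpace ℝ F]
    {g : M → F} (hg : ContMDiff 𝓘(ℝ, E) 𝓘(ℝ, F) ∞ g) (x₀ : M) :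
    ContDiffOn ℝ ∞ (g ∘ (extChartAt 𝓘(ℝ, E) x₀).symm) (extChartAt 𝓘(ℝ, E) x₀).target := by
  rw [← contMDiffOn_iff_contDiffOn]
  exact hg.comp_contMDiffOn (contMDiffOn_extChartAt_symm x₀)

lemma contMDiff_of_contDiffOn_comp_symm_chart {F : Type*} [NormedAddCommGroup F] [NormedSpace ℝ F]
    {g : M → F} (hg : ∀ x₀, ContDiffOn ℝ ∞ (g ∘ (extChartAt 𝓘(ℝ, E) x₀).symm)
      (extChartAt 𝓘(ℝ, E) x₀).target) : ContMDiff 𝓘(ℝ, E) 𝓘(ℝ, F) ∞ g := by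
  intro x₀
  have h1 := hg x₀
  rw [← contMDiffOn_iff_contDiffOn] at h1
  have h2 := h1.comp (contMDiffOn_extChartAt (x := x₀)) (fun x hx =>
    (extChartAt 𝓘(ℝ, E) x₀).map_source (by simpa using hx))
  refine (h2.contMDiffAt ((chartAt E x₀).open_source.mem_nhds
    (mem_chart_source E x₀))).congr_of_eventuallyEq ?_
  filter_upwards [(chartAt E x₀).open_source.mem_nhds (mem_chart_source E x₀)] with x hx
  simp only [Function.comp_apply]
  rw [(extChartAt 𝓘(ℝ, E) x₀).left_inv (by simpa using hx)]

lemma ContMDiff.contDiffOn_fderiv_comp_symm_chart {F : Type*} [NormedAddCommGroup F]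
    [NormedSpace ℝ F] {g : M → F} (hg : ContMDiff 𝓘(ℝ, E) 𝓘(ℝ, F) ∞ g) (x₀ : M) :
    ContDiffOn ℝ ∞ (fderiv ℝ (g ∘ (extChartAt 𝓘(ℝ, E) x₀).symm))
      (extChartAt 𝓘(ℝ, E) x₀).target :=
  (hg.contDiffOn_comp_symm_chart x₀).fderiv_of_isOpen (isOpen_extChartAt_target x₀) (by simp)

lemma IsSymplecticForm.contDiffOn_hamiltonianField (hΩ : IsSymplecticForm 𝓘(ℝ, E) Ω) {g : M → ℝ}
    (hg : ContMDiff 𝓘(ℝ, E) 𝓘(ℝ, ℝ) ∞ g) (x₀ : M) :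
    ContDiffOn ℝ ∞ (fieldInChart (hamiltonianField Ω g) x₀) (extChartAt 𝓘(ℝ, E) x₀).target :=
  (contDiffOn_formSharp (hΩ.smooth x₀) (hg.contDiffOn_fderiv_comp_symm_chart x₀)
    fun _ hy => hΩ.inChart_nondegenerate hy).congr
      fun _ hy => hΩ.hamiltonianField_inChart (hg.mdifferentiable (by simp)) hy

/-- The Poisson bracket of two functions is smooth. -/
lemma IsSymplecticForm.contMDiff_bracket (hΩ : IsSymplecticForm 𝓘(ℝ, E) Ω) {g g' : M → ℝ}
    (hg : ContMDiff 𝓘(ℝ, E) 𝓘(ℝ, ℝ) ∞ g) (hg' : ContMDiff 𝓘(ℝ, E) 𝓘(ℝ, ℝ) ∞ g') :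
    ContMDiff 𝓘(ℝ, E) 𝓘(ℝ, ℝ) ∞
      (fun x => Ω x ![hamiltonianField Ω g x, hamiltonianField Ω g' x]) := by
  refine contMDiff_of_contDiffOn_comp_symm_chart fun x₀ => ?_
  -- The bracket is `dg` applied to the field of `g'`.
  refine ((hg.contDiffOn_fderiv_comp_symm_chart x₀).clm_apply
    (hΩ.contDiffOn_hamiltonianField hg' x₀)).congr fun y hy => ?_
  rw [mfderiv_comp_symm_chart hy (hg.mdifferentiable (by simp) _), mfderiv_symm_fieldInChart _ hy]
  exact hΩ.apply_hamiltonianField g _ _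

end Dual

/-! ### Submersions and the tangent spaces of their fibres -/

section Submersion

variable {E : Type*} [NormedAddCommGroup E] [NormedSpace ℝ E]
  {M : Type*} [TopologicalSpace M] [ChartedSpace E M] [IsManifold 𝓘(ℝ, E) ∞ M]
  {p : M → ℂ}

lemma mdifferentiable_of_mem_maximalAtlas {e : OpenPartialHomeomorph M E}
    (he : e ∈ IsManifold.maximalAtlas 𝓘(ℝ, E) ∞ M) : e.MDifferentiable 𝓘(ℝ, E) 𝓘(ℝ, E) :=
  ⟨(contMDiffOn_of_mem_maximalAtlas he).mdifferentiableOn (by simp),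
    (contMDiffOn_symm_of_mem_maximalAtlas he).mdifferentiableOn (by simp)⟩

/-- At every point, a submersion looks like a surjective linear map in suitable charts. -/
lemma IsSubmersion.exists_charts (hp : Manifold.IsSubmersion 𝓘(ℝ, E) 𝓘(ℝ, ℂ) ∞ p) (m : M) :
    ∃ (χ : OpenPartialHomeomorph M E) (ψ : OpenPartialHomeomorph ℂ ℂ) (L : E →L[ℝ] ℂ),
      χ ∈ IsManifold.maximalAtlas 𝓘(ℝ, E) ∞ M ∧ ψ ∈ IsManifold.maximalAtlas 𝓘(ℝ, ℂ) ∞ ℂ ∧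
      m ∈ χ.source ∧ Function.Surjective L ∧
      ∀ x ∈ χ.source, p x ∈ ψ.source ∧ ψ (p x) = L (χ x) := by
  have h := hp.isSubmersionAt m
  refine ⟨h.domChart, h.codChart, (ContinuousLinearMap.fst ℝ ℂ h.complement).comp
    (h.equiv : E →L[ℝ] ℂ × h.complement), h.domChart_mem_maximalAtlas, h.codChart_mem_maximalAtlas,
    h.mem_domChart_source, ?_, fun x hx => ⟨h.source_subset_preimage_source hx, ?_⟩⟩
  · exact Prod.fst_surjective.comp h.equiv.surjective
  · have hx' : h.domChart x ∈ (h.domChart.extend 𝓘(ℝ, E)).target := by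
      simpa using h.domChart.map_source hx
    have h1 := h.writtenInCharts hx'
    simpa [h.domChart.left_inv hx] using h1

variable {χ : OpenPartialHomeomorph M E} {ψ : OpenPartialHomeomorph ℂ ℂ} {L : E →L[ℝ] ℂ}

lemma mfderiv_of_charts (hχ : χ ∈ IsManifold.maximalAtlas 𝓘(ℝ, E) ∞ M)
    (hψ : ψ ∈ IsManifold.maximalAtlas 𝓘(ℝ, ℂ) ∞ ℂ)
    (hL : ∀ x ∈ χ.source, p x ∈ ψ.source ∧ ψ (p x) = L (χ x)) {m : M} (hm : m ∈ χ.source)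
    (hp : MDifferentiableAt 𝓘(ℝ, E) 𝓘(ℝ, ℂ) p m) (v : TangentSpace 𝓘(ℝ, E) m) :
    mfderiv 𝓘(ℝ, ℂ) 𝓘(ℝ, ℂ) ψ (p m) (mfderiv 𝓘(ℝ, E) 𝓘(ℝ, ℂ) p m v) =
      L (mfderiv 𝓘(ℝ, E) 𝓘(ℝ, E) χ m v) := by
  have h1 : (ψ ∘ p) =ᶠ[𝓝 m] (L ∘ χ) := by
    filter_upwards [χ.open_source.mem_nhds hm] with x hx
    exact (hL x hx).2
  have h2 := h1.mfderiv_eq (I := 𝓘(ℝ, E)) (I' := 𝓘(ℝ, ℂ))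
  rw [mfderiv_comp m ((mdifferentiable_of_mem_maximalAtlas hψ).mdifferentiableAt (hL m hm).1) hp,
    mfderiv_comp m L.mdifferentiableAt
      ((mdifferentiable_of_mem_maximalAtlas hχ).mdifferentiableAt hm)] at h2
  have h3 := congrArg (fun T : E →L[ℝ] ℂ => T v) h2
  have h4 : mfderiv 𝓘(ℝ, E) 𝓘(ℝ, ℂ) L (χ m) = L := L.hasMFDerivAt.mfderiv
  rw [h4] at h3
  exact h3

lemma IsSubmersion.mfderiv_surjective (hp : Manifold.IsSubmersion 𝓘(ℝ, E) 𝓘(ℝ, ℂ) ∞ p) (m : M) :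
    Function.Surjective (mfderiv 𝓘(ℝ, E) 𝓘(ℝ, ℂ) p m) := by
  obtain ⟨χ, ψ, L, hχ, hψ, hm, hsurj, hL⟩ := IsSubmersion.exists_charts hp m
  intro z
  obtain ⟨w, hw⟩ := hsurj (mfderiv 𝓘(ℝ, ℂ) 𝓘(ℝ, ℂ) ψ (p m) z)
  obtain ⟨v, hv⟩ := (mdifferentiable_of_mem_maximalAtlas hχ).mfderiv_surjective hm w
  refine ⟨v, (mdifferentiable_of_mem_maximalAtlas hψ).mfderiv_injective (hL m hm).1 ?_⟩
  rw [mfderiv_of_charts hχ hψ hL hm (hp.contMDiff.mdifferentiable (by simp) m)]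
  exact (congrArg L hv).trans hw

variable {E₀ : Type*} [NormedAddCommGroup E₀] [NormedSpace ℝ E₀]
  {F : Type*} [TopologicalSpace F] [ChartedSpace E₀ F] [IsManifold 𝓘(ℝ, E₀) ∞ F]

/-- The tangent space of a fibre of a submersion is the kernel of the differential. -/
lemma IsSubmersion.exists_mfderiv_eq (hp : Manifold.IsSubmersion 𝓘(ℝ, E) 𝓘(ℝ, ℂ) ∞ p) {j : F → M}
    (hj : Manifold.IsSmoothEmbedding 𝓘(ℝ, E₀) 𝓘(ℝ, E) ∞ j) {z : ℂ} (hrange : range j = p ⁻¹' {z})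
    (x : F) (v : TangentSpace 𝓘(ℝ, E) (j x)) (hv : mfderiv 𝓘(ℝ, E) 𝓘(ℝ, ℂ) p (j x) v = 0) :
    ∃ u : TangentSpace 𝓘(ℝ, E₀) x, mfderiv 𝓘(ℝ, E₀) 𝓘(ℝ, E) j x u = v := by
  obtain ⟨χ, ψ, L, hχ, hψ, hm, -, hL⟩ := IsSubmersion.exists_charts hp (j x)
  set y : E := χ (j x)
  set w : E := mfderiv 𝓘(ℝ, E) 𝓘(ℝ, E) χ (j x) v with hw
  have hLw : L w = 0 := by
    rw [hw, ← mfderiv_of_charts hχ hψ hL hm (hp.contMDiff.mdifferentiable (by simp) _), hv]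
    exact map_zero (mfderiv 𝓘(ℝ, ℂ) 𝓘(ℝ, ℂ) ψ (p (j x)))
  -- In the charts `p` is the linear map `L` and `L w = 0`, so this line stays in the fibre for
  -- small `s`. It lifts through `j` to a curve in `F`, smooth because `j` is an immersion, and the
  -- velocity of the lift is the required vector.
  let a : ℝ → E := fun s => y + s • w
  have ha : HasDerivAt a w 0 :=
    (((hasDerivAt_id (0 : ℝ)).smul_const w).const_add y).congr_deriv (one_smul _ _)
  have ha0 : a 0 = y := by simp [a]
  have hac : ContDiff ℝ ∞ a := by fun_prop
  have hy : y ∈ χ.target := χ.map_source hm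
  let c : ℝ → M := fun s => χ.symm (a s)
  have hc0 : c 0 = j x := by simp only [c, ha0]; exact χ.left_inv hm
  have hcs : ContMDiffAt 𝓘(ℝ, ℝ) 𝓘(ℝ, E) ∞ c 0 := by
    refine ContMDiffAt.comp 0 (g := χ.symm) ?_ hac.contMDiff.contMDiffAt
    rw [ha0]
    exact contMDiffAt_symm_of_mem_maximalAtlas hχ hy
  have hcr : ∀ᶠ s in 𝓝 (0 : ℝ), c s ∈ range j := by
    have : ∀ᶠ s in 𝓝 (0 : ℝ), a s ∈ χ.target :=
      ha.continuousAt.eventually (χ.open_target.mem_nhds (by rwa [ha0]))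
    filter_upwards [this] with s hs
    have h1 := hL (c s) (χ.map_target hs)
    have h2 := hL (j x) hm
    rw [hrange, mem_preimage, mem_singleton_iff]
    have h3 : p (j x) = z := by
      have : j x ∈ p ⁻¹' {z} := hrange ▸ mem_range_self x
      exact this
    rw [← h3]
    refine ψ.injOn h1.1 h2.1 ?_
    rw [h1.2, h2.2, χ.right_inv hs]
    simp [a, hLw, y]
  have : Nonempty F := ⟨x⟩
  let f : ℝ → F := fun s => Function.invFun j (c s)
  have hjf : j ∘ f =ᶠ[𝓝 0] c := by
    filter_upwards [hcr] with s hs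
    exact Function.invFun_eq hs
  have hf0 : f 0 = x := by
    simp only [f, hc0]
    exact Function.leftInverse_invFun hj.isEmbedding.injective x
  have hfs : ContMDiffAt 𝓘(ℝ, ℝ) 𝓘(ℝ, E₀) ∞ f 0 := by
    refine (ContMDiffAt.iff_comp_isImmersionAt (hj.isImmersion.isImmersionAt (f 0))).2 ⟨?_, ?_⟩
    · rw [hj.isEmbedding.continuousAt_iff]
      exact hcs.continuousAt.congr hjf.symm
    · exact hcs.congr_of_eventuallyEq hjf
  have hχd := mdifferentiable_of_mem_maximalAtlas hχ
  have hfd := (hfs.mdifferentiableAt (by simp)).hasMFDerivAt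
  have hjd : HasMFDerivAt 𝓘(ℝ, E₀) 𝓘(ℝ, E) j (f 0)
      (show E₀ →L[ℝ] E from mfderiv 𝓘(ℝ, E₀) 𝓘(ℝ, E) j x) := by
    rw [hf0]
    exact (hj.isImmersion.contMDiff.mdifferentiable (by simp) x).hasMFDerivAt
  have hsd : HasMFDerivAt 𝓘(ℝ, E) 𝓘(ℝ, E) χ.symm (a 0)
      (show E →L[ℝ] E from mfderiv 𝓘(ℝ, E) 𝓘(ℝ, E) χ.symm y) := by
    rw [ha0]
    exact (hχd.mdifferentiableAt_symm hy).hasMFDerivAt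
  have h1 := (hjd.comp 0 hfd).congr_of_eventuallyEq hjf.symm
  have h2 := HasMFDerivAt.comp 0 hsd ha.hasFDerivAt.hasMFDerivAt
  have h3 := congrArg (fun T : ℝ →L[ℝ] E => T 1) (hasMFDerivAt_unique h1 h2)
  refine ⟨(show ℝ →L[ℝ] E₀ from mfderiv 𝓘(ℝ, ℝ) 𝓘(ℝ, E₀) f 0) 1, h3.trans ?_⟩
  have h4 := congrArg (fun T : E →L[ℝ] E => T v) (hχd.symm_comp_deriv hm)
  refine Eq.trans ?_ h4
  change (mfderiv 𝓘(ℝ, E) 𝓘(ℝ, E) χ.symm y) ((1 : ℝ) • w) = _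
  rw [one_smul]
  rfl

end Submersion

/-! ### The symplectic connection -/

section Horizontal

variable {E : Type*} [NormedAddCommGroup E] [NormedSpace ℝ E] [FiniteDimensional ℝ E]
  {M : Type*} [TopologicalSpace M] [ChartedSpace E M] [IsManifold 𝓘(ℝ, E) ∞ M]
  {p : M → ℂ} {Ω : DiffForm 𝓘(ℝ, E) M 2}

lemma mfderiv_re_comp {x : M} (hp : MDifferentiableAt 𝓘(ℝ, E) 𝓘(ℝ, ℂ) p x)
    (w : TangentSpace 𝓘(ℝ, E) x) :
    mfderiv 𝓘(ℝ, E) 𝓘(ℝ, ℝ) (fun y => (p y).re) x w =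
      (show ℂ from mfderiv 𝓘(ℝ, E) 𝓘(ℝ, ℂ) p x w).re := by
  have h := HasMFDerivAt.comp x (Complex.reCLM.hasMFDerivAt (x := p x)) hp.hasMFDerivAt
  exact congrArg (fun T : E →L[ℝ] ℝ => T w) h.mfderiv

lemma mfderiv_im_comp {x : M} (hp : MDifferentiableAt 𝓘(ℝ, E) 𝓘(ℝ, ℂ) p x)
    (w : TangentSpace 𝓘(ℝ, E) x) :
    mfderiv 𝓘(ℝ, E) 𝓘(ℝ, ℝ) (fun y => (p y).im) x w =
      (show ℂ from mfderiv 𝓘(ℝ, E) 𝓘(ℝ, ℂ) p x w).im := by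
  have h := HasMFDerivAt.comp x (Complex.imCLM.hasMFDerivAt (x := p x)) hp.hasMFDerivAt
  exact congrArg (fun T : E →L[ℝ] ℝ => T w) h.mfderiv

/-- The restriction of the form to the vertical space of a Hamiltonian fibration is
nondegenerate. -/
lemma IsHamiltonianFibration.vertical_nondegenerate
    {E₀ : Type*} [NormedAddCommGroup E₀] [NormedSpace ℝ E₀]
    {F : Type*} [TopologicalSpace F] [ChartedSpace E₀ F] [IsManifold 𝓘(ℝ, E₀) ∞ F]
    [CompactSpace F] {αF : DiffForm 𝓘(ℝ, E₀) F 2}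
    (hp : IsHamiltonianFibration 𝓘(ℝ, E) 𝓘(ℝ, E₀) p Ω αF) (x : M) (v : TangentSpace 𝓘(ℝ, E) x)
    (hv : mfderiv 𝓘(ℝ, E) 𝓘(ℝ, ℂ) p x v = 0)
    (h : ∀ w : TangentSpace 𝓘(ℝ, E) x, mfderiv 𝓘(ℝ, E) 𝓘(ℝ, ℂ) p x w = 0 → Ω x ![v, w] = 0) :
    v = 0 := by
  obtain ⟨j, hj, hrange, hpull⟩ := hp.fibre (p x)
  obtain ⟨q, rfl⟩ : x ∈ range j := by rw [hrange]; rfl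
  obtain ⟨u, rfl⟩ := IsSubmersion.exists_mfderiv_eq hp.submersion hj hrange q v hv
  have hpj : p ∘ j = fun _ => p (j q) := by
    funext y
    have : j y ∈ p ⁻¹' {p (j q)} := hrange ▸ mem_range_self y
    exact this
  have hjd := hj.isImmersion.contMDiff.mdifferentiable (by simp)
  have hpd := hp.submersion.contMDiff.mdifferentiable (by simp)
  have hdj : ∀ u : TangentSpace 𝓘(ℝ, E₀) q, mfderiv 𝓘(ℝ, E) 𝓘(ℝ, ℂ) p (j q)
      (mfderiv 𝓘(ℝ, E₀) 𝓘(ℝ, E) j q u) = 0 := by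
    intro u
    have h1 := mfderiv_comp q (hpd (j q)) (hjd q)
    rw [hpj, mfderiv_const] at h1
    exact (congrArg (fun T : E₀ →L[ℝ] ℂ => T u) h1).symm
  have hu : u = 0 := by
    refine hp.fibre_symplectic.nondegenerate q u fun w => ?_
    rw [← hpull, DiffForm.pullback_apply_two]
    exact h _ (hdj w)
  rw [hu]
  exact map_zero (mfderiv 𝓘(ℝ, E₀) 𝓘(ℝ, E) j q)

/-- The symplectic connection of a Hamiltonian fibration over the plane: horizontal lifts of
constant vector fields. -/
theorem IsHamiltonianFibration.exists_horizontal_lift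
    {E₀ : Type*} [NormedAddCommGroup E₀] [NormedSpace ℝ E₀]
    {F : Type*} [TopologicalSpace F] [ChartedSpace E₀ F] [IsManifold 𝓘(ℝ, E₀) ∞ F]
    [CompactSpace F] {αF : DiffForm 𝓘(ℝ, E₀) F 2}
    (hp : IsHamiltonianFibration 𝓘(ℝ, E) 𝓘(ℝ, E₀) p Ω αF) (hΩ : IsSymplecticForm 𝓘(ℝ, E) Ω) :
    ∃ (V : ∀ x : M, ℂ →L[ℝ] TangentSpace 𝓘(ℝ, E) x) (r : M → ℝ),
      SmoothFieldFamily V ∧ ContMDiff 𝓘(ℝ, E) 𝓘(ℝ, ℝ) ∞ r ∧ (∀ x, r x ≠ 0) ∧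
      (∀ x z, mfderiv 𝓘(ℝ, E) 𝓘(ℝ, ℂ) p x (V x z) = z) ∧
      ∀ x z w, Ω x ![V x z, w] =
        r x * ((starRingEnd ℂ) z * (show ℂ from mfderiv 𝓘(ℝ, E) 𝓘(ℝ, ℂ) p x w)).im := by
  have hps := hp.submersion.contMDiff
  have hpd := hps.mdifferentiable (by simp)
  have hre : ContMDiff 𝓘(ℝ, E) 𝓘(ℝ, ℝ) ∞ (fun y => (p y).re) :=
    Complex.reCLM.contMDiff.comp hps
  have him : ContMDiff 𝓘(ℝ, E) 𝓘(ℝ, ℝ) ∞ (fun y => (p y).im) :=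
    Complex.imCLM.contMDiff.comp hps
  let X₁ : M → E := hamiltonianField Ω (fun y => (p y).re)
  let X₂ : M → E := hamiltonianField Ω (fun y => (p y).im)
  let dp : M → E →L[ℝ] ℂ := fun x => mfderiv 𝓘(ℝ, E) 𝓘(ℝ, ℂ) p x
  let B : M → E →L[ℝ] E →L[ℝ] ℝ := fun x => formFlat (E := E) (Ω x)
  let κ : M → ℝ := fun x => B x (X₁ x) (X₂ x)
  have hX₁ : ∀ x (w : E), B x (X₁ x) w = (dp x w).re := fun x w =>
    (hΩ.apply_hamiltonianField _ x w).trans (mfderiv_re_comp (hpd x) w)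
  have hX₂ : ∀ x (w : E), B x (X₂ x) w = (dp x w).im := fun x w =>
    (hΩ.apply_hamiltonianField _ x w).trans (mfderiv_im_comp (hpd x) w)
  have h11 : ∀ x, (dp x (X₁ x)).re = 0 := fun x => by
    rw [← hX₁]; exact form_self (E := E) (Ω x) (X₁ x)
  have h22 : ∀ x, (dp x (X₂ x)).im = 0 := fun x => by
    rw [← hX₂]; exact form_self (E := E) (Ω x) (X₂ x)
  have h12 : ∀ x, (dp x (X₂ x)).re = κ x := fun x => (hX₁ x (X₂ x)).symm
  have h21 : ∀ x, (dp x (X₁ x)).im = -κ x := fun x => by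
    rw [← hX₂]; exact form_swap (E := E) (Ω x) (X₂ x) (X₁ x)
  have hκs : ContMDiff 𝓘(ℝ, E) 𝓘(ℝ, ℝ) ∞ κ := hΩ.contMDiff_bracket hre him
  -- If `κ x = 0` then `X₁` is vertical. It pairs with `w` to `Re (dp w)`, hence to zero with
  -- vertical `w`, so it vanishes by `vertical_nondegenerate`. This contradicts surjectivity of
  -- `dp`.
  have hκ : ∀ x, κ x ≠ 0 := by
    intro x hx
    have h0 : X₁ x = 0 := by
      refine hp.vertical_nondegenerate x (X₁ x) ?_ fun w hw => ?_
      · exact Complex.ext (h11 x) ((h21 x).trans (by rw [hx]; exact neg_zero))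
      · have : dp x w = 0 := hw
        refine (hX₁ x w).trans ?_
        rw [this]
        rfl
    obtain ⟨w, hw⟩ := IsSubmersion.mfderiv_surjective hp.submersion x (1 : ℂ)
    have h1 := hX₁ x w
    have h2 : dp x w = 1 := hw
    rw [h0, h2, map_zero] at h1
    exact zero_ne_one (h1.trans Complex.one_re)
  have hκi : ContMDiff 𝓘(ℝ, E) 𝓘(ℝ, ℝ) ∞ (fun x => (κ x)⁻¹) := hκs.inv₀ hκ
  -- Since `dp X₂ = κ` and `dp X₁ = -κ i`, this is the combination of `X₁` and `X₂` that lifts `z`.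
  -- Pairing it with `w` produces the factor `r = κ⁻¹`.
  let V : M → ℂ →L[ℝ] E := fun x =>
    (κ x)⁻¹ • (Complex.reCLM.smulRight (X₂ x) - Complex.imCLM.smulRight (X₁ x))
  have hV : ∀ x z, V x z = (κ x)⁻¹ • (z.re • X₂ x - z.im • X₁ x) := fun x z => rfl
  refine ⟨V, fun x => (κ x)⁻¹, fun z => ?_, hκi, fun x => inv_ne_zero (hκ x), fun x z => ?_,
    fun x z (w : E) => ?_⟩
  · have e1 : ContMDiff 𝓘(ℝ, E) 𝓘(ℝ, ℝ) ∞ (fun x => (κ x)⁻¹ * z.re) := hκi.mul contMDiff_const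
    have e2 : ContMDiff 𝓘(ℝ, E) 𝓘(ℝ, ℝ) ∞ (fun x => -((κ x)⁻¹ * z.im)) :=
      (hκi.mul contMDiff_const).neg
    refine (contMDiff_field_iff fun x => V x z).2 ?_
    intro x₀
    have c1 := hΩ.contDiffOn_hamiltonianField hre x₀
    have c2 := hΩ.contDiffOn_hamiltonianField him x₀
    have d1 := e1.contDiffOn_comp_symm_chart x₀
    have d2 := e2.contDiffOn_comp_symm_chart x₀
    refine ((d1.smul c2).add (d2.smul c1)).congr fun y hy => ?_
    let D : E →L[ℝ] E := mfderiv 𝓘(ℝ, E) 𝓘(ℝ, E) (extChartAt 𝓘(ℝ, E) x₀)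
      ((extChartAt 𝓘(ℝ, E) x₀).symm y)
    change D ((κ _)⁻¹ • (z.re • X₂ _ - z.im • X₁ _)) =
      ((κ _)⁻¹ * z.re) • D (X₂ _) + (-((κ _)⁻¹ * z.im)) • D (X₁ _)
    rw [map_smul, map_sub, map_smul, map_smul]
    module
  · change dp x (V x z) = z
    have hk := hκ x
    rw [hV, map_smul, map_sub, map_smul, map_smul]
    have a1 : dp x (X₂ x) = κ x := Complex.ext (h12 x) (by simpa using h22 x)
    have a2 : dp x (X₁ x) = -κ x * Complex.I :=
      Complex.ext (by simpa using h11 x) (by simpa using h21 x)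
    rw [a1, a2]
    apply Complex.ext
    · simp; field_simp
    · simp; field_simp
  · change B x (V x z) w = (κ x)⁻¹ * ((starRingEnd ℂ) z * dp x w).im
    have b1 : B x (X₁ x) w = (dp x w).re := hX₁ x w
    have b2 : B x (X₂ x) w = (dp x w).im := hX₂ x w
    rw [hV, map_smul, map_sub, map_smul, map_smul, smul_apply, sub_apply, smul_apply, smul_apply,
      b1, b2]
    simp only [smul_eq_mul, Complex.mul_im, Complex.conj_re, Complex.conj_im]
    ring

end Horizontal

/-! ### Vanishing of closed forms without radial part -/

section RadialVanishing

variable {E : Type*} [NormedAddCommGroup E] [NormedSpace ℝ E]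

lemma extDeriv_apply_three {β : E → E [⋀^Fin 2]→L[ℝ] ℝ} {y : E} (h : DifferentiableAt ℝ β y)
    (a b c : E) :
    extDeriv β y ![a, b, c] = fderiv ℝ (fun y => β y ![b, c]) y a -
      fderiv ℝ (fun y => β y ![a, c]) y b + fderiv ℝ (fun y => β y ![a, b]) y c := by
  rw [extDeriv_apply h, Fin.sum_univ_three]
  have h0 : (0 : Fin 3).removeNth ![a, b, c] = ![b, c] := by ext i; fin_cases i <;> rfl
  have h1 : (1 : Fin 3).removeNth ![a, b, c] = ![a, c] := by ext i; fin_cases i <;> rfl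
  have h2 : (2 : Fin 3).removeNth ![a, b, c] = ![a, b] := by ext i; fin_cases i <;> rfl
  rw [h0, h1, h2]
  simp [sub_eq_add_neg]

variable {P : Type*} [NormedAddCommGroup P] [NormedSpace ℝ P]

/-- `formFlat` as a continuous linear map. -/
noncomputable def formFlatCLM : (E [⋀^Fin 2]→L[ℝ] ℝ) →L[ℝ] E →L[ℝ] E →L[ℝ] ℝ :=
  LinearMap.mkContinuous ⟨⟨formFlat, fun _ _ => rfl⟩, fun _ _ => rfl⟩ 1 fun η => by
    rw [one_mul]
    refine ContinuousLinearMap.opNorm_le_bound₂ (formFlat η) (norm_nonneg η) fun v w => ?_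
    have := η.le_opNorm ![v, w]
    simpa [Fin.prod_univ_two, mul_assoc] using this

lemma DifferentiableAt.formFlat {E' : Type*} [NormedAddCommGroup E'] [NormedSpace ℝ E']
    {β : E' → E [⋀^Fin 2]→L[ℝ] ℝ} {y : E'} (hβ : DifferentiableAt ℝ β y) :
    DifferentiableAt ℝ (fun q => formFlat (β q)) y := by
  have h : DifferentiableAt ℝ (formFlatCLM : (E [⋀^Fin 2]→L[ℝ] ℝ) → E →L[ℝ] E →L[ℝ] ℝ) (β y) :=
    ContinuousLinearMap.differentiableAt _
  exact DifferentiableAt.comp (g := (formFlatCLM : (E [⋀^Fin 2]→L[ℝ] ℝ) → E →L[ℝ] E →L[ℝ] ℝ))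
    (f := β) y h hβ

/-- A closed `2`-form on a cylinder is determined by its contraction with the radial field and its
restriction to the core. -/
theorem closed_form_eq_zero_of_radial {U : Set E}
    (hU : IsOpen U) {β : E × P → (E × P) [⋀^Fin 2]→L[ℝ] ℝ}
    (hβ : ∀ q ∈ U ×ˢ (univ : Set P), DifferentiableAt ℝ β q) (hclosed : ∀ q ∈ U ×ˢ (univ : Set P), extDeriv β q = 0)
    (hrad : ∀ u ∈ U, ∀ z w, β (u, z) ![(0, z), w] = 0)
    (hcore : ∀ u ∈ U, ∀ a b, β (u, 0) ![(a, 0), (b, 0)] = 0) {u : E} (hu : u ∈ U) (z : P)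
    (w w' : E × P) : β (u, z) ![w, w'] = 0 := by
  have hopen : IsOpen (U ×ˢ (univ : Set P)) := hU.prod isOpen_univ
  let B : E × P → (E × P) →L[ℝ] (E × P) →L[ℝ] ℝ := fun q => formFlat (β q)
  have hβd : ∀ t : ℝ, DifferentiableAt ℝ β (u, t • z) := fun t => hβ _ ⟨hu, mem_univ _⟩
  have hd : ∀ t : ℝ, HasFDerivAt B (fderiv ℝ B (u, t • z)) (u, t • z) := fun t =>
    (hβd t).formFlat.hasFDerivAt
  have hap : ∀ (t : ℝ) (a b c : E × P), fderiv ℝ (fun q => β q ![b, c]) (u, t • z) a =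
      fderiv ℝ B (u, t • z) a b c := by
    intro t a b c
    have h1 := ((hd t).clm_apply (hasFDerivAt_const b _)).clm_apply (hasFDerivAt_const c _)
    have h2 : HasFDerivAt (fun q => β q ![b, c]) _ (u, t • z) := h1
    rw [h2.fderiv]
    simp
  have hskew : ∀ (q a b : E × P), B q a b = -B q b a := fun q a b => form_swap (β q) a b
  -- This differentiates the identity `B q (0, q.2) b = 0` in the direction `a`. At `(u, t • z)` the
  -- radial vector is `t • (0, z)`, whence the factor `t⁻¹`.
  have hradD : ∀ (t : ℝ), t ≠ 0 → ∀ a b : E × P,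
      fderiv ℝ B (u, t • z) a (0, z) b = - t⁻¹ • B (u, t • z) (0, a.2) b := by
    intro t ht a b
    have h0 : HasFDerivAt (fun q : E × P => ((0 : E), q.2))
        ((0 : E × P →L[ℝ] E).prod (ContinuousLinearMap.snd ℝ E P)) (u, t • z) :=
      (hasFDerivAt_const _ _).prodMk hasFDerivAt_snd
    have h1 := ((hd t).clm_apply h0).clm_apply (hasFDerivAt_const b _)
    have h2 : (fun q : E × P => B q (0, q.2) b) =ᶠ[𝓝 (u, t • z)] fun _ => (0 : ℝ) := by
      filter_upwards [hopen.mem_nhds (show (u, t • z) ∈ U ×ˢ univ from ⟨hu, mem_univ _⟩)] with q hq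
      exact hrad q.1 hq.1 q.2 b
    have h3 := h1.unique ((hasFDerivAt_const (0 : ℝ) _).congr_of_eventuallyEq h2)
    have h4 := congrArg (fun L : E × P →L[ℝ] ℝ => L a) h3
    have h6 : ((0 : E), t • z) = t • ((0 : E), z) := by simp
    simp only [ContinuousLinearMap.comp_zero, zero_add, ContinuousLinearMap.flip_apply,
      add_apply, ContinuousLinearMap.coe_comp, Function.comp_apply,
      ContinuousLinearMap.prod_apply, zero_apply, h6, map_smul,
      ContinuousLinearMap.coe_snd', smul_apply, smul_eq_mul] at h4
    rw [smul_eq_mul]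
    field_simp
    linarith
  let m : ℝ → E × P → E × P := fun t a => (a.1, t • a.2)
  -- `c t` is the value on `w, w'` of the pullback of `β` under the scaling `(u, z) ↦ (u, t • z)`.
  -- Its derivative is, up to a factor `t⁻¹`, a Lie derivative along the radial field, which
  -- Cartan's formula makes zero.
  let c : ℝ → ℝ := fun t => B (u, t • z) (m t w) (m t w')
  have hmd : ∀ a (t : ℝ), HasDerivAt (fun t => m t a) (0, a.2) t := fun a t =>
    (hasDerivAt_const t a.1).prodMk
      (((hasDerivAt_id t).smul_const a.2).congr_deriv (one_smul ℝ a.2))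
  have hcd : ∀ t, HasDerivAt c (fderiv ℝ B (u, t • z) (0, z) (m t w) (m t w') +
      B (u, t • z) (0, w.2) (m t w') + B (u, t • z) (m t w) (0, w'.2)) t := by
    intro t
    have h1 : HasDerivAt (fun t : ℝ => B (u, t • z)) (fderiv ℝ B (u, t • z) (0, z)) t :=
      HasFDerivAt.comp_hasDerivAt (l := B) (f := fun t : ℝ => (u, t • z)) t (hd t) (hmd (u, z) t)
    have h2 := (h1.clm_apply (hmd w t)).clm_apply (hmd w' t)
    refine h2.congr_deriv ?_
    simp
  have hc0 : ∀ t, t ≠ 0 → HasDerivAt c 0 t := by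
    intro t ht
    refine (hcd t).congr_deriv ?_
    have h1 := extDeriv_apply_three (hβd t) (0, z) (m t w) (m t w')
    rw [hclosed _ ⟨hu, mem_univ _⟩] at h1
    rw [hap, hap, hap, hradD t ht] at h1
    have h5 : fderiv ℝ B (u, t • z) (m t w') (0, z) (m t w) = _ := hradD t ht _ _
    rw [h5] at h1
    have h6 : ∀ (a b : E × P), t⁻¹ * B (u, t • z) (0, (m t a).2) b = B (u, t • z) (0, a.2) b := by
      intro a b
      have : ((0 : E), (m t a).2) = t • ((0 : E), a.2) := by simp [m]
      rw [this, map_smul, smul_apply, smul_eq_mul, inv_mul_cancel_left₀ ht]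
    simp only [smul_eq_mul, neg_mul, h6] at h1
    rw [hskew _ (m t w) (0, w'.2)]
    have h7 : (0 : (E × P) [⋀^Fin (2 + 1)]→L[ℝ] ℝ) ![(0, z), m t w, m t w'] = 0 := rfl
    linarith
  have hcc : Continuous c := continuous_iff_continuousAt.2 fun t => (hcd t).continuousAt
  -- The derivative is known to vanish only for `t ≠ 0`; continuity at `0` is enough for the mean
  -- value theorem on `[0, 1]`.
  have hconst : c 1 = c 0 := by
    obtain ⟨t, ht, h⟩ := exists_hasDerivAt_eq_slope c (fun _ => 0) zero_lt_one hcc.continuousOn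
      fun t ht => hc0 t ht.1.ne'
    linarith
  have h1 : c 1 = β (u, z) ![w, w'] := by simp [c, m, B]
  rw [← h1, hconst]
  have : c 0 = β (u, 0) ![(w.1, 0), (w'.1, 0)] := by simp [c, m, B]
  rw [this, hcore u hu]

end RadialVanishing

/-! ### Pullbacks of forms to vector spaces -/

section Pullback

variable {E : Type*} [NormedAddCommGroup E] [NormedSpace ℝ E]
  {M : Type*} [TopologicalSpace M] [ChartedSpace E M] [IsManifold 𝓘(ℝ, E) ∞ M]
  {P : Type*} [NormedAddCommGroup P] [NormedSpace ℝ P]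
  {k : ℕ} {α : DiffForm 𝓘(ℝ, E) M k} {G : P → M} {y : P}

/-- The pullback of a form to a vector space, as a form on the vector space. -/
noncomputable def DiffForm.pullbackModel (α : DiffForm 𝓘(ℝ, E) M k) (G : P → M) :
    P → P [⋀^Fin k]→L[ℝ] ℝ :=
  DiffForm.pullback 𝓘(ℝ, P) 𝓘(ℝ, E) G α

/-- Near `y` the pullback factors through the single chart at `G y`. It becomes a pullback between
vector spaces, where differentiability and naturality of `extDeriv` are available. -/
lemma DiffForm.pullbackModel_eventuallyEq (α : DiffForm 𝓘(ℝ, E) M k)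
    (hG : ContMDiffAt 𝓘(ℝ, P) 𝓘(ℝ, E) ∞ G y) :
    DiffForm.pullbackModel α G =ᶠ[𝓝 y] fun q =>
      (DiffForm.inChart 𝓘(ℝ, E) α (G y) (extChartAt 𝓘(ℝ, E) (G y) (G q))).compContinuousLinearMap
        (fderiv ℝ (fun q => extChartAt 𝓘(ℝ, E) (G y) (G q)) q) := by
  have h1 : ∀ᶠ q in 𝓝 y, ContMDiffAt 𝓘(ℝ, P) 𝓘(ℝ, E) 1 G q :=
    (contMDiffAt_iff_contMDiffAt_nhds (by simp)).1 (hG.of_le (by simp))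
  have h2 : ∀ᶠ q in 𝓝 y, G q ∈ (extChartAt 𝓘(ℝ, E) (G y)).source :=
    hG.continuousAt.eventually (extChartAt_source_mem_nhds (G y))
  filter_upwards [h1, h2] with q hq1 hq2
  have hq3 := (extChartAt 𝓘(ℝ, E) (G y)).map_source hq2
  have h4 : G q = (extChartAt 𝓘(ℝ, E) (G y)).symm (extChartAt 𝓘(ℝ, E) (G y) (G q)) :=
    ((extChartAt 𝓘(ℝ, E) (G y)).left_inv hq2).symm
  have hcd : MDifferentiableAt 𝓘(ℝ, E) 𝓘(ℝ, E) (extChartAt 𝓘(ℝ, E) (G y)) (G q) :=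
    (contMDiffAt_extChartAt' (n := ∞) (by simpa using hq2)).mdifferentiableAt (by simp)
  have h5 : ∀ v : P, fderiv ℝ (fun q => extChartAt 𝓘(ℝ, E) (G y) (G q)) q v =
      mfderiv 𝓘(ℝ, E) 𝓘(ℝ, E) (extChartAt 𝓘(ℝ, E) (G y)) (G q)
        (mfderiv 𝓘(ℝ, P) 𝓘(ℝ, E) G q v) := by
    intro v
    have := mfderiv_comp q hcd (hq1.mdifferentiableAt (by simp))
    rw [← mfderiv_eq_fderiv]
    exact congrArg (fun T : P →L[ℝ] E => T v) this
  have h6 : ∀ v : E, mfderiv 𝓘(ℝ, E) 𝓘(ℝ, E) (extChartAt 𝓘(ℝ, E) (G y)).symm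
      (extChartAt 𝓘(ℝ, E) (G y) (G q)) (mfderiv 𝓘(ℝ, E) 𝓘(ℝ, E) (extChartAt 𝓘(ℝ, E) (G y)) (G q) v)
        = v := by
    intro v
    have := mfderiv_symm_mfderiv_extChartAt hq3 v
    rwa [← h4] at this
  ext u
  change α (G q) (fun i => mfderiv 𝓘(ℝ, P) 𝓘(ℝ, E) G q (u i)) = α _
    (fun i => mfderiv 𝓘(ℝ, E) 𝓘(ℝ, E) (extChartAt 𝓘(ℝ, E) (G y)).symm
      (extChartAt 𝓘(ℝ, E) (G y) (G q))
      (fderiv ℝ (fun q => extChartAt 𝓘(ℝ, E) (G y) (G q)) q (u i)))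
  have h7 : ∀ v : P, mfderiv 𝓘(ℝ, E) 𝓘(ℝ, E) (extChartAt 𝓘(ℝ, E) (G y)).symm
      (extChartAt 𝓘(ℝ, E) (G y) (G q))
      (fderiv ℝ (fun q => extChartAt 𝓘(ℝ, E) (G y) (G q)) q v) =
        (mfderiv 𝓘(ℝ, P) 𝓘(ℝ, E) G q v : E) := by
    intro v
    rw [h5 v]
    exact h6 _
  have h8 : (fun i => mfderiv 𝓘(ℝ, E) 𝓘(ℝ, E) (extChartAt 𝓘(ℝ, E) (G y)).symm
      (extChartAt 𝓘(ℝ, E) (G y) (G q))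
      (fderiv ℝ (fun q => extChartAt 𝓘(ℝ, E) (G y) (G q)) q (u i))) =
        (fun i => mfderiv 𝓘(ℝ, P) 𝓘(ℝ, E) G q (u i) : Fin k → E) := funext fun i => h7 (u i)
  rw [h8, ← h4]

lemma DiffForm.IsSmooth.differentiableAt_pullbackModel (hα : DiffForm.IsSmooth 𝓘(ℝ, E) α)
    (hG : ContMDiffAt 𝓘(ℝ, P) 𝓘(ℝ, E) ∞ G y) :
    DifferentiableAt ℝ
      (DiffForm.pullbackModel α G) y := by
  refine DifferentiableAt.congr_of_eventuallyEq ?_ (DiffForm.pullbackModel_eventuallyEq α hG)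
  have hg : ContDiffAt ℝ ∞ (fun q => extChartAt 𝓘(ℝ, E) (G y) (G q)) y := by
    rw [← contMDiffAt_iff_contDiffAt]
    exact contMDiffAt_extChartAt.comp y hG
  have ht := (isOpen_extChartAt_target (I := 𝓘(ℝ, E)) (G y)).mem_nhds
    (mem_extChartAt_target (I := 𝓘(ℝ, E)) (G y))
  refine DifferentiableAt.continuousAlternatingMapCompContinuousLinearMap ?_ ?_
  · exact (((hα (G y)).contDiffAt ht).differentiableAt (by simp)).comp y
      (hg.differentiableAt (by simp))
  · exact (hg.fderiv_right (m := ∞) (by simp)).differentiableAt (by simp)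

lemma DiffForm.IsClosedForm.extDeriv_pullbackModel (hα : DiffForm.IsSmooth 𝓘(ℝ, E) α)
    (hα' : DiffForm.IsClosedForm 𝓘(ℝ, E) α) (hG : ContMDiffAt 𝓘(ℝ, P) 𝓘(ℝ, E) ∞ G y) :
    extDeriv (DiffForm.pullbackModel α G) y = 0 := by
  rw [(DiffForm.pullbackModel_eventuallyEq α hG).extDeriv_eq]
  have hg : ContDiffAt ℝ ∞ (fun q => extChartAt 𝓘(ℝ, E) (G y) (G q)) y := by
    rw [← contMDiffAt_iff_contDiffAt]
    exact contMDiffAt_extChartAt.comp y hG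
  have ht := (isOpen_extChartAt_target (I := 𝓘(ℝ, E)) (G y)).mem_nhds
    (mem_extChartAt_target (I := 𝓘(ℝ, E)) (G y))
  have h := _root_.extDeriv_pullback (r := ∞) (f := fun q => extChartAt 𝓘(ℝ, E) (G y) (G q))
    (((hα (G y)).contDiffAt ht).differentiableAt (by simp)) hg
    (by simp only [minSmoothness_of_isRCLikeNormedField];
        exact WithTop.coe_le_coe.2 le_top)
  refine h.trans ?_
  rw [hα' (G y) _ (mem_extChartAt_target (G y))]
  ext
  rfl

end Pullback

/-! ### Parallel transport along rays -/

section Trivialization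

variable {E : Type*} [NormedAddCommGroup E] [NormedSpace ℝ E] [FiniteDimensional ℝ E]
  {M : Type*} [TopologicalSpace M] [ChartedSpace E M] [IsManifold 𝓘(ℝ, E) ∞ M] [T2Space M]

/-- The transport maps of a smooth linear family of vector fields lifting the constant vector
fields along a proper map. -/
theorem SmoothFieldFamily.exists_lifted_translation {P : Type*} [NormedAddCommGroup P]
    [NormedSpace ℝ P] [FiniteDimensional ℝ P] {V : ∀ x : M, P →L[ℝ] TangentSpace 𝓘(ℝ, E) x}
    {p : M → P} (hV : SmoothFieldFamily V)
    (hp : ContMDiff 𝓘(ℝ, E) 𝓘(ℝ, P) ∞ p) (hproper : IsProperMap p)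
    (hpV : ∀ x z, mfderiv 𝓘(ℝ, E) 𝓘(ℝ, P) p x (V x z) = z) :
    ∃ Ξ : M × P → M, ContMDiff (𝓘(ℝ, E).prod 𝓘(ℝ, P)) 𝓘(ℝ, E) ∞ Ξ ∧
      (∀ m, Ξ (m, 0) = m) ∧
      (∀ m z (s t : ℝ), Ξ (Ξ (m, s • z), t • z) = Ξ (m, (s + t) • z)) ∧
      (∀ m z, IsMIntegralCurve (I := 𝓘(ℝ, E)) (fun t : ℝ => Ξ (m, t • z)) fun x => V x z) ∧
      ∀ m z, p (Ξ (m, z)) = p m + z := by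
  have hcomplete := hV.complete_of_proper hp hproper hpV
  obtain ⟨Ξ, hΞ, hΞγ⟩ := hV.exists_transport hcomplete
  -- By uniqueness of integral curves, `Ξ (·, t • z)` advances every integral curve of `V z` by time
  -- `t`, from any starting point.
  have key : ∀ z γ, IsMIntegralCurve (I := 𝓘(ℝ, E)) γ (fun x => V x z) → ∀ s t : ℝ,
      Ξ (γ s, t • z) = γ (s + t) := by
    intro z γ hγ s t
    have h1 : IsMIntegralCurve (I := 𝓘(ℝ, E)) ((γ ∘ (· + s)) ∘ (· * t)) fun x => V x (t • z) := by
      have := (hγ.comp_add s).comp_mul t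
      have h2 : (fun x => V x (t • z)) = t • fun x => V x z := by
        funext x
        simp
      rwa [h2]
    have h2 := hΞγ _ _ h1
    simp only [Function.comp_apply, one_mul, zero_mul, zero_add] at h2
    rw [← h2, add_comm]
  have key' : ∀ m z, IsMIntegralCurve (I := 𝓘(ℝ, E)) (fun t : ℝ => Ξ (m, t • z))
      fun x => V x z := by
    intro m z
    obtain ⟨γ, rfl, hγ⟩ := hcomplete m z
    have : (fun t : ℝ => Ξ (γ 0, t • z)) = γ := by
      funext t
      rw [key z γ hγ, zero_add]
    rwa [this]
  refine ⟨Ξ, hΞ, fun m => ?_, fun m z s t => ?_, key', fun m z => ?_⟩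
  · obtain ⟨γ, rfl, hγ⟩ := hcomplete m 0
    simpa using key 0 γ hγ 0 0
  · obtain ⟨γ, rfl, hγ⟩ := hcomplete m z
    rw [key z γ hγ, key z γ hγ, key z γ hγ]
    congr 1
    ring
  · have h0 : ∀ t, HasDerivAt (fun t : ℝ => p (Ξ (m, t • z)) - t • z) 0 t := by
      intro t
      have h1 := hasDerivAt_comp_integralCurve (X := fun x => V x z) (key' m z t)
        ((hp _).mdifferentiableAt (by simp))
      have h2 := h1.congr_deriv (hpV _ z)
      exact (h2.sub ((hasDerivAt_id t).smul_const z)).congr_deriv (by simp)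
    have h3 := is_const_of_deriv_eq_zero (fun t => (h0 t).differentiableAt)
      (fun t => (h0 t).deriv) 1 0
    obtain ⟨γ, rfl, hγ⟩ := hcomplete m z
    have h4 := key z γ hγ 0 0
    simp only [zero_smul, add_zero] at h4
    simp only [one_smul, zero_smul, sub_zero, h4] at h3
    rw [← h3]
    abel

variable {p : M → ℂ} {Ω : DiffForm 𝓘(ℝ, E) M 2}
  {E₀ : Type*} [NormedAddCommGroup E₀] [NormedSpace ℝ E₀]
  {F : Type*} [TopologicalSpace F] [ChartedSpace E₀ F] [IsManifold 𝓘(ℝ, E₀) ∞ F]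
  [CompactSpace F] {αF : DiffForm 𝓘(ℝ, E₀) F 2}

/-- Radial parallel transport trivializes a Hamiltonian fibration over the plane. -/
theorem IsHamiltonianFibration.exists_trivialization
    (hp : IsHamiltonianFibration 𝓘(ℝ, E) 𝓘(ℝ, E₀) p Ω αF) (hΩ : IsSymplecticForm 𝓘(ℝ, E) Ω)
    {ι : F → M} (hι : Manifold.IsSmoothEmbedding 𝓘(ℝ, E₀) 𝓘(ℝ, E) ∞ ι)
    (hF : Set.range ι = p ⁻¹' {0}) :
    ∃ (V : ∀ x : M, ℂ →L[ℝ] TangentSpace 𝓘(ℝ, E) x) (r : M → ℝ) (Φ : F × ℂ → M) (Ψ : M → F × ℂ),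
      ContMDiff 𝓘(ℝ, E) 𝓘(ℝ, ℝ) ∞ r ∧ (∀ x, r x ≠ 0) ∧
      (∀ x z w, Ω x ![V x z, w] =
        r x * ((starRingEnd ℂ) z * (show ℂ from mfderiv 𝓘(ℝ, E) 𝓘(ℝ, ℂ) p x w)).im) ∧
      ContMDiff (𝓘(ℝ, E₀).prod 𝓘(ℝ, ℂ)) 𝓘(ℝ, E) ∞ Φ ∧
      ContMDiff 𝓘(ℝ, E) (𝓘(ℝ, E₀).prod 𝓘(ℝ, ℂ)) ∞ Ψ ∧
      (∀ q, Ψ (Φ q) = q) ∧ (∀ m, Φ (Ψ m) = m) ∧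
      (∀ q, p (Φ q) = q.2) ∧ (∀ x, Φ (x, 0) = ι x) ∧
      ∀ x z, IsMIntegralCurve (I := 𝓘(ℝ, E)) (fun t : ℝ => Φ (x, t • z)) fun x => V x z := by
  obtain ⟨V, r, hV, hr, hr0, hpV, hΩV⟩ := hp.exists_horizontal_lift hΩ
  obtain ⟨Ξ, hΞ, hΞ0, hΞa, hΞi, hΞp⟩ :=
    hV.exists_lifted_translation hp.submersion.contMDiff hp.proper hpV
  have hιp : ∀ x, p (ι x) = 0 := fun x => by
    have : ι x ∈ p ⁻¹' {0} := hF ▸ mem_range_self x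
    exact this
  have hinv : ∀ m z, Ξ (Ξ (m, z), -z) = m := fun m z => by
    have := hΞa m z 1 (-1)
    simpa [hΞ0] using this
  have hinv' : ∀ m z, Ξ (Ξ (m, -z), z) = m := fun m z => by
    have := hinv m (-z)
    rwa [neg_neg] at this
  -- Transport by `-p m` brings `m` back to the zero fibre; the point reached is the `F`-component
  -- of `Ψ m`.
  have hex : ∀ m, ∃ x, ι x = Ξ (m, -p m) := fun m => by
    have : Ξ (m, -p m) ∈ range ι := by
      rw [hF, mem_preimage, hΞp]
      simp
    exact this
  choose a ha using hex
  have hps := hp.submersion.contMDiff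
  have has : ContMDiff 𝓘(ℝ, E) 𝓘(ℝ, E₀) ∞ a := by
    have h1 : ContMDiff 𝓘(ℝ, E) 𝓘(ℝ, E) ∞ (ι ∘ a) := by
      have : ι ∘ a = fun m => Ξ (m, -p m) := funext ha
      rw [this]
      exact hΞ.comp (contMDiff_id.prodMk hps.neg)
    -- Since `ι` is an immersion and a topological embedding, smoothness of `ι ∘ a` passes to `a`.
    exact (ContMDiff.iff_comp_isImmersion hι.isImmersion).2
      ⟨hι.isEmbedding.continuous_iff.2 h1.continuous, h1⟩
  refine ⟨V, r, fun q => Ξ (ι q.1, q.2), fun m => (a m, p m), hr, hr0, hΩV, ?_,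
    has.prodMk hps, fun q => ?_, fun m => ?_, fun q => ?_, fun x => hΞ0 _, fun x z => hΞi (ι x) z⟩
  · exact hΞ.comp ((hι.isImmersion.contMDiff.comp contMDiff_fst).prodMk contMDiff_snd)
  · have h1 : p (Ξ (ι q.1, q.2)) = q.2 := by rw [hΞp, hιp, zero_add]
    refine Prod.ext (hι.isEmbedding.injective ?_) h1
    change ι (a _) = _
    rw [ha, h1, hinv]
  · change Ξ (ι (a m), p m) = m
    rw [ha, hinv']
  · change p (Ξ (ι q.1, q.2)) = q.2
    rw [hΞp, hιp, zero_add]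

end Trivialization

/-! ### Weighted means along rays and radial rescaling -/

section RadialMean

variable {E : Type*} [NormedAddCommGroup E] [NormedSpace ℝ E]
  {P : Type*} [NormedAddCommGroup P] [NormedSpace ℝ P]

/-- The mean of `ρ` along rays, weighted by the parameter. -/
noncomputable def radialMean (ρ : E × P → ℝ) (q : E × P) : ℝ :=
  ∫ t in (0 : ℝ)..1, t * ρ (q.1, t • q.2)

/-- The rays of a product, as a linear map. -/
noncomputable def rayCLM : E × P →L[ℝ] C(Icc (0 : ℝ) 1, E × P) :=
  LinearMap.mkContinuous
    { toFun := fun q => ⟨fun t => (q.1, (t : ℝ) • q.2), by fun_prop⟩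
      map_add' := fun q q' => by ext t <;> simp
      map_smul' := fun c q => by ext t <;> simp [smul_comm c] } 1 fun q => by
    rw [one_mul, ContinuousMap.norm_le _ (norm_nonneg q)]
    rintro ⟨t, ht⟩
    refine max_le (norm_fst_le q) ?_
    change ‖t • q.2‖ ≤ _
    rw [norm_smul, Real.norm_of_nonneg ht.1]
    exact (mul_le_of_le_one_left (norm_nonneg _) ht.2).trans (norm_snd_le q)

/-- The weighted integral as a linear form. -/
noncomputable def weightedIntegralCLM : C(Icc (0 : ℝ) 1, ℝ) →L[ℝ] ℝ :=
  LinearMap.mkContinuous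
    { toFun := fun γ => ∫ t in (0 : ℝ)..1, t * γ (projIcc 0 1 zero_le_one t)
      map_add' := fun γ γ' => by
        simp only [ContinuousMap.add_apply, mul_add]
        refine intervalIntegral.integral_add ?_ ?_ <;>
        · refine Continuous.intervalIntegrable ?_ _ _
          exact continuous_id.mul ((ContinuousMap.continuous _).comp continuous_projIcc)
      map_smul' := fun c γ => by
        simp only [ContinuousMap.smul_apply, smul_eq_mul, mul_left_comm _ c,
          intervalIntegral.integral_const_mul, RingHom.id_apply] } 1 fun γ => by
    have := intervalIntegral.norm_integral_le_of_norm_le_const (a := (0 : ℝ)) (b := 1) (C := ‖γ‖)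
      (f := fun t => t * γ (projIcc 0 1 zero_le_one t)) (fun t ht => by
        rw [uIoc_of_le zero_le_one] at ht
        rw [norm_mul, Real.norm_of_nonneg ht.1.le]
        exact (mul_le_of_le_one_left (norm_nonneg _) ht.2).trans (γ.norm_coe_le_norm _))
    simpa using this

/-- The mean is the composition of the linear ray map, superposition with `ρ` and a continuous
linear functional. No differentiation under the integral sign is needed. -/
lemma contDiff_radialMean {ρ : E × P → ℝ} (hρ : ContDiff ℝ ∞ ρ) : ContDiff ℝ ∞ (radialMean ρ) := by
  rw [contDiff_infty]
  intro n
  have h1 := ContinuousMap.contDiff_comp (K := Icc (0 : ℝ) 1) n ⟨ρ, hρ.continuous⟩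
    (hρ.of_le (by exact_mod_cast le_top))
  have h2 : radialMean ρ = fun q =>
      weightedIntegralCLM ((⟨ρ, hρ.continuous⟩ : C(E × P, ℝ)).comp (rayCLM q)) := by
    funext q
    refine intervalIntegral.integral_congr fun t ht => ?_
    rw [uIcc_of_le zero_le_one] at ht
    change t * _ = t * ρ (q.1, ((projIcc 0 1 zero_le_one t : Icc (0 : ℝ) 1) : ℝ) • q.2)
    rw [projIcc_of_mem _ ht]
  rw [h2]
  have h3 : ContDiff ℝ n (rayCLM : E × P → C(Icc (0 : ℝ) 1, E × P)) :=
    ContinuousLinearMap.contDiff _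
  have h4 : ContDiff ℝ n (weightedIntegralCLM : C(Icc (0 : ℝ) 1, ℝ) → ℝ) :=
    ContinuousLinearMap.contDiff _
  exact h4.comp (h1.comp h3)

/-- Rays do not move `u`, so a cutoff in the variable `u` alone leaves the mean unchanged near `u₀`
and reduces to a globally smooth `ρ`. -/
lemma contDiffOn_radialMean [FiniteDimensional ℝ E] {ρ : E × P → ℝ} {U : Set E} (hU : IsOpen U)
    (hρ : ContDiffOn ℝ ∞ ρ (U ×ˢ univ)) : ContDiffOn ℝ ∞ (radialMean ρ) (U ×ˢ univ) := by
  rintro ⟨u₀, z₀⟩ ⟨hu₀, -⟩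
  obtain ⟨ε, hε, hball⟩ := Metric.isOpen_iff.1 hU u₀ hu₀
  let χ : ContDiffBump u₀ := ⟨ε / 3, ε / 2, by positivity, by linarith⟩
  have hs : ContDiff ℝ ∞ (fun q : E × P => χ q.1 * ρ q) := by
    rw [contDiff_iff_contDiffAt]
    rintro ⟨u, z⟩
    by_cases hu : u ∈ U
    · exact (χ.contDiff.contDiffAt.comp (u, z) contDiffAt_fst).mul
        (hρ.contDiffAt ((hU.prod isOpen_univ).mem_nhds ⟨hu, mem_univ _⟩))
    · have h1 : (fun q : E × P => χ q.1 * ρ q) =ᶠ[𝓝 (u, z)] fun _ => 0 := by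
        have h2 : ∀ᶠ u' in 𝓝 u, u' ∉ Metric.closedBall u₀ (ε / 2) :=
          Metric.isClosed_closedBall.isOpen_compl.mem_nhds fun h =>
            hu (hball (Metric.closedBall_subset_ball (by linarith) h))
        filter_upwards [continuous_fst.continuousAt.eventually h2] with q hq
        rw [χ.zero_of_le_dist (by simpa using (not_le.1 hq).le), zero_mul]
      exact contDiffAt_const.congr_of_eventuallyEq h1
  have h3 : radialMean ρ =ᶠ[𝓝 (u₀, z₀)] radialMean fun q : E × P => χ q.1 * ρ q := by
    have h2 : ∀ᶠ u' in 𝓝 u₀, χ u' = 1 := χ.eventuallyEq_one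
    filter_upwards [continuous_fst.continuousAt.eventually h2] with q hq
    simp only [radialMean, hq, one_mul]
  exact ((contDiff_radialMean hs).contDiffAt.congr_of_eventuallyEq h3).contDiffWithinAt

lemma sq_mul_radialMean (ρ : E × P → ℝ) (u : E) (z : P) (t : ℝ) :
    t ^ 2 * radialMean ρ (u, t • z) = ∫ τ in (0 : ℝ)..t, τ * ρ (u, τ • z) := by
  have h := intervalIntegral.smul_integral_comp_mul_right (a := 0) (b := 1)
    (fun τ => τ * ρ (u, τ • z)) t
  rw [zero_mul, one_mul] at h
  rw [← h, radialMean, sq, mul_assoc, smul_eq_mul, ← intervalIntegral.integral_const_mul]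
  congr 1
  refine intervalIntegral.integral_congr fun τ _ => ?_
  simp only [smul_smul]
  ring

lemma hasDerivAt_sq_mul_radialMean {ρ : E × P → ℝ} {u : E} {z : P}
    (hρ : Continuous fun t : ℝ => ρ (u, t • z)) (t : ℝ) :
    HasDerivAt (fun t : ℝ => t ^ 2 * radialMean ρ (u, t • z)) (t * ρ (u, t • z)) t := by
  simp only [sq_mul_radialMean]
  exact (continuous_id.mul hρ).integral_hasStrictDerivAt 0 t |>.hasDerivAt

/-- This is the derivative at `t = 1` of `t² H (u, tz) = ∫₀ᵗ τ ρ (u, τz) dτ`. It is the radial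
equation that gives `√H • z` the prescribed area contraction in `area_sqrt_smul`. -/
lemma two_mul_radialMean_add {ρ : E × P → ℝ} {u : E} {z : P}
    (hρ : Continuous fun t : ℝ => ρ (u, t • z)) (hd : DifferentiableAt ℝ (radialMean ρ) (u, z)) :
    2 * radialMean ρ (u, z) + fderiv ℝ (radialMean ρ) (u, z) (0, z) = ρ (u, z) := by
  have h1 : HasDerivAt (fun t : ℝ => ((u, t • z) : E × P)) (0, z) 1 :=
    (hasDerivAt_const 1 u).prodMk (((hasDerivAt_id (1 : ℝ)).smul_const z).congr_deriv (one_smul ℝ z))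
  have hd' : HasFDerivAt (radialMean ρ) (fderiv ℝ (radialMean ρ) (u, z)) (u, (1 : ℝ) • z) := by
    rw [one_smul]; exact hd.hasFDerivAt
  have h2 := HasFDerivAt.comp_hasDerivAt (f := fun t : ℝ => ((u, t • z) : E × P)) 1 hd' h1
  have h3 := (hasDerivAt_pow 2 (1 : ℝ)).mul h2
  have h4 := h3.unique (hasDerivAt_sq_mul_radialMean hρ 1)
  simpa using h4

lemma radialMean_pos {ρ : E × P → ℝ} {u : E} {z : P}
    (hρ : Continuous fun t : ℝ => ρ (u, t • z)) (hpos : ∀ t : ℝ, 0 < ρ (u, t • z)) :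
    0 < radialMean ρ (u, z) :=
  intervalIntegral.intervalIntegral_pos_of_pos_on
    ((continuous_id.mul hρ).intervalIntegrable _ _)
    (fun t ht => mul_pos ht.1 (hpos t)) zero_lt_one

lemma strictMonoOn_sq_mul_radialMean {ρ : E × P → ℝ} {u : E} {z : P}
    (hρ : Continuous fun t : ℝ => ρ (u, t • z)) (hpos : ∀ t : ℝ, 0 < ρ (u, t • z)) :
    StrictMonoOn (fun t : ℝ => t ^ 2 * radialMean ρ (u, t • z)) (Ici 0) := by
  refine strictMonoOn_of_deriv_pos (convex_Ici 0)
    (fun t _ => (hasDerivAt_sq_mul_radialMean hρ t).continuousAt.continuousWithinAt) fun t ht => ?_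
  rw [interior_Ici] at ht
  rw [(hasDerivAt_sq_mul_radialMean hρ t).deriv]
  exact mul_pos ht (hpos t)

/-- The area form pulled back by a rescaled linear map, contracted with a radial vector. -/
lemma area_sqrt_smul {H : E → ℝ} {q : E} (hH : 0 < H q) (hd : DifferentiableAt ℝ H q)
    (T : E →L[ℝ] ℂ) {X : E} (hX : T X = T q) (w : E) :
    2 * ((starRingEnd ℂ) (fderiv ℝ (fun q => √(H q) • T q) q X) *
      fderiv ℝ (fun q => √(H q) • T q) q w).im =
      (2 * H q + fderiv ℝ H q X) * ((starRingEnd ℂ) (T q) * T w).im := by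
  have h1 : HasFDerivAt (fun q => √(H q) • T q) _ q :=
    (hd.hasFDerivAt.sqrt hH.ne').smul (T.hasFDerivAt (x := q))
  rw [h1.fderiv]
  have h2 : √(H q) ≠ 0 := (Real.sqrt_pos.2 hH).ne'
  have h3 : √(H q) ^ 2 = H q := Real.sq_sqrt hH.le
  simp [hX]
  field_simp
  simp only [h3]
  ring

/-- Equal images of nonzero vectors lie on one open ray, so `w = t • z` with `t > 0`. The squared
length of the image of `t • z` is `‖z‖²` times the strictly increasing function in `hmono`, so `t =
1`. -/
lemma injective_sqrt_smul {P : Type*} [NormedAddCommGroup P] [NormedSpace ℝ P] {k : P → ℝ}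
    (hk : ∀ z, 0 < k z) (hmono : ∀ z, StrictMonoOn (fun t : ℝ => t ^ 2 * k (t • z)) (Ici 0)) :
    Function.Injective fun z => √(k z) • z := by
  intro z w hzw
  have hzw' : √(k z) • z = √(k w) • w := hzw
  have hw0 := Real.sqrt_pos.2 (hk w)
  rcases eq_or_ne z 0 with rfl | hz
  · rw [smul_zero, eq_comm, smul_eq_zero] at hzw'
    exact (hzw'.resolve_left hw0.ne').symm
  · let t : ℝ := (√(k w))⁻¹ * √(k z)
    have ht : 0 < t := mul_pos (inv_pos.2 hw0) (Real.sqrt_pos.2 (hk z))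
    have hw : w = t • z := by rw [mul_smul, hzw', inv_smul_smul₀ hw0.ne']
    have h1 : t ^ 2 * k (t • z) = 1 ^ 2 * k ((1 : ℝ) • z) := by
      have h2 : t * √(k (t • z)) = √(k z) := by
        rw [← hw]
        simp only [t]
        field_simp
      have h3 : t ^ 2 * k (t • z) = (t * √(k (t • z))) ^ 2 := by
        rw [mul_pow t, Real.sq_sqrt (hk _).le]
      rw [h3, h2, Real.sq_sqrt (hk z).le, one_smul, one_pow, one_mul]
    rw [hw, (hmono z).injOn ht.le (zero_le_one (α := ℝ)) h1, one_smul]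

end RadialMean

/-! ### Radial symplectic forms on the plane -/

section PlaneForm

lemma plane_form_apply (η : ℂ [⋀^Fin 2]→L[ℝ] ℝ) (a b : ℂ) :
    η ![a, b] = η ![1, Complex.I] * ((starRingEnd ℂ) a * b).im := by
  have h : ∀ z : ℂ, z = z.re • (1 : ℂ) + z.im • Complex.I := fun z => by
    apply Complex.ext <;> simp
  rw [← formFlat_apply, ← formFlat_apply]
  conv_lhs => rw [h a, h b]
  simp only [map_add, map_smul, add_apply, smul_apply, smul_eq_mul]
  have h1 : formFlat η 1 1 = 0 := form_self η 1
  have h2 : formFlat η Complex.I Complex.I = 0 := form_self η _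
  have h3 : formFlat η Complex.I 1 = -formFlat η 1 Complex.I := form_swap η _ _
  rw [h1, h2, h3]
  simp
  ring

/-- One has `d(f dθ) = f' dr ∧ dθ`, and `z`, `iz` are the values at `z` of `r ∂_r` and `∂_θ`. -/
lemma hasDerivAt_radial_form {f : ℝ → ℝ} {z : ℂ} (hz : z ≠ 0) (hf : DifferentiableAt ℝ f ‖z‖) :
    dRadialTheta f z ![z, Complex.I * z] = ‖z‖ * deriv f ‖z‖ := by
  have hn : 0 < ‖z‖ := norm_pos_iff.2 hz
  have hθ : DifferentiableAt ℝ (fun y : ℂ => f ‖y‖ • dTheta y) z := by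
    have h1 : DifferentiableAt ℝ (fun y : ℂ => f ‖y‖) z :=
      hf.comp z (differentiableAt_id.norm ℝ hz)
    have h2 : DifferentiableAt ℝ (fun y : ℂ => y⁻¹) z := differentiableAt_id.inv hz
    have h3 : DifferentiableAt ℝ dTheta z := by
      unfold dTheta
      fun_prop
    exact h1.smul h3
  have hη : DifferentiableAt ℝ (fun y : ℂ =>
      ContinuousAlternatingMap.ofSubsingleton ℝ ℂ ℝ (0 : Fin 1) (f ‖y‖ • dTheta y)) z := by
    exact (ContinuousAlternatingMap.ofSubsingletonLIE (𝕜 := ℝ) (E := ℂ) (F := ℝ)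
      (0 : Fin 1)).differentiableAt.comp z hθ
  have h0 : (0 : Fin 2).removeNth ![z, Complex.I * z] = ![Complex.I * z] := by
    ext i; fin_cases i; rfl
  have h1 : (1 : Fin 2).removeNth ![z, Complex.I * z] = ![z] := by
    ext i; fin_cases i; rfl
  rw [dRadialTheta, extDeriv_apply hη, Fin.sum_univ_two, h0, h1]
  have happ : ∀ v : ℂ, (fun y : ℂ => ContinuousAlternatingMap.ofSubsingleton ℝ ℂ ℝ (0 : Fin 1)
      (f ‖y‖ • dTheta y) ![v]) = fun y => f ‖y‖ * (y⁻¹ * v).im := by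
    intro v
    funext y
    rfl
  have hd : ∀ v, DifferentiableAt ℝ (fun y : ℂ => f ‖y‖ * (y⁻¹ * v).im) z := by
    intro v
    exact hθ.clm_apply (differentiableAt_const v)
  have hline : ∀ v a : ℂ, HasDerivAt (fun t : ℝ => f ‖z + t • a‖ * ((z + t • a)⁻¹ * v).im)
      (fderiv ℝ (fun y : ℂ => f ‖y‖ * (y⁻¹ * v).im) z a) 0 := fun v a =>
    ((hd v).hasFDerivAt.hasLineDerivAt a)
  rw [happ, happ]
  -- At `(1 + t) z` the fixed vector `iz` has `dθ` equal to `(1 + t)⁻¹`. The resulting term `-f`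
  -- cancels against `e2`.
  have e1 : fderiv ℝ (fun y : ℂ => f ‖y‖ * (y⁻¹ * (Complex.I * z)).im) z z =
      ‖z‖ * deriv f ‖z‖ - f ‖z‖ := by
    refine (hline (Complex.I * z) z).unique ?_
    have h2 : (fun t : ℝ => f ‖z + t • z‖ * ((z + t • z)⁻¹ * (Complex.I * z)).im) =ᶠ[𝓝 0]
        fun t => f ((1 + t) * ‖z‖) * (1 + t)⁻¹ := by
      have : ∀ᶠ t : ℝ in 𝓝 0, -1 < t := eventually_gt_nhds (by norm_num)
      filter_upwards [this] with t ht
      have ht' : 0 < 1 + t := by linarith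
      have h3 : z + t • z = ((1 + t : ℝ) : ℂ) * z := by simp; ring
      have h4 : (((1 + t : ℝ) : ℂ) * z)⁻¹ * (Complex.I * z) = (((1 + t)⁻¹ : ℝ) : ℂ) * Complex.I := by
        push_cast
        field_simp
      rw [h3, h4, norm_mul, Complex.norm_real, Real.norm_of_nonneg ht'.le, Complex.im_ofReal_mul]
      simp
    refine HasDerivAt.congr_of_eventuallyEq ?_ h2
    have h5 : HasDerivAt (fun t : ℝ => 1 + t) 1 0 := (hasDerivAt_id (0 : ℝ)).const_add 1
    have h6 : HasDerivAt (fun t : ℝ => f ((1 + t) * ‖z‖)) (deriv f ‖z‖ * ‖z‖) 0 := by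
      have h7 := h5.mul_const ‖z‖
      have h8 : HasDerivAt f (deriv f ‖z‖) ((1 + 0) * ‖z‖) := by simpa using hf.hasDerivAt
      exact (h8.comp 0 h7).congr_deriv (by ring)
    exact (h6.mul (h5.inv (by norm_num))).congr_deriv (by simp; ring)
  have e2 : fderiv ℝ (fun y : ℂ => f ‖y‖ * (y⁻¹ * z).im) z (Complex.I * z) = - f ‖z‖ := by
    refine (hline z (Complex.I * z)).unique ?_
    have h2 : (fun t : ℝ => f ‖z + t • (Complex.I * z)‖ * ((z + t • (Complex.I * z))⁻¹ * z).im) =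
        fun t => f (√(1 + t ^ 2) * ‖z‖) * -(t * (1 + t ^ 2)⁻¹) := by
      funext t
      have h3 : z + t • (Complex.I * z) = (1 + t * Complex.I) * z := by simp; ring
      have h4 : ((1 + t * Complex.I) * z)⁻¹ * z = (1 + t * Complex.I)⁻¹ := by
        rw [mul_inv, mul_assoc, inv_mul_cancel₀ hz, mul_one]
      have h5 : ‖(1 + t * Complex.I : ℂ)‖ = √(1 + t ^ 2) := by
        rw [Complex.norm_def, Complex.normSq_apply]
        simp [sq]
      rw [h3, h4, norm_mul, h5, Complex.inv_im, Complex.normSq_apply]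
      simp [sq]
      field_simp
    rw [h2]
    have h5 : HasDerivAt (fun t : ℝ => 1 + t ^ 2) 0 0 := by
      simpa using (hasDerivAt_pow 2 (0 : ℝ)).const_add 1
    have h6 : HasDerivAt (fun t : ℝ => f (√(1 + t ^ 2) * ‖z‖)) 0 0 := by
      have h7 := (h5.sqrt (by norm_num)).mul_const ‖z‖
      have h8 : HasDerivAt f (deriv f ‖z‖) (√(1 + 0 ^ 2) * ‖z‖) := by simpa using hf.hasDerivAt
      exact (h8.comp 0 h7).congr_deriv (by simp)
    have h7 : HasDerivAt (fun t : ℝ => -(t * (1 + t ^ 2)⁻¹)) (-1) 0 :=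
      (((hasDerivAt_id (0 : ℝ)).mul (h5.inv (by norm_num))).neg).congr_deriv (by simp)
    exact (h6.mul h7).congr_deriv (by simp)
  change (-1) ^ 0 • fderiv ℝ (fun y : ℂ => f ‖y‖ * (y⁻¹ * (Complex.I * z)).im) z z +
    (-1) ^ 1 • fderiv ℝ (fun y : ℂ => f ‖y‖ * (y⁻¹ * z).im) z (Complex.I * z) = _
  rw [e1, e2]
  simp

variable {σ : DiffForm 𝓘(ℝ, ℂ) ℂ 2} {f : ℝ → ℝ}

/-- The density of a `2`-form on the plane. -/
noncomputable def planeDensity (σ : DiffForm 𝓘(ℝ, ℂ) ℂ 2) (z : ℂ) : ℝ :=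
  (show ℂ [⋀^Fin 2]→L[ℝ] ℝ from σ z) ![1, Complex.I]

lemma planeDensity_apply (σ : DiffForm 𝓘(ℝ, ℂ) ℂ 2) (z a b : ℂ) :
    (show ℂ [⋀^Fin 2]→L[ℝ] ℝ from σ z) ![a, b] =
      planeDensity σ z * ((starRingEnd ℂ) a * b).im :=
  plane_form_apply _ a b

lemma IsSymplecticForm.contDiff_planeDensity (hσ : IsSymplecticForm 𝓘(ℝ, ℂ) σ) :
    ContDiff ℝ ∞ (planeDensity σ) := by
  have h1 := hσ.smooth 0
  have h2 : ContDiffOn ℝ ∞ (planeDensity σ) univ := by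
    have h3 := contDiffOn_form_apply h1 ![1, Complex.I]
    simp only [extChartAt_model_space_eq_id, PartialEquiv.refl_target] at h3
    refine h3.congr fun z _ => ?_
    have h5 : mfderiv 𝓘(ℝ, ℂ) 𝓘(ℝ, ℂ) (extChartAt 𝓘(ℝ, ℂ) (0 : ℂ)).symm z =
        ContinuousLinearMap.id ℝ ℂ := by
      rw [extChartAt_model_space_eq_id]
      exact mfderiv_id
    have h4 : DiffForm.inChart 𝓘(ℝ, ℂ) σ 0 z ![1, Complex.I] = _ :=
      DiffForm.pullback_apply_two (I := 𝓘(ℝ, ℂ)) (I' := 𝓘(ℝ, ℂ))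
        (extChartAt 𝓘(ℝ, ℂ) (0 : ℂ)).symm σ z (1 : ℂ) Complex.I
    rw [h4, h5]
    rfl
  exact contDiffOn_univ.1 h2

lemma IsSymplecticForm.planeDensity_ne_zero (hσ : IsSymplecticForm 𝓘(ℝ, ℂ) σ) (z : ℂ) :
    planeDensity σ z ≠ 0 := by
  intro h
  have h1 := hσ.nondegenerate z (1 : ℂ) fun w => by
    have := planeDensity_apply σ z 1 w
    rwa [h, zero_mul] at this
  exact one_ne_zero (α := ℂ) h1

lemma norm_mul_planeDensity (hf : ContDiffOn ℝ ∞ f (Ici 0))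
    (hσf : ∀ z : ℂ, z ≠ 0 → σ z = dRadialTheta f z) {z : ℂ} (hz : z ≠ 0) :
    ‖z‖ * planeDensity σ z = deriv f ‖z‖ := by
  have hn : 0 < ‖z‖ := norm_pos_iff.2 hz
  have h1 := hasDerivAt_radial_form hz
    ((hf.contDiffAt (Ici_mem_nhds hn)).differentiableAt (by simp))
  have h2 := planeDensity_apply σ z z (Complex.I * z)
  have h3 : (show ℂ [⋀^Fin 2]→L[ℝ] ℝ from σ z) = dRadialTheta f z := hσf z hz
  have h4 : ((starRingEnd ℂ) z * (Complex.I * z)).im = ‖z‖ ^ 2 := by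
    rw [mul_left_comm, mul_comm ((starRingEnd ℂ) z), Complex.mul_conj, Complex.normSq_eq_norm_sq]
    simp
    norm_cast
  rw [h3, h1, h4] at h2
  have h5 : ‖z‖ * (‖z‖ * planeDensity σ z) = ‖z‖ * deriv f ‖z‖ := by rw [h2]; ring
  exact mul_left_cancel₀ hn.ne' h5

lemma monotoneOn_deriv (hf : ContDiffOn ℝ ∞ f (Ici 0))
    (hf2 : ∀ r : ℝ, 0 < r → 0 ≤ iteratedDeriv 2 f r) : MonotoneOn (deriv f) (Ioi 0) := by
  have h1 : ContDiffOn ℝ 1 (deriv f) (Ioi 0) :=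
    (hf.mono Ioi_subset_Ici_self).deriv_of_isOpen isOpen_Ioi (by exact WithTop.coe_le_coe.2 le_top)
  refine monotoneOn_of_deriv_nonneg (convex_Ioi 0) h1.continuousOn ?_ ?_
  · rw [interior_Ioi]
    exact h1.differentiableOn (by simp)
  · intro r hr
    rw [interior_Ioi] at hr
    have := hf2 r hr
    rwa [iteratedDeriv_succ, iteratedDeriv_one] at this

/-- With density `s`, the function `r s(r) = f'(r)` is nondecreasing on `r > 0` and tends to `0` at
the origin, so `s 1 ≥ 0`. The density has no zeros, and connectedness of the plane spreads the sign.
-/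
lemma planeDensity_pos (hσ : IsSymplecticForm 𝓘(ℝ, ℂ) σ) (hf : ContDiffOn ℝ ∞ f (Ici 0))
    (hf2 : ∀ r : ℝ, 0 < r → 0 ≤ iteratedDeriv 2 f r)
    (hσf : ∀ z : ℂ, z ≠ 0 → σ z = dRadialTheta f z) (z : ℂ) : 0 < planeDensity σ z := by
  have hs := hσ.contDiff_planeDensity.continuous
  have hder : ∀ r : ℝ, 0 < r → r * planeDensity σ r = deriv f r := fun r hr => by
    have := norm_mul_planeDensity hf hσf (z := (r : ℂ)) (by exact_mod_cast hr.ne')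
    rwa [Complex.norm_real, Real.norm_of_nonneg hr.le] at this
  have h1 : 0 < planeDensity σ 1 := by
    by_contra h
    have h2 : planeDensity σ 1 < 0 := lt_of_le_of_ne (not_lt.1 h) (hσ.planeDensity_ne_zero 1)
    have h3 : Tendsto (fun r : ℝ => r * planeDensity σ r) (𝓝[>] 0) (𝓝 0) := by
      have : Continuous fun r : ℝ => r * planeDensity σ r := by fun_prop
      have := this.tendsto 0
      rw [zero_mul] at this
      exact this.mono_left nhdsWithin_le_nhds
    have h4 : (0 : ℝ) ≤ planeDensity σ 1 := by
      refine le_of_tendsto h3 ?_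
      filter_upwards [Ioo_mem_nhdsGT (zero_lt_one (α := ℝ))] with r hr
      have h5 := monotoneOn_deriv hf hf2 hr.1 (zero_lt_one (α := ℝ)) hr.2.le
      rw [← hder r hr.1, ← hder 1 zero_lt_one] at h5
      simpa using h5
    linarith
  by_contra h
  obtain ⟨w, -, hw⟩ := isPreconnected_univ.intermediate_value (mem_univ z) (mem_univ (1 : ℂ))
    hs.continuousOn ⟨not_lt.1 h, h1.le⟩
  exact hσ.planeDensity_ne_zero w hw

end PlaneForm

/-! ### Normal form of the radial symplectic form -/

section AreaNormalization

/-- The coefficient on the right is the determinant of `L`. -/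
lemma area_comp_linear (L : ℂ →L[ℝ] ℂ) (a b : ℂ) :
    ((starRingEnd ℂ) (L a) * L b).im =
      ((starRingEnd ℂ) (L 1) * L Complex.I).im * ((starRingEnd ℂ) a * b).im := by
  have h : ∀ z : ℂ, z = z.re • (1 : ℂ) + z.im • Complex.I := fun z => by
    apply Complex.ext <;> simp
  have h' : ∀ z : ℂ, L z = z.re • L 1 + z.im • L Complex.I := fun z => by
    conv_lhs => rw [h z, map_add, map_smul, map_smul]
  rw [h' a, h' b]
  simp
  ring

lemma injective_of_area {L : ℂ →L[ℝ] ℂ} (h : ((starRingEnd ℂ) (L 1) * L Complex.I).im ≠ 0) :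
    Function.Injective L := by
  rw [injective_iff_map_eq_zero]
  intro a ha
  have h1 := area_comp_linear L a (Complex.I * a)
  rw [ha, map_zero, zero_mul, Complex.zero_im, zero_eq_mul] at h1
  have h2 := h1.resolve_left h
  rw [mul_left_comm, mul_comm ((starRingEnd ℂ) a), Complex.mul_conj] at h2
  simpa using h2

variable {σ : DiffForm 𝓘(ℝ, ℂ) ℂ 2} {f : ℝ → ℝ}

/-- A radial symplectic form `d(f dθ)` on the plane with `f'' ≥ 0` is isomorphic to twice the
standard one. -/
theorem exists_area_normalization (hσ : IsSymplecticForm 𝓘(ℝ, ℂ) σ) (hf : ContDiffOn ℝ ∞ f (Ici 0))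
    (hf2 : ∀ r : ℝ, 0 < r → 0 ≤ iteratedDeriv 2 f r)
    (hσf : ∀ z : ℂ, z ≠ 0 → σ z = dRadialTheta f z) :
    ∃ S : ℂ → ℂ, ContDiff ℝ ∞ S ∧ Function.Injective S ∧ S 0 = 0 ∧ ∀ z a b,
      (show ℂ [⋀^Fin 2]→L[ℝ] ℝ from σ (S z)) ![fderiv ℝ S z a, fderiv ℝ S z b] =
        2 * ((starRingEnd ℂ) a * b).im := by
  have hpos := planeDensity_pos hσ hf hf2 hσf
  have hs := hσ.contDiff_planeDensity
  -- The factor `ℝ` is a dummy base for `radialMean`; only its point `0` matters.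
  let ρ : ℝ × ℂ → ℝ := fun q => planeDensity σ q.2
  have hρ : ContDiff ℝ ∞ ρ := hs.comp contDiff_snd
  have hm := contDiff_radialMean hρ
  let k : ℂ → ℝ := fun z => radialMean ρ (0, z)
  have hj : ∀ z, HasFDerivAt (fun z : ℂ => ((0 : ℝ), z)) (ContinuousLinearMap.inr ℝ ℝ ℂ) z :=
    fun z => (ContinuousLinearMap.inr ℝ ℝ ℂ).hasFDerivAt
  have hk : ContDiff ℝ ∞ k := hm.comp (contDiff_const.prodMk contDiff_id)
  have hray : ∀ z : ℂ, Continuous fun t : ℝ => ρ ((0 : ℝ), t • z) := fun z =>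
    hρ.continuous.comp (by fun_prop)
  have hk0 : ∀ z, 0 < k z := fun z => radialMean_pos (hray z) fun t => hpos _
  have hkd : ∀ z, 2 * k z + fderiv ℝ k z z = planeDensity σ z := fun z => by
    have hd := hm.differentiable (by simp) (0, z)
    have h1 := two_mul_radialMean_add (hray z) hd
    have h2 : HasFDerivAt k _ z := hd.hasFDerivAt.comp z (hj z)
    rw [h2.fderiv]
    exact h1
  -- `A` pulls twice the standard form back to `σ`, and `S` will be its inverse.
  let A : ℂ → ℂ := fun z => √(k z) • z
  have hA : ContDiff ℝ ∞ A := (hk.sqrt fun z => (hk0 z).ne').smul contDiff_id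
  have hAd : ∀ z, HasFDerivAt A (fderiv ℝ A z) z := fun z =>
    (hA.differentiable (by simp) z).hasFDerivAt
  have harea1 : ∀ z, 2 * ((starRingEnd ℂ) (fderiv ℝ A z 1) * fderiv ℝ A z Complex.I).im =
      planeDensity σ z := by
    intro z
    -- Away from the origin, contraction with `z` determines the determinant of `dA`. At the origin
    -- that vector vanishes, and there `dA` is multiplication by `√(k 0)`.
    rcases eq_or_ne z 0 with rfl | hz
    · have h1 : HasFDerivAt A _ 0 :=
        (((hk.differentiable (by simp) 0).hasFDerivAt).sqrt (hk0 0).ne').smul (hasFDerivAt_id 0)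
      have h2 := hkd 0
      rw [h1.fderiv, ← h2]
      simp
      rw [Real.mul_self_sqrt (hk0 0).le]
    · have h1 := area_sqrt_smul (hk0 z) (hk.differentiable (by simp) z)
        (ContinuousLinearMap.id ℝ ℂ) (X := z) rfl (Complex.I * z)
      have h2 := area_comp_linear (fderiv ℝ A z) z (Complex.I * z)
      have h3 : ((starRingEnd ℂ) z * (Complex.I * z)).im ≠ 0 := by
        rw [mul_left_comm, mul_comm ((starRingEnd ℂ) z), Complex.mul_conj]
        simpa using hz
      rw [hkd] at h1
      refine mul_right_cancel₀ h3 ?_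
      rw [mul_assoc, ← h2]
      exact h1
  have harea : ∀ z a b, 2 * ((starRingEnd ℂ) (fderiv ℝ A z a) * fderiv ℝ A z b).im =
      planeDensity σ z * ((starRingEnd ℂ) a * b).im := fun z a b => by
    rw [area_comp_linear, ← mul_assoc, harea1]
  have hinj : ∀ z, Function.Injective (fderiv ℝ A z) := fun z => injective_of_area fun h => by
    have := harea1 z
    rw [h, mul_zero] at this
    exact (hpos z).ne this
  let A' : ∀ z, ℂ ≃L[ℝ] ℂ := fun z =>
    (LinearEquiv.ofInjectiveEndo (fderiv ℝ A z : ℂ →ₗ[ℝ] ℂ) (hinj z)).toContinuousLinearEquiv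
  have hA' : ∀ z, (A' z : ℂ →L[ℝ] ℂ) = fderiv ℝ A z := fun z => by ext; rfl
  have hopen : IsOpenMap A := isOpenMap_of_hasStrictFDerivAt_equiv (f' := A') fun z => by
    rw [hA']
    exact (hA.contDiffAt.hasStrictFDerivAt (by simp))
  have hmono : ∀ w : ℂ, StrictMonoOn (fun t : ℝ => t ^ 2 * k (t • w)) (Ici 0) := fun w =>
    strictMonoOn_sq_mul_radialMean (hray w) fun t => hpos _
  have hA0 : ∀ z, A z = 0 ↔ z = 0 := fun z => by
    simp [A, (Real.sqrt_pos.2 (hk0 z)).ne']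
  have hAinj : Function.Injective A := injective_sqrt_smul hk0 hmono
  -- Along a unit ray `|A|²` has derivative `f' t ≥ f' 1 > 0` for `t ≥ 1`, hence is unbounded. This
  -- makes `A` onto.
  have hgrow : ∀ w : ℂ, ‖w‖ = 1 → Tendsto (fun t : ℝ => t ^ 2 * k (t • w)) atTop atTop := by
    intro w hw
    have hd : ∀ t, HasDerivAt (fun t : ℝ => t ^ 2 * k (t • w)) (t * planeDensity σ (t • w)) t :=
      fun t => hasDerivAt_sq_mul_radialMean (hray w) t
    have hd' : ∀ t : ℝ, 0 < t → t * planeDensity σ (t • w) = deriv f t := fun t ht => by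
      have h1 : ‖t • w‖ = t := by rw [norm_smul, hw, mul_one, Real.norm_of_nonneg ht.le]
      have h2 := norm_mul_planeDensity hf hσf (z := t • w) (by
        rw [← norm_ne_zero_iff, h1]; exact ht.ne')
      rwa [h1] at h2
    have hc : 0 < deriv f 1 := by
      rw [← hd' 1 one_pos]; simpa using hpos w
    have hlow : ∀ t : ℝ, 1 ≤ t → deriv f 1 * (t - 1) ≤ t ^ 2 * k (t • w) := by
      intro t ht
      have h1 := Convex.mul_sub_le_image_sub_of_le_deriv (convex_Ici (1 : ℝ))
        (f := fun t : ℝ => t ^ 2 * k (t • w))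
        (fun t _ => (hd t).continuousAt.continuousWithinAt)
        (fun t _ => (hd t).differentiableAt.differentiableWithinAt) (C := deriv f 1) (fun t ht => by
          rw [interior_Ici] at ht
          have ht0 : (0 : ℝ) < t := one_pos.trans ht
          rw [(hd t).deriv, hd' t ht0]
          exact monotoneOn_deriv hf hf2 (one_pos (α := ℝ)) ht0 (le_of_lt ht))
        1 (self_mem_Ici) t ht ht
      have h2 : 0 ≤ (1 : ℝ) ^ 2 * k ((1 : ℝ) • w) := by have := hk0 ((1 : ℝ) • w); positivity
      linarith
    refine tendsto_atTop_mono' atTop ?_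
      ((tendsto_atTop_add_const_right atTop (-1 : ℝ) tendsto_id).const_mul_atTop hc)
    filter_upwards [eventually_ge_atTop (1 : ℝ)] with t ht
    exact hlow t ht
  have hAsurj : Function.Surjective A := by
    intro y
    rcases eq_or_ne y 0 with rfl | hy
    · exact ⟨0, (hA0 0).2 rfl⟩
    have hy' := norm_pos_iff.2 hy
    let w : ℂ := ‖y‖⁻¹ • y
    have hw : ‖w‖ = 1 := norm_smul_inv_norm hy
    have hc : Continuous fun t : ℝ => t ^ 2 * k (t • w) := by
      have := hk.continuous
      fun_prop
    obtain ⟨b, hb, hb'⟩ := (((hgrow w hw).eventually_ge_atTop (‖y‖ ^ 2)).and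
      (eventually_ge_atTop 0)).exists
    obtain ⟨t, ht, hty⟩ := intermediate_value_Icc hb' hc.continuousOn
      (show ‖y‖ ^ 2 ∈ Icc _ _ from ⟨by simp, hb⟩)
    refine ⟨t • w, ?_⟩
    have hty' : t ^ 2 * k (t • w) = ‖y‖ ^ 2 := hty
    have h1 : √(k (t • w)) * t = ‖y‖ := by
      rw [← Real.sqrt_sq hy'.le, ← hty', mul_comm (t ^ 2), Real.sqrt_mul (hk0 _).le,
        Real.sqrt_sq ht.1]
    change √(k (t • w)) • t • w = y
    rw [smul_smul, h1, smul_inv_smul₀ hy'.ne']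
  let e : ℂ ≃ₜ ℂ := (Equiv.ofBijective A ⟨hAinj, hAsurj⟩).toHomeomorphOfContinuousOpen
    hA.continuous hopen
  have hAe : ∀ z, A (e.symm z) = z := e.apply_symm_apply
  have hS : ContDiff ℝ ∞ e.symm := e.contDiff_symm (f₀' := A') (fun z => by
    rw [hA']; exact hAd z) hA
  refine ⟨e.symm, hS, e.symm.injective, ?_, fun z a b => ?_⟩
  · rw [e.symm_apply_eq]
    exact ((hA0 0).2 rfl).symm
  · have hinv : ∀ a, fderiv ℝ A (e.symm z) (fderiv ℝ e.symm z a) = a := by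
      intro a
      have h1 := (hAd (e.symm z)).comp z (hS.differentiable (by simp) z).hasFDerivAt
      have h2 : A ∘ e.symm = id := funext hAe
      rw [h2] at h1
      exact congrArg (fun L : ℂ →L[ℝ] ℂ => L a) (h1.unique (hasFDerivAt_id z))
    rw [planeDensity_apply, ← harea, hinv, hinv]

end AreaNormalization

/-! ### Smooth embeddings from bijective differentials -/

section Embedding

variable {E : Type*} [NormedAddCommGroup E] [NormedSpace ℝ E] [FiniteDimensional ℝ E]
  {M : Type*} [TopologicalSpace M] [ChartedSpace E M] [IsManifold 𝓘(ℝ, E) ∞ M]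
  {B : Type*} [NormedAddCommGroup B] [NormedSpace ℝ B]
  {G : Type*} [TopologicalSpace G] {J : ModelWithCorners ℝ B G} [J.Boundaryless]
  {N : Type*} [TopologicalSpace N] [ChartedSpace G N] [IsManifold J ∞ N]
  {φ : M → N}

/-- The linear equivalence underlying a bijective continuous linear map. -/
lemma ContinuousLinearMap.exists_equiv_of_bijective (L : E →L[ℝ] B) (hL : Function.Bijective L) :
    ∃ e : E ≃L[ℝ] B, (e : E →L[ℝ] B) = L := by
  have : FiniteDimensional ℝ B := (LinearEquiv.ofBijective (L : E →ₗ[ℝ] B) hL).finiteDimensional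
  exact ⟨(LinearEquiv.ofBijective (L : E →ₗ[ℝ] B) hL).toContinuousLinearEquiv, by ext; rfl⟩

/-- The inverse function theorem in charts. -/
lemma ContMDiffAt.exists_written_equiv {m : M} (hφ : ContMDiffAt 𝓘(ℝ, E) J ∞ φ m)
    (hb : Function.Bijective (mfderiv 𝓘(ℝ, E) J φ m)) :
    ∃ e : E ≃L[ℝ] B, ContDiffAt ℝ ∞ (writtenInExtChartAt 𝓘(ℝ, E) J m φ) (extChartAt 𝓘(ℝ, E) m m) ∧
      HasFDerivAt (writtenInExtChartAt 𝓘(ℝ, E) J m φ) (e : E →L[ℝ] B) (extChartAt 𝓘(ℝ, E) m m) := by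
  have h1 : ContDiffAt ℝ ∞ (writtenInExtChartAt 𝓘(ℝ, E) J m φ) (extChartAt 𝓘(ℝ, E) m m) := by
    have := (contMDiffAt_iff.1 hφ).2
    simp only [modelWithCornersSelf_coe, range_id, contDiffWithinAt_univ] at this
    exact this
  have h2 : mfderiv 𝓘(ℝ, E) J φ m =
      fderiv ℝ (writtenInExtChartAt 𝓘(ℝ, E) J m φ) (extChartAt 𝓘(ℝ, E) m m) := by
    rw [(hφ.mdifferentiableAt (by simp)).mfderiv]
    simp only [modelWithCornersSelf_coe, range_id, fderivWithin_univ]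
    rfl
  have hb' : Function.Bijective
      (fderiv ℝ (writtenInExtChartAt 𝓘(ℝ, E) J m φ) (extChartAt 𝓘(ℝ, E) m m)) := by
    rw [← h2]; exact hb
  obtain ⟨e, he⟩ := ContinuousLinearMap.exists_equiv_of_bijective _ hb'
  exact ⟨e, h1, by rw [he]; exact (h1.differentiableAt (by simp)).hasFDerivAt⟩

/-- The inverse function theorem gives this for the expression of `φ` in charts, and the charts
carry neighbourhood filters to neighbourhood filters. It yields openness of `φ`. -/
lemma ContMDiffAt.map_nhds_of_bijective_mfderiv {m : M} (hφ : ContMDiffAt 𝓘(ℝ, E) J ∞ φ m)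
    (hb : Function.Bijective (mfderiv 𝓘(ℝ, E) J φ m)) : 𝓝 (φ m) ≤ map φ (𝓝 m) := by
  obtain ⟨e, h1, h2⟩ := hφ.exists_written_equiv hb
  have : FiniteDimensional ℝ B := e.toLinearEquiv.finiteDimensional
  have h3 : HasStrictFDerivAt (writtenInExtChartAt 𝓘(ℝ, E) J m φ) (e : E →L[ℝ] B)
      (extChartAt 𝓘(ℝ, E) m m) := h1.hasStrictFDerivAt' h2 (by simp)
  have h4 := h3.map_nhds_eq_of_equiv
  have h5 : map (extChartAt J (φ m)).symm (𝓝 (extChartAt J (φ m) (φ m))) = 𝓝 (φ m) := by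
    have := map_extChartAt_symm_nhdsWithin_range (I := J) (φ m)
    rwa [J.range_eq_univ, nhdsWithin_univ] at this
  have h6 : writtenInExtChartAt 𝓘(ℝ, E) J m φ (extChartAt 𝓘(ℝ, E) m m) =
      extChartAt J (φ m) (φ m) := by
    simp only [writtenInExtChartAt, Function.comp_apply, extChartAt_to_inv]
  rw [h6] at h4
  rw [← h5, ← h4, ← map_extChartAt_nhds_of_boundaryless (I := 𝓘(ℝ, E)) m, map_map, map_map]
  refine le_of_eq (map_congr ?_)
  have h7 : ∀ᶠ x in 𝓝 m, φ x ∈ (extChartAt J (φ m)).source :=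
    hφ.continuousAt.eventually (extChartAt_source_mem_nhds (φ m))
  filter_upwards [extChartAt_source_mem_nhds (I := 𝓘(ℝ, E)) m, h7] with x hx hx'
  simp only [writtenInExtChartAt, Function.comp_apply]
  rw [(extChartAt 𝓘(ℝ, E) m).left_inv hx, (extChartAt J (φ m)).left_inv hx']

lemma OpenPartialHomeomorph.contMDiffAt_symm_of_bijective_mfderiv
    (e : OpenPartialHomeomorph M E) {m : M} (hm : m ∈ e.source)
    (he : ContMDiffAt 𝓘(ℝ, E) 𝓘(ℝ, E) ∞ e m)
    (hb : Function.Bijective (mfderiv 𝓘(ℝ, E) 𝓘(ℝ, E) e m)) :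
    ContMDiffAt 𝓘(ℝ, E) 𝓘(ℝ, E) ∞ e.symm (e m) := by
  obtain ⟨L, h1, h2⟩ := he.exists_written_equiv hb
  let c := chartAt E m
  let θ : OpenPartialHomeomorph E E := c.symm.trans e
  have hmc : m ∈ c.source := mem_chart_source E m
  have hθ : (writtenInExtChartAt 𝓘(ℝ, E) 𝓘(ℝ, E) m e) = θ := by
    simp only [writtenInExtChartAt, extChartAt_model_space_eq_id]
    rfl
  rw [hθ] at h1 h2
  have hcm : extChartAt 𝓘(ℝ, E) m m = c m := rfl
  rw [hcm] at h1 h2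
  have hsm : θ.symm (e m) = c m := by
    change c (e.symm (e m)) = c m
    rw [e.left_inv hm]
  have ht : e m ∈ θ.target := by
    have h3 : c m ∈ θ.source := by
      simp only [θ, OpenPartialHomeomorph.trans_source, mem_inter_iff, mem_preimage,
        OpenPartialHomeomorph.symm_source]
      exact ⟨c.map_source hmc, by rwa [c.left_inv hmc]⟩
    have := θ.map_source h3
    have h4 : θ (c m) = e m := by
      change e (c.symm (c m)) = e m
      rw [c.left_inv hmc]
    rwa [h4] at this
  have h5 : ContDiffAt ℝ ∞ θ.symm (e m) :=
    θ.contDiffAt_symm (f₀' := L) ht (by rwa [hsm]) (by rwa [hsm])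
  have h6 : ContMDiffAt 𝓘(ℝ, E) 𝓘(ℝ, E) ∞ (c.symm ∘ θ.symm) (e m) := by
    refine ContMDiffAt.comp (e m) (g := c.symm) ?_ h5.contMDiffAt
    rw [hsm]
    exact contMDiffAt_symm_of_mem_maximalAtlas (IsManifold.chart_mem_maximalAtlas m)
      (c.map_source hmc)
  refine h6.congr_of_eventuallyEq ?_
  have h7 : ∀ᶠ y in 𝓝 (e m), e.symm y ∈ c.source := by
    refine (e.continuousAt_symm (e.map_source hm)).eventually ?_
    rw [e.left_inv hm]
    exact c.open_source.mem_nhds hmc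
  filter_upwards [h7] with y hy
  change _ = c.symm (c (e.symm y))
  rw [c.left_inv hy]

/-- A boundaryless model with corners as a homeomorphism. -/
noncomputable def ModelWithCorners.homeomorph (J : ModelWithCorners ℝ B G) [J.Boundaryless] :
    G ≃ₜ B where
  toFun := J
  invFun := J.symm
  left_inv := J.left_inv
  right_inv := fun x => J.right_inv (by rw [J.range_eq_univ]; trivial)
  continuous_toFun := J.continuous
  continuous_invFun := J.continuous_symm

/-- An injective smooth map with bijective differentials is a smooth embedding. -/
theorem isSmoothEmbedding_of_bijective_mfderiv (hφ : ContMDiff 𝓘(ℝ, E) J ∞ φ)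
    (hinj : Function.Injective φ) (hb : ∀ m, Function.Bijective (mfderiv 𝓘(ℝ, E) J φ m)) :
    Manifold.IsSmoothEmbedding 𝓘(ℝ, E) J ∞ φ := by
  have hopen : IsOpenMap φ :=
    isOpenMap_iff_nhds_le.2 fun m => (hφ m).map_nhds_of_bijective_mfderiv (hb m)
  have hemb : IsOpenEmbedding φ := .of_continuous_injective_isOpenMap hφ.continuous hinj hopen
  refine ⟨?_, hemb.isEmbedding⟩
  refine Manifold.IsImmersionOfComplement.isImmersion (F := PUnit) fun m => ?_
  have : Nonempty M := ⟨m⟩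
  obtain ⟨L, -, -⟩ := (hφ m).exists_written_equiv (hb m)
  let ψ := chartAt G (φ m)
  -- In this chart `φ` reads as the linear equivalence `L`, which exhibits an immersion with trivial
  -- complement.
  let e : OpenPartialHomeomorph M E := (((hemb.toOpenPartialHomeomorph φ).trans ψ).trans
    J.homeomorph.toOpenPartialHomeomorph).trans L.symm.toHomeomorph.toOpenPartialHomeomorph
  have hes : e.source = φ ⁻¹' ψ.source := by
    simp [e]
  have hev : ∀ x, e x = L.symm (extChartAt J (φ m) (φ x)) := fun x => rfl
  have hed : ∀ x ∈ e.source, ContMDiffAt 𝓘(ℝ, E) 𝓘(ℝ, E) ∞ e x := by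
    intro x hx
    rw [hes] at hx
    exact (L.symm.contDiff.contMDiff.contMDiffAt).comp x
      ((contMDiffAt_extChartAt' hx).comp x (hφ x))
  have heb : ∀ x ∈ e.source, Function.Bijective (mfderiv 𝓘(ℝ, E) 𝓘(ℝ, E) e x) := by
    intro x hx
    rw [hes] at hx
    have hx' : φ x ∈ (extChartAt J (φ m)).source := by rwa [extChartAt_source]
    obtain ⟨T, hT⟩ := isInvertible_mfderiv_extChartAt hx'
    have hT' : HasMFDerivAt J 𝓘(ℝ, B) (extChartAt J (φ m)) (φ x) (T : _ →L[ℝ] _) := by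
      rw [hT]
      exact ((contMDiffAt_extChartAt' (n := ∞) hx).mdifferentiableAt (by simp)).hasMFDerivAt
    have h1 := hT'.comp x ((hφ x).mdifferentiableAt (by simp)).hasMFDerivAt
    have h2 := HasMFDerivAt.comp x (L.symm.hasFDerivAt.hasMFDerivAt
      (x := extChartAt J (φ m) (φ x))) h1
    have h3 : mfderiv 𝓘(ℝ, E) 𝓘(ℝ, E) e x = _ := h2.mfderiv
    rw [h3]
    exact L.symm.bijective.comp (T.bijective.comp (hb x))
  have heat : e ∈ IsManifold.maximalAtlas 𝓘(ℝ, E) ∞ M := by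
    refine e.mem_maximalAtlas_of_contMDiffOn (fun x hx => (hed x hx).contMDiffWithinAt)
      fun y hy => ?_
    have hx := e.map_target hy
    have := e.contMDiffAt_symm_of_bijective_mfderiv hx (hed _ hx) (heb _ hx)
    rw [e.right_inv hy] at this
    exact this.contMDiffWithinAt
  refine Manifold.IsImmersionAtOfComplement.mk_of_charts
    ((ContinuousLinearEquiv.prodUnique ℝ E PUnit).trans L) e ψ ?_ (mem_chart_source G (φ m)) heat
    (IsManifold.chart_mem_maximalAtlas _) (by rw [hes]) ?_
  · rw [hes]
    exact mem_chart_source G (φ m)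
  · intro y hy
    have hy' : y ∈ e.target := by simpa using hy
    have h1 := e.right_inv hy'
    rw [hev, L.symm_apply_eq] at h1
    exact h1

end Embedding

/-! ### Comparison of the two forms in the radial trivialization -/

section LocalIdentity

lemma DiffForm.pullbackModel_apply_two
    {E : Type*} [NormedAddCommGroup E] [NormedSpace ℝ E]
    {M : Type*} [TopologicalSpace M] [ChartedSpace E M]
    {P : Type*} [NormedAddCommGroup P] [NormedSpace ℝ P]
    (α : DiffForm 𝓘(ℝ, E) M 2) (G : P → M) (y : P) (v w : P) :
    DiffForm.pullbackModel α G y ![v, w] =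
      α (G y) ![mfderiv 𝓘(ℝ, P) 𝓘(ℝ, E) G y v, mfderiv 𝓘(ℝ, P) 𝓘(ℝ, E) G y w] :=
  DiffForm.pullback_apply_two (I := 𝓘(ℝ, P)) (I' := 𝓘(ℝ, E)) G α y v w

/-- Pulling a form back along a composition of a map with a map to a vector space. -/
lemma DiffForm.pullbackModel_comp_apply
    {E : Type*} [NormedAddCommGroup E] [NormedSpace ℝ E]
    {M : Type*} [TopologicalSpace M] [ChartedSpace E M]
    {P : Type*} [NormedAddCommGroup P] [NormedSpace ℝ P]
    {E' : Type*} [NormedAddCommGroup E'] [NormedSpace ℝ E']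
    {M' : Type*} [TopologicalSpace M'] [ChartedSpace E' M']
    (α : DiffForm 𝓘(ℝ, E) M 2) {G : P → M} {q : M' → P} {g : M' → M} {m : M'}
    (hG : MDifferentiableAt 𝓘(ℝ, P) 𝓘(ℝ, E) G (q m)) (hq : MDifferentiableAt 𝓘(ℝ, E') 𝓘(ℝ, P) q m)
    (hg : G ∘ q =ᶠ[𝓝 m] g) (v w : TangentSpace 𝓘(ℝ, E') m) :
    DiffForm.pullbackModel α G (q m) ![mfderiv 𝓘(ℝ, E') 𝓘(ℝ, P) q m v,
      mfderiv 𝓘(ℝ, E') 𝓘(ℝ, P) q m w] =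
      α (g m) ![mfderiv 𝓘(ℝ, E') 𝓘(ℝ, E) g m v, mfderiv 𝓘(ℝ, E') 𝓘(ℝ, E) g m w] := by
  refine (DiffForm.pullbackModel_apply_two α G (q m) _ _).trans ?_
  have h1 := (hG.hasMFDerivAt.comp m hq.hasMFDerivAt).congr_of_eventuallyEq hg.symm
  have h2 : ∀ v : TangentSpace 𝓘(ℝ, E') m, (mfderiv 𝓘(ℝ, E') 𝓘(ℝ, E) g m v : E) =
      mfderiv 𝓘(ℝ, P) 𝓘(ℝ, E) G (q m) (mfderiv 𝓘(ℝ, E') 𝓘(ℝ, P) q m v) := fun v =>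
    congrArg (fun T : E' →L[ℝ] E => T v) h1.mfderiv
  have h3 : G (q m) = g m := hg.self_of_nhds
  have h4 : ∀ (x y : M) (hxy : x = y) (a b : E),
      (show E [⋀^Fin 2]→L[ℝ] ℝ from α x) ![a, b] = (show E [⋀^Fin 2]→L[ℝ] ℝ from α y) ![a, b] := by
    rintro x _ rfl a b
    rfl
  refine (h4 _ _ h3 _ _).trans ?_
  rw [← h2 v, ← h2 w]
  rfl

variable {E : Type*} [NormedAddCommGroup E] [NormedSpace ℝ E] [FiniteDimensional ℝ E]
  {M : Type*} [TopologicalSpace M] [ChartedSpace E M] [IsManifold 𝓘(ℝ, E) ∞ M]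
  {E₀ : Type*} [NormedAddCommGroup E₀] [NormedSpace ℝ E₀] [FiniteDimensional ℝ E₀]
  {F : Type*} [TopologicalSpace F] [ChartedSpace E₀ F] [IsManifold 𝓘(ℝ, E₀) ∞ F]
  {Ω : DiffForm 𝓘(ℝ, E) M 2} {p : M → ℂ} {ι : F → M} {σ : DiffForm 𝓘(ℝ, ℂ) ℂ 2}
  {V : ∀ x : M, ℂ →L[ℝ] TangentSpace 𝓘(ℝ, E) x} {r : M → ℝ} {Φ : F × ℂ → M} {S : ℂ → ℂ}

/-- The difference of the two sides is closed, so `closed_form_eq_zero_of_radial` reduces the claim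
to the core and to contraction with `(0, z)`. On the core `Φ` is `ι` and the map inside `S` is zero.
Radially the `F`-term vanishes, `hΩV` gives `r Im (z̄ w₂)`, and the `σ`-term gives `ε² r Im (z̄
w₂)`. The sign `ε` keeps the mean under the root positive, and `T` compensates with determinant `ε`.
-/
theorem radial_trivialization_pullback_eq (hΩs : DiffForm.IsSmooth 𝓘(ℝ, E) Ω)
    (hΩc : DiffForm.IsClosedForm 𝓘(ℝ, E) Ω)
    (hFs : DiffForm.IsSmooth 𝓘(ℝ, E₀) (DiffForm.pullback 𝓘(ℝ, E₀) 𝓘(ℝ, E) ι Ω))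
    (hFc : DiffForm.IsClosedForm 𝓘(ℝ, E₀) (DiffForm.pullback 𝓘(ℝ, E₀) 𝓘(ℝ, E) ι Ω))
    (hσs : DiffForm.IsSmooth 𝓘(ℝ, ℂ) σ) (hσc : DiffForm.IsClosedForm 𝓘(ℝ, ℂ) σ)
    (hp : ContMDiff 𝓘(ℝ, E) 𝓘(ℝ, ℂ) ∞ p) (hι : ContMDiff 𝓘(ℝ, E₀) 𝓘(ℝ, E) ∞ ι)
    (hr : ContMDiff 𝓘(ℝ, E) 𝓘(ℝ, ℝ) ∞ r)
    (hΩV : ∀ x z w, Ω x ![V x z, w] =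
        r x * ((starRingEnd ℂ) z * (show ℂ from mfderiv 𝓘(ℝ, E) 𝓘(ℝ, ℂ) p x w)).im)
    (hΦ : ContMDiff (𝓘(ℝ, E₀).prod 𝓘(ℝ, ℂ)) 𝓘(ℝ, E) ∞ Φ) (hpΦ : ∀ q, p (Φ q) = q.2)
    (hΦ0 : ∀ x, Φ (x, 0) = ι x)
    (hΦV : ∀ x z, IsMIntegralCurve (I := 𝓘(ℝ, E)) (fun t : ℝ => Φ (x, t • z)) fun x => V x z)
    (hS : ContDiff ℝ ∞ S)
    (hSσ : ∀ z a b, (show ℂ [⋀^Fin 2]→L[ℝ] ℝ from σ (S z)) ![fderiv ℝ S z a, fderiv ℝ S z b] =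
        2 * ((starRingEnd ℂ) a * b).im)
    {U : Set E₀} (hU : IsOpen U) {j : E₀ → F} (hj : ContMDiffOn 𝓘(ℝ, E₀) 𝓘(ℝ, E₀) ∞ j U)
    {ε : ℝ} (hε : ε * ε = 1) {T : ℂ →L[ℝ] ℂ}
    (hT : ∀ a b, ((starRingEnd ℂ) (T a) * T b).im = ε * ((starRingEnd ℂ) a * b).im)
    (hsign : ∀ u ∈ U, ∀ z, 0 < ε * r (Φ (j u, z))) {u : E₀} (hu : u ∈ U) (z : ℂ) (w w' : E₀ × ℂ) :
    DiffForm.pullbackModel Ω (fun q : E₀ × ℂ => Φ (j q.1, q.2)) (u, z) ![w, w'] =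
      DiffForm.pullbackModel (DiffForm.pullback 𝓘(ℝ, E₀) 𝓘(ℝ, E) ι Ω) (fun q : E₀ × ℂ => j q.1)
        (u, z) ![w, w'] +
      DiffForm.pullbackModel σ (fun q : E₀ × ℂ =>
        S (√(radialMean (fun q : E₀ × ℂ => ε * r (Φ (j q.1, q.2))) q) • T q.2)) (u, z) ![w, w'] := by
  set ρ : E₀ × ℂ → ℝ := fun q => ε * r (Φ (j q.1, q.2)) with hρdef
  set αF := DiffForm.pullback 𝓘(ℝ, E₀) 𝓘(ℝ, E) ι Ω with hαF
  have hopen : IsOpen (U ×ˢ (univ : Set ℂ)) := hU.prod isOpen_univ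
  let T' : E₀ × ℂ →L[ℝ] ℂ := T.comp (ContinuousLinearMap.snd ℝ E₀ ℂ)
  let G₁ : E₀ × ℂ → M := fun q => Φ (j q.1, q.2)
  let G₂ : E₀ × ℂ → F := fun q => j q.1
  let C : E₀ × ℂ → ℂ := fun q => √(radialMean ρ q) • T' q
  let G₃ : E₀ × ℂ → ℂ := fun q => S (C q)
  have hjat : ∀ u ∈ U, ContMDiffAt 𝓘(ℝ, E₀) 𝓘(ℝ, E₀) ∞ j u := fun u hu =>
    (hj u hu).contMDiffAt (hU.mem_nhds hu)
  have h2 : ∀ q ∈ U ×ˢ (univ : Set ℂ), ContMDiffAt 𝓘(ℝ, E₀ × ℂ) 𝓘(ℝ, E₀) ∞ G₂ q := fun q hq =>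
    (hjat q.1 hq.1).comp q contDiff_fst.contMDiff.contMDiffAt
  have h1 : ∀ q ∈ U ×ˢ (univ : Set ℂ), ContMDiffAt 𝓘(ℝ, E₀ × ℂ) 𝓘(ℝ, E) ∞ G₁ q := fun q hq =>
    (hΦ _).comp q ((h2 q hq).prodMk contDiff_snd.contMDiff.contMDiffAt)
  have hρs : ContDiffOn ℝ ∞ ρ (U ×ˢ univ) := by
    rw [← contMDiffOn_iff_contDiffOn]
    exact fun q hq => (contMDiffAt_const.mul ((hr _).comp q (h1 q hq))).contMDiffWithinAt
  have hm : ContDiffOn ℝ ∞ (radialMean ρ) (U ×ˢ univ) := contDiffOn_radialMean hU hρs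
  have hray : ∀ u ∈ U, ∀ z : ℂ, Continuous fun t : ℝ => ρ (u, t • z) := fun u hu z =>
    hρs.continuousOn.comp_continuous (by fun_prop) fun t => ⟨hu, mem_univ _⟩
  have hpos : ∀ q ∈ U ×ˢ (univ : Set ℂ), 0 < radialMean ρ q := fun q hq =>
    radialMean_pos (hray q.1 hq.1 q.2) fun t => hsign _ hq.1 _
  have hmat : ∀ q ∈ U ×ˢ (univ : Set ℂ), ContDiffAt ℝ ∞ (radialMean ρ) q := fun q hq =>
    hm.contDiffAt (hopen.mem_nhds hq)
  have hC : ∀ q ∈ U ×ˢ (univ : Set ℂ), ContDiffAt ℝ ∞ C q := fun q hq =>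
    ((hmat q hq).sqrt (hpos q hq).ne').smul T'.contDiff.contDiffAt
  have h3 : ∀ q ∈ U ×ˢ (univ : Set ℂ), ContMDiffAt 𝓘(ℝ, E₀ × ℂ) 𝓘(ℝ, ℂ) ∞ G₃ q := fun q hq =>
    (hS.contDiffAt.comp q (hC q hq)).contMDiffAt
  let β₁ := DiffForm.pullbackModel Ω G₁
  let β₂ := DiffForm.pullbackModel αF G₂
  let β₃ := DiffForm.pullbackModel σ G₃
  have hd₁ : ∀ q ∈ U ×ˢ (univ : Set ℂ), DifferentiableAt ℝ β₁ q := fun q hq =>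
    hΩs.differentiableAt_pullbackModel (h1 q hq)
  have hd₂ : ∀ q ∈ U ×ˢ (univ : Set ℂ), DifferentiableAt ℝ β₂ q := fun q hq =>
    hFs.differentiableAt_pullbackModel (h2 q hq)
  have hd₃ : ∀ q ∈ U ×ˢ (univ : Set ℂ), DifferentiableAt ℝ β₃ q := fun q hq =>
    hσs.differentiableAt_pullbackModel (h3 q hq)
  have hG₁d : ∀ q ∈ U ×ˢ (univ : Set ℂ), MDifferentiableAt 𝓘(ℝ, E₀ × ℂ) 𝓘(ℝ, E) G₁ q := fun q hq =>
    (h1 q hq).mdifferentiableAt (by simp)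
  have hG₂d : ∀ q ∈ U ×ˢ (univ : Set ℂ), MDifferentiableAt 𝓘(ℝ, E₀ × ℂ) 𝓘(ℝ, E₀) G₂ q :=
    fun q hq => (h2 q hq).mdifferentiableAt (by simp)
  have hjd : ∀ u ∈ U, MDifferentiableAt 𝓘(ℝ, E₀) 𝓘(ℝ, E₀) j u := fun u hu =>
    (hjat u hu).mdifferentiableAt (by simp)
  -- the differentials of the three maps
  have hG₁V : ∀ u ∈ U, ∀ z : ℂ, (mfderiv 𝓘(ℝ, E₀ × ℂ) 𝓘(ℝ, E) G₁ (u, z) (0, z) : E) =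
      V (Φ (j u, z)) z := by
    intro u hu z
    have e1 : HasDerivAt (fun t : ℝ => (u, t • z)) (0, z) 1 :=
      (hasDerivAt_const 1 u).prodMk
        (((hasDerivAt_id (1 : ℝ)).smul_const z).congr_deriv (one_smul ℝ z))
    have e2 := HasMFDerivAt.comp (f := fun t : ℝ => (u, t • z)) 1
      (hG₁d (u, (1 : ℝ) • z) ⟨hu, mem_univ _⟩).hasMFDerivAt e1.hasFDerivAt.hasMFDerivAt
    have e3 := congrArg (fun L : ℝ →L[ℝ] E => L 1) (hasMFDerivAt_unique e2 (hΦV (j u) z 1))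
    have e4 : ∀ z', z' = (1 : ℝ) • z →
        (mfderiv 𝓘(ℝ, E₀ × ℂ) 𝓘(ℝ, E) G₁ (u, z') ((1 : ℝ) • ((0 : E₀), z)) : E) =
          (1 : ℝ) • (show E from V (Φ (j u, z')) z) := by
      rintro _ rfl
      exact e3
    exact (congrArg (fun v : E₀ × ℂ => (mfderiv 𝓘(ℝ, E₀ × ℂ) 𝓘(ℝ, E) G₁ (u, z) v : E))
      (one_smul ℝ _).symm).trans ((e4 z (one_smul ℝ z).symm).trans (one_smul ℝ (_ : E)))
  have hpG₁ : ∀ q ∈ U ×ˢ (univ : Set ℂ), ∀ w : E₀ × ℂ, (mfderiv 𝓘(ℝ, E) 𝓘(ℝ, ℂ) p (G₁ q)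
      (mfderiv 𝓘(ℝ, E₀ × ℂ) 𝓘(ℝ, E) G₁ q w) : ℂ) = w.2 := by
    intro q hq w
    have e1 := HasMFDerivAt.comp q (hp.mdifferentiable (by simp) (G₁ q)).hasMFDerivAt
      (hG₁d q hq).hasMFDerivAt
    have e2 : p ∘ G₁ = Prod.snd := funext fun q => hpΦ _
    rw [e2] at e1
    exact congrArg (fun L : E₀ × ℂ →L[ℝ] ℂ => L w)
      (hasMFDerivAt_unique e1 (hasFDerivAt_snd (𝕜 := ℝ)).hasMFDerivAt)
  have hG₂w : ∀ q ∈ U ×ˢ (univ : Set ℂ), ∀ w : E₀ × ℂ,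
      (mfderiv 𝓘(ℝ, E₀ × ℂ) 𝓘(ℝ, E₀) G₂ q w : E₀) = mfderiv 𝓘(ℝ, E₀) 𝓘(ℝ, E₀) j q.1 w.1 := by
    intro q hq w
    have e1 := HasMFDerivAt.comp q (hjd q.1 hq.1).hasMFDerivAt
      (hasFDerivAt_fst (𝕜 := ℝ) (p := q)).hasMFDerivAt
    exact congrArg (fun L : E₀ × ℂ →L[ℝ] E₀ => L w)
      (hasMFDerivAt_unique (hG₂d q hq).hasMFDerivAt e1)
  have hG₁0 : ∀ u ∈ U, ∀ a : E₀, (mfderiv 𝓘(ℝ, E₀ × ℂ) 𝓘(ℝ, E) G₁ (u, 0) (a, 0) : E) =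
      mfderiv 𝓘(ℝ, E₀) 𝓘(ℝ, E) ι (j u) (mfderiv 𝓘(ℝ, E₀) 𝓘(ℝ, E₀) j u a) := by
    intro u hu a
    have e1 : HasFDerivAt (fun u : E₀ => (u, (0 : ℂ))) (ContinuousLinearMap.inl ℝ E₀ ℂ) u :=
      (ContinuousLinearMap.inl ℝ E₀ ℂ).hasFDerivAt
    have e2 := HasMFDerivAt.comp (f := fun u : E₀ => (u, (0 : ℂ))) u
      (hG₁d (u, 0) ⟨hu, mem_univ _⟩).hasMFDerivAt e1.hasMFDerivAt
    have e3 := HasMFDerivAt.comp u (hι.mdifferentiable (by simp) (j u)).hasMFDerivAt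
      (hjd u hu).hasMFDerivAt
    have e4 : G₁ ∘ (fun u : E₀ => (u, (0 : ℂ))) = ι ∘ j := funext fun u => hΦ0 _
    rw [e4] at e2
    exact congrArg (fun L : E₀ →L[ℝ] E => L a) (hasMFDerivAt_unique e2 e3)
  -- As `S` carries twice the standard form to `σ`, only `C` enters the third term.
  have hβ₃ : ∀ q ∈ U ×ˢ (univ : Set ℂ), ∀ w w' : E₀ × ℂ, β₃ q ![w, w'] =
      2 * ((starRingEnd ℂ) (fderiv ℝ C q w) * fderiv ℝ C q w').im := by
    intro q hq w w'
    have e1 : HasFDerivAt G₃ ((fderiv ℝ S (C q)).comp (fderiv ℝ C q)) q :=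
      (hS.differentiable (by simp) _).hasFDerivAt.comp q
        ((hC q hq).differentiableAt (by simp)).hasFDerivAt
    have e2 : ∀ w, (mfderiv 𝓘(ℝ, E₀ × ℂ) 𝓘(ℝ, ℂ) G₃ q w : ℂ) =
        fderiv ℝ S (C q) (fderiv ℝ C q w) := fun w =>
      congrArg (fun L : E₀ × ℂ →L[ℝ] ℂ => L w) e1.hasMFDerivAt.mfderiv
    refine (DiffForm.pullbackModel_apply_two σ G₃ q w w').trans ?_
    refine Eq.trans ?_ (hSσ (C q) _ _)
    exact congrArg₂ (fun a b : ℂ => formFlat (E := ℂ) (σ (G₃ q)) a b) (e2 w) (e2 w')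
  have key := closed_form_eq_zero_of_radial hU (β := β₁ + (-1 : ℝ) • (β₂ + β₃))
    (fun q hq => (hd₁ q hq).add (((hd₂ q hq).add (hd₃ q hq)).const_smul _)) (fun q hq => by
      rw [extDeriv_add (hd₁ q hq) (((hd₂ q hq).add (hd₃ q hq)).const_smul _), extDeriv_smul,
        extDeriv_add (hd₂ q hq) (hd₃ q hq), hΩc.extDeriv_pullbackModel hΩs (h1 q hq),
        hFc.extDeriv_pullbackModel hFs (h2 q hq), hσc.extDeriv_pullbackModel hσs (h3 q hq)]
      simp) (fun u hu z w => by
      have hq : (u, z) ∈ U ×ˢ (univ : Set ℂ) := ⟨hu, mem_univ _⟩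
      have e1 : β₁ (u, z) ![(0, z), w] = r (Φ (j u, z)) * ((starRingEnd ℂ) z * w.2).im := by
        refine (DiffForm.pullbackModel_apply_two Ω G₁ (u, z) (0, z) w).trans ?_
        rw [← hpG₁ _ hq w, ← hΩV]
        exact congrArg (fun v : E => formFlat (E := E) (Ω (G₁ (u, z))) v
          (mfderiv 𝓘(ℝ, E₀ × ℂ) 𝓘(ℝ, E) G₁ (u, z) w)) (hG₁V u hu z)
      have e2 : β₂ (u, z) ![(0, z), w] = 0 := by
        refine (DiffForm.pullbackModel_apply_two αF G₂ (u, z) (0, z) w).trans ?_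
        have e0 : (mfderiv 𝓘(ℝ, E₀ × ℂ) 𝓘(ℝ, E₀) G₂ (u, z) (0, z) : E₀) = 0 :=
          (hG₂w _ hq (0, z)).trans (map_zero (mfderiv 𝓘(ℝ, E₀) 𝓘(ℝ, E₀) j u))
        refine (congrArg (fun v : E₀ => formFlat (E := E₀) (αF (G₂ (u, z))) v
          (mfderiv 𝓘(ℝ, E₀ × ℂ) 𝓘(ℝ, E₀) G₂ (u, z) w)) e0).trans ?_
        exact congrArg (fun L : E₀ →L[ℝ] ℝ => L (mfderiv 𝓘(ℝ, E₀ × ℂ) 𝓘(ℝ, E₀) G₂ (u, z) w))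
          (map_zero (formFlat (E := E₀) (αF (G₂ (u, z)))))
      have e3 : β₃ (u, z) ![(0, z), w] = r (Φ (j u, z)) * ((starRingEnd ℂ) z * w.2).im := by
        rw [hβ₃ _ hq]
        have h4 := area_sqrt_smul (hpos _ hq) ((hmat _ hq).differentiableAt (by simp)) T'
          (X := (0, z)) rfl w
        have h5 := two_mul_radialMean_add (hray u hu z) ((hmat _ hq).differentiableAt (by simp))
        rw [h5] at h4
        refine h4.trans ?_
        change ρ (u, z) * ((starRingEnd ℂ) (T z) * T w.2).im = _
        rw [hT, hρdef]
        linear_combination (r (Φ (j u, z)) * ((starRingEnd ℂ) z * w.2).im) * hε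
      change β₁ (u, z) ![(0, z), w] + (-1 : ℝ) • (β₂ (u, z) ![(0, z), w] + β₃ (u, z) ![(0, z), w]) = 0
      rw [e1, e2, e3]
      simp) (fun u hu a b => by
      have hq : (u, (0 : ℂ)) ∈ U ×ˢ (univ : Set ℂ) := ⟨hu, mem_univ _⟩
      have e1 : β₁ (u, 0) ![(a, 0), (b, 0)] = β₂ (u, 0) ![(a, 0), (b, 0)] := by
        refine (DiffForm.pullbackModel_apply_two Ω G₁ (u, 0) (a, 0) (b, 0)).trans
          (Eq.trans ?_ (DiffForm.pullbackModel_apply_two αF G₂ (u, 0) (a, 0) (b, 0)).symm)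
        refine Eq.trans ?_ (DiffForm.pullback_apply_two ι Ω (G₂ (u, 0)) _ _).symm
        have e0 : ∀ a : E₀, (mfderiv 𝓘(ℝ, E₀ × ℂ) 𝓘(ℝ, E) G₁ (u, 0) (a, 0) : E) =
            mfderiv 𝓘(ℝ, E₀) 𝓘(ℝ, E) ι (G₂ (u, 0))
              (mfderiv 𝓘(ℝ, E₀ × ℂ) 𝓘(ℝ, E₀) G₂ (u, 0) (a, 0)) := fun a =>
          (hG₁0 u hu a).trans (congrArg (fun v : E₀ =>
            (mfderiv 𝓘(ℝ, E₀) 𝓘(ℝ, E) ι (j u) v : E)) (hG₂w _ hq (a, 0)).symm)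
        have e5 : ∀ (x y : M) (hxy : x = y) (a b : E), formFlat (E := E) (Ω x) a b =
            formFlat (E := E) (Ω y) a b := by
          rintro x _ rfl a b
          rfl
        refine (e5 _ _ (hΦ0 (j u)) _ _).trans ?_
        rw [e0 a, e0 b]
        rfl
      have e3 : β₃ (u, 0) ![(a, 0), (b, 0)] = 0 := by
        rw [hβ₃ _ hq]
        have e0 : fderiv ℝ C (u, 0) (a, 0) = 0 := by
          have e4 := ((hC _ hq).differentiableAt (by simp)).hasFDerivAt.comp u
            ((ContinuousLinearMap.inl ℝ E₀ ℂ).hasFDerivAt (x := u))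
          have e5 : C ∘ (ContinuousLinearMap.inl ℝ E₀ ℂ) = fun _ => 0 := by
            funext u
            simp [C, T']
          rw [e5] at e4
          exact congrArg (fun L : E₀ →L[ℝ] ℂ => L a) (e4.unique (hasFDerivAt_const _ _))
        rw [e0]
        simp
      change β₁ (u, 0) ![(a, 0), (b, 0)] + (-1 : ℝ) • (β₂ (u, 0) ![(a, 0), (b, 0)] +
        β₃ (u, 0) ![(a, 0), (b, 0)]) = 0
      rw [e1, e3]
      simp) hu z w w'
  change β₁ (u, z) ![w, w'] + (-1 : ℝ) • (β₂ (u, z) ![w, w'] + β₃ (u, z) ![w, w']) = 0 at key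
  change β₁ (u, z) ![w, w'] = β₂ (u, z) ![w, w'] + β₃ (u, z) ![w, w']
  rw [smul_eq_mul] at key
  linarith

end LocalIdentity

/-! ### The fibrewise radial coordinate on `F × ℂ` -/

section RadialCoordinate

/-- A continuous function without zeros on a real vector space has constant sign. -/
lemma mul_pos_of_continuous_of_ne_zero {P : Type*} [NormedAddCommGroup P] [NormedSpace ℝ P]
    {g : P → ℝ} (hg : Continuous g) (h0 : ∀ z, g z ≠ 0) (z w : P) : 0 < g z * g w := by
  by_contra! h
  obtain ⟨y, hy⟩ := mem_range_of_exists_le_of_exists_ge (f := fun w => g z * g w)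
    (continuous_const.mul hg) ⟨w, h⟩ ⟨z, mul_self_nonneg (g z)⟩
  exact mul_ne_zero (h0 z) (h0 y) hy

open Classical in
/-- The identity of the plane if `c` is positive, and complex conjugation otherwise. -/
noncomputable def orientedPlane (c : ℝ) : ℂ →L[ℝ] ℂ :=
  if 0 < c then ContinuousLinearMap.id ℝ ℂ else Complex.conjCLE.toContinuousLinearMap

lemma norm_orientedPlane (c : ℝ) (z : ℂ) : ‖orientedPlane c z‖ = ‖z‖ := by
  unfold orientedPlane
  split_ifs <;> simp

open Classical in
lemma orientedPlane_area (c : ℝ) (a b : ℂ) :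
    ((starRingEnd ℂ) (orientedPlane c a) * orientedPlane c b).im =
      (if 0 < c then 1 else -1) * ((starRingEnd ℂ) a * b).im := by
  unfold orientedPlane
  split_ifs
  · simp
  · simp
    ring

lemma orientedPlane_eq {c d : ℝ} (h : 0 < c * d) : orientedPlane c = orientedPlane d := by
  unfold orientedPlane
  rcases pos_and_pos_or_neg_and_neg_of_mul_pos h with h | h
  · simp [h.1, h.2]
  · simp [h.1.not_gt, h.2.not_gt]

lemma contDiffOn_sqrt_radialMean_smul {E P : Type*} [NormedAddCommGroup E] [NormedSpace ℝ E]
    [FiniteDimensional ℝ E] [NormedAddCommGroup P] [NormedSpace ℝ P] [FiniteDimensional ℝ P] {U : Set E} (hU : IsOpen U)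
    {ρ : E × P → ℝ} (hρ : ContDiffOn ℝ ∞ ρ (U ×ˢ univ)) (hpos : ∀ u ∈ U, ∀ z, 0 < ρ (u, z))
    (T : P →L[ℝ] P) :
    ContDiffOn ℝ ∞ (fun q => √(radialMean ρ q) • T q.2) (U ×ˢ univ) := by
  have hray : ∀ u ∈ U, ∀ z : P, Continuous fun t : ℝ => ρ (u, t • z) := fun u hu z =>
    hρ.continuousOn.comp_continuous (by fun_prop) fun t => ⟨hu, mem_univ _⟩
  exact ((contDiffOn_radialMean hU hρ).sqrt fun q hq =>
    (radialMean_pos (hray q.1 hq.1 q.2) fun t => hpos _ hq.1 _).ne').smul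
    (T.contDiff.comp contDiff_snd).contDiffOn

variable {E₀ : Type*} [NormedAddCommGroup E₀] [NormedSpace ℝ E₀] [FiniteDimensional ℝ E₀]
  {F : Type*} [TopologicalSpace F] [ChartedSpace E₀ F] [IsManifold 𝓘(ℝ, E₀) ∞ F]
  {s : F × ℂ → ℝ}

/-- The fibrewise radial map of the plane that takes `2 dx dy` to `2 s dx dy` along rays, up to
terms that vanish in the radial direction. -/
noncomputable def radialCoordinate (s : F × ℂ → ℝ) (q : F × ℂ) : ℂ :=
  √(∫ t in (0 : ℝ)..1, t * |s (q.1, t • q.2)|) • orientedPlane (s (q.1, 0)) q.2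

lemma radialCoordinate_zero (x : F) : radialCoordinate s (x, 0) = 0 := by
  simp [radialCoordinate]

/-- `orientedPlane` is linear and preserves norms, so the claim reduces to `injective_sqrt_smul`. -/
lemma radialCoordinate_injective (hs : Continuous s) (h0 : ∀ q, s q ≠ 0) (x : F) :
    Function.Injective fun z => radialCoordinate s (x, z) := by
  have hsc : Continuous fun z => s (x, z) := hs.comp (by fun_prop)
  let ρ : ℝ × ℂ → ℝ := fun q => |s (x, q.2)|
  have hray : ∀ z : ℂ, Continuous fun t : ℝ => ρ (0, t • z) := fun z =>
    (hsc.comp (by fun_prop : Continuous fun t : ℝ => t • z)).abs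
  have hpos : ∀ q, 0 < ρ q := fun q => abs_pos.2 (h0 _)
  have hinj := injective_sqrt_smul (k := fun z => radialMean ρ (0, z))
    (fun z => radialMean_pos (hray z) fun t => hpos _)
    fun z => strictMonoOn_sq_mul_radialMean (hray z) fun t => hpos _
  intro z w hzw
  have h1 : ∀ z, radialCoordinate s (x, z) =
      orientedPlane (s (x, 0)) (√(radialMean ρ (0, z)) • z) := fun z => by
    rw [map_smul]
    rfl
  refine hinj (sub_eq_zero.1 (norm_eq_zero.1 ?_))
  rw [← norm_orientedPlane (s (x, 0)), map_sub, ← h1, ← h1, norm_eq_zero, sub_eq_zero]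
  exact hzw

/-- The sign of `s` is constant on each connected slice `{x} × ℂ` and locally constant in `x`. As
`F` may be disconnected, one sign need not serve everywhere. Over a small `U` the function `|s|` is
the smooth function `ε s` and the orientation is fixed. -/
lemma exists_local_radialCoordinate (hs : ContMDiff (𝓘(ℝ, E₀).prod 𝓘(ℝ, ℂ)) 𝓘(ℝ, ℝ) ∞ s)
    (h0 : ∀ q, s q ≠ 0) (x₀ : F) :
    ∃ (U : Set E₀) (ε : ℝ) (T : ℂ →L[ℝ] ℂ), IsOpen U ∧ extChartAt 𝓘(ℝ, E₀) x₀ x₀ ∈ U ∧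
      U ⊆ (extChartAt 𝓘(ℝ, E₀) x₀).target ∧ ε * ε = 1 ∧
      (∀ a b, ((starRingEnd ℂ) (T a) * T b).im = ε * ((starRingEnd ℂ) a * b).im) ∧
      (∀ u ∈ U, ∀ z, 0 < ε * s ((extChartAt 𝓘(ℝ, E₀) x₀).symm u, z)) ∧
      ∀ u ∈ U, ∀ z, radialCoordinate s ((extChartAt 𝓘(ℝ, E₀) x₀).symm u, z) =
        √(radialMean (fun q : E₀ × ℂ => ε * s ((extChartAt 𝓘(ℝ, E₀) x₀).symm q.1, q.2)) (u, z)) •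
          T z := by
  classical
  set e := extChartAt 𝓘(ℝ, E₀) x₀ with he
  have hsc : ∀ x, Continuous fun z => s (x, z) := fun x =>
    hs.continuous.comp (by fun_prop)
  have hc : Continuous fun x => s (x₀, 0) * s (x, 0) :=
    continuous_const.mul (hs.continuous.comp (by fun_prop))
  have hU : IsOpen (e.target ∩ e.symm ⁻¹' {x | 0 < s (x₀, 0) * s (x, 0)}) :=
    (continuousOn_extChartAt_symm x₀).isOpen_inter_preimage (isOpen_extChartAt_target x₀)
      (isOpen_lt continuous_const hc)
  set ε : ℝ := if 0 < s (x₀, 0) then 1 else -1 with hε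
  have hεs : 0 < ε * s (x₀, 0) := by
    rw [hε]
    split_ifs with h
    · simpa using h
    · have := lt_of_le_of_ne (not_lt.1 h) (h0 _)
      linarith
  have hpos : ∀ x, 0 < s (x₀, 0) * s (x, 0) → ∀ z, 0 < ε * s (x, z) := by
    intro x hx z
    have h1 := mul_pos_of_continuous_of_ne_zero (hsc x) (fun z => h0 _) 0 z
    have h2 := mul_pos hεs (mul_pos hx h1)
    -- Regrouping isolates a square, so the positive product forces `ε s (x, z) > 0`.
    have h3 : ε * s (x₀, 0) * (s (x₀, 0) * s (x, 0) * (s (x, 0) * s (x, z))) =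
      (s (x₀, 0) * s (x, 0)) ^ 2 * (ε * s (x, z)) := by ring
    rw [h3] at h2
    exact pos_of_mul_pos_right h2 (sq_nonneg _)
  refine ⟨_, ε, orientedPlane (s (x₀, 0)), hU, ⟨mem_extChartAt_target x₀, ?_⟩, inter_subset_left,
    ?_, orientedPlane_area _, fun u hu => hpos _ hu.2, fun u hu z => ?_⟩
  · change 0 < s (x₀, 0) * s (e.symm (e x₀), 0)
    rw [he, extChartAt_to_inv x₀]
    exact mul_self_pos.2 (h0 _)
  · rw [hε]
    split_ifs <;> norm_num
  · have hu' : 0 < s (x₀, 0) * s (e.symm u, 0) := hu.2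
    unfold radialCoordinate radialMean
    simp only
    rw [orientedPlane_eq hu']
    congr 3
    funext t
    have h1 : |ε| = 1 := by
      rw [hε]
      split_ifs <;> simp
    rw [← abs_of_pos (hpos _ hu' (t • z)), abs_mul, h1, one_mul]

lemma contMDiff_radialCoordinate (hs : ContMDiff (𝓘(ℝ, E₀).prod 𝓘(ℝ, ℂ)) 𝓘(ℝ, ℝ) ∞ s)
    (h0 : ∀ q, s q ≠ 0) :
    ContMDiff (𝓘(ℝ, E₀).prod 𝓘(ℝ, ℂ)) 𝓘(ℝ, ℂ) ∞ (radialCoordinate s) := by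
  intro q₀
  obtain ⟨U, ε, T, hU, hx₀, hUt, -, -, hpos, hC⟩ := exists_local_radialCoordinate hs h0 q₀.1
  set e := extChartAt 𝓘(ℝ, E₀) q₀.1 with he
  have hj : ContMDiffOn 𝓘(ℝ, E₀) 𝓘(ℝ, E₀) ∞ e.symm U := (contMDiffOn_extChartAt_symm _).mono hUt
  have hρ : ContDiffOn ℝ ∞ (fun q : E₀ × ℂ => ε * s (e.symm q.1, q.2)) (U ×ˢ univ) := by
    rw [← contMDiffOn_iff_contDiffOn]
    intro q hq
    have h1 : ContMDiffAt 𝓘(ℝ, E₀ × ℂ) 𝓘(ℝ, E₀) ∞ (fun q : E₀ × ℂ => e.symm q.1) q :=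
      ((hj q.1 hq.1).contMDiffAt (hU.mem_nhds hq.1)).comp q contDiff_fst.contMDiff.contMDiffAt
    exact (contMDiffAt_const.mul ((hs _).comp q
      (h1.prodMk contDiff_snd.contMDiff.contMDiffAt))).contMDiffWithinAt
  have h1 : ContDiffAt ℝ ∞ _ (e q₀.1, q₀.2) := (contDiffOn_sqrt_radialMean_smul hU hρ hpos T).contDiffAt
    ((hU.prod isOpen_univ).mem_nhds ⟨hx₀, mem_univ _⟩)
  have h2 : ContMDiffAt (𝓘(ℝ, E₀).prod 𝓘(ℝ, ℂ)) 𝓘(ℝ, E₀ × ℂ) ∞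
      (fun q : F × ℂ => (e q.1, q.2)) q₀ := by
    have h3 : ContMDiffAt (𝓘(ℝ, E₀).prod 𝓘(ℝ, ℂ)) 𝓘(ℝ, E₀) ∞ (fun q : F × ℂ => e q.1) q₀ :=
      contMDiffAt_extChartAt.comp q₀ contMDiffAt_fst
    exact h3.prodMk_space contMDiffAt_snd
  refine (ContMDiffAt.comp q₀ h1.contMDiffAt h2).congr_of_eventuallyEq ?_
  have h4 : ∀ᶠ q : F × ℂ in 𝓝 q₀, q.1 ∈ e.source :=
    continuous_fst.continuousAt.eventually (extChartAt_source_mem_nhds q₀.1)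
  have h5 : ∀ᶠ q : F × ℂ in 𝓝 q₀, e q.1 ∈ U :=
    ((continuousAt_extChartAt q₀.1).comp continuous_fst.continuousAt).eventually
      (hU.mem_nhds hx₀)
  filter_upwards [h4, h5] with q hq hqU
  have := hC _ hqU q.2
  rw [e.left_inv hq] at this
  exact this

end RadialCoordinate

/-! ### Pullback of the split form -/

section Embedding

variable {E : Type*} [NormedAddCommGroup E] [NormedSpace ℝ E] [FiniteDimensional ℝ E]
  {M : Type*} [TopologicalSpace M] [ChartedSpace E M] [IsManifold 𝓘(ℝ, E) ∞ M]
  {E₀ : Type*} [NormedAddCommGroup E₀] [NormedSpace ℝ E₀] [FiniteDimensional ℝ E₀]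
  {F : Type*} [TopologicalSpace F] [ChartedSpace E₀ F] [IsManifold 𝓘(ℝ, E₀) ∞ F]
  {Ω : DiffForm 𝓘(ℝ, E) M 2} {p : M → ℂ} {ι : F → M} {σ : DiffForm 𝓘(ℝ, ℂ) ℂ 2}
  {V : ∀ x : M, ℂ →L[ℝ] TangentSpace 𝓘(ℝ, E) x} {r : M → ℝ} {Φ : F × ℂ → M} {Ψ : M → F × ℂ}
  {S : ℂ → ℂ}

/-- The equality is pointwise. Near `m` the identity and both components of the map factor through
the coordinates `q` built from `Ψ` and a chart of `F`, so that `radial_trivialization_pullback_eq`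
evaluated on the images of `v, w` under `dq` is the claim. -/
theorem pullback_prodSum_radialCoordinate (hΩs : DiffForm.IsSmooth 𝓘(ℝ, E) Ω)
    (hΩc : DiffForm.IsClosedForm 𝓘(ℝ, E) Ω)
    (hFs : DiffForm.IsSmooth 𝓘(ℝ, E₀) (DiffForm.pullback 𝓘(ℝ, E₀) 𝓘(ℝ, E) ι Ω))
    (hFc : DiffForm.IsClosedForm 𝓘(ℝ, E₀) (DiffForm.pullback 𝓘(ℝ, E₀) 𝓘(ℝ, E) ι Ω))
    (hσs : DiffForm.IsSmooth 𝓘(ℝ, ℂ) σ) (hσc : DiffForm.IsClosedForm 𝓘(ℝ, ℂ) σ)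
    (hp : ContMDiff 𝓘(ℝ, E) 𝓘(ℝ, ℂ) ∞ p) (hι : ContMDiff 𝓘(ℝ, E₀) 𝓘(ℝ, E) ∞ ι)
    (hr : ContMDiff 𝓘(ℝ, E) 𝓘(ℝ, ℝ) ∞ r) (hr0 : ∀ x, r x ≠ 0)
    (hΩV : ∀ x z w, Ω x ![V x z, w] =
        r x * ((starRingEnd ℂ) z * (show ℂ from mfderiv 𝓘(ℝ, E) 𝓘(ℝ, ℂ) p x w)).im)
    (hΦ : ContMDiff (𝓘(ℝ, E₀).prod 𝓘(ℝ, ℂ)) 𝓘(ℝ, E) ∞ Φ)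
    (hΨ : ContMDiff 𝓘(ℝ, E) (𝓘(ℝ, E₀).prod 𝓘(ℝ, ℂ)) ∞ Ψ) (hΦΨ : ∀ m, Φ (Ψ m) = m)
    (hpΦ : ∀ q, p (Φ q) = q.2) (hΦ0 : ∀ x, Φ (x, 0) = ι x)
    (hΦV : ∀ x z, IsMIntegralCurve (I := 𝓘(ℝ, E)) (fun t : ℝ => Φ (x, t • z)) fun x => V x z)
    (hS : ContDiff ℝ ∞ S)
    (hSσ : ∀ z a b, (show ℂ [⋀^Fin 2]→L[ℝ] ℝ from σ (S z)) ![fderiv ℝ S z a, fderiv ℝ S z b] =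
        2 * ((starRingEnd ℂ) a * b).im) :
    DiffForm.pullback 𝓘(ℝ, E) (𝓘(ℝ, E₀).prod 𝓘(ℝ, ℂ))
      (fun m => ((Ψ m).1, S (radialCoordinate (fun q => r (Φ q)) (Ψ m))))
      (DiffForm.prodSum 𝓘(ℝ, E₀) 𝓘(ℝ, ℂ) (DiffForm.pullback 𝓘(ℝ, E₀) 𝓘(ℝ, E) ι Ω) σ) = Ω := by
  have hs : ContMDiff (𝓘(ℝ, E₀).prod 𝓘(ℝ, ℂ)) 𝓘(ℝ, ℝ) ∞ fun q => r (Φ q) := hr.comp hΦ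
  set αF := DiffForm.pullback 𝓘(ℝ, E₀) 𝓘(ℝ, E) ι Ω with hαF
  set C := radialCoordinate fun q => r (Φ q) with hCdef
  have hC : ContMDiff (𝓘(ℝ, E₀).prod 𝓘(ℝ, ℂ)) 𝓘(ℝ, ℂ) ∞ C :=
    contMDiff_radialCoordinate hs fun q => hr0 _
  let φ₁ : M → F := fun m => (Ψ m).1
  let φ₂ : M → ℂ := fun m => S (C (Ψ m))
  have hφ₁ : ContMDiff 𝓘(ℝ, E) 𝓘(ℝ, E₀) ∞ φ₁ := contMDiff_fst.comp hΨ
  have hφ₂ : ContMDiff 𝓘(ℝ, E) 𝓘(ℝ, ℂ) ∞ φ₂ := hS.contMDiff.comp (hC.comp hΨ)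
  funext m
  obtain ⟨U, ε, T, hU, hx₀, hUt, hε, hT, hpos, hCl⟩ :=
    exists_local_radialCoordinate hs (fun q => hr0 _) (Ψ m).1
  set e := extChartAt 𝓘(ℝ, E₀) (Ψ m).1 with he
  have hj : ContMDiffOn 𝓘(ℝ, E₀) 𝓘(ℝ, E₀) ∞ e.symm U := (contMDiffOn_extChartAt_symm _).mono hUt
  let q : M → E₀ × ℂ := fun m => (e (Ψ m).1, (Ψ m).2)
  have hq : MDifferentiableAt 𝓘(ℝ, E) 𝓘(ℝ, E₀ × ℂ) q m := by
    have h1 : ContMDiffAt 𝓘(ℝ, E) 𝓘(ℝ, E₀) ∞ (fun m => e (Ψ m).1) m :=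
      contMDiffAt_extChartAt.comp m (hφ₁ m)
    have h2 : ContMDiffAt 𝓘(ℝ, E) 𝓘(ℝ, ℂ) ∞ (fun m => (Ψ m).2) m := contMDiffAt_snd.comp m (hΨ m)
    exact (h1.prodMk_space h2).mdifferentiableAt (by simp)
  have hsrc : ∀ᶠ m' in 𝓝 m, e.symm (e (Ψ m').1) = (Ψ m').1 :=
    (hφ₁.continuous.continuousAt.eventually (extChartAt_source_mem_nhds (Ψ m).1)).mono
      fun m' hm' => e.left_inv hm'
  have hqU : ∀ᶠ m' in 𝓝 m, e (Ψ m').1 ∈ U :=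
    (ContinuousAt.comp (f := φ₁) (continuousAt_extChartAt (Ψ m).1)
      hφ₁.continuous.continuousAt).eventually (hU.mem_nhds hx₀)
  let G₁ : E₀ × ℂ → M := fun q => Φ (e.symm q.1, q.2)
  let G₂ : E₀ × ℂ → F := fun q => e.symm q.1
  let G₃ : E₀ × ℂ → ℂ := fun q =>
    S (√(radialMean (fun q : E₀ × ℂ => ε * r (Φ (e.symm q.1, q.2))) q) • T q.2)
  have hG₂ : ContMDiffAt 𝓘(ℝ, E₀ × ℂ) 𝓘(ℝ, E₀) ∞ G₂ (q m) :=
    ((hj _ hx₀).contMDiffAt (hU.mem_nhds hx₀)).comp (q m) contDiff_fst.contMDiff.contMDiffAt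
  have hG₁ : ContMDiffAt 𝓘(ℝ, E₀ × ℂ) 𝓘(ℝ, E) ∞ G₁ (q m) :=
    (hΦ _).comp (q m) (hG₂.prodMk contDiff_snd.contMDiff.contMDiffAt)
  have hG₃' : G₃ =ᶠ[𝓝 (q m)] fun q => S (C (e.symm q.1, q.2)) := by
    filter_upwards [(hU.preimage continuous_fst).mem_nhds (show (q m).1 ∈ U from hx₀)] with y hy
    exact congrArg S (hCl y.1 hy y.2).symm
  have hG₃ : ContMDiffAt 𝓘(ℝ, E₀ × ℂ) 𝓘(ℝ, ℂ) ∞ G₃ (q m) := by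
    refine ContMDiffAt.congr_of_eventuallyEq ?_ hG₃'
    exact (hS.contMDiff.comp hC).contMDiffAt.comp (q m)
      (hG₂.prodMk contDiff_snd.contMDiff.contMDiffAt)
  have hid : G₁ ∘ q =ᶠ[𝓝 m] id := by
    filter_upwards [hsrc] with m' hm'
    change Φ (e.symm (e (Ψ m').1), (Ψ m').2) = m'
    rw [hm', hΦΨ]
  have hfst : G₂ ∘ q =ᶠ[𝓝 m] φ₁ := hsrc
  have hsnd : G₃ ∘ q =ᶠ[𝓝 m] φ₂ := by
    filter_upwards [hsrc, hqU] with m' hm' hm'U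
    have h1 := hCl _ hm'U (Ψ m').2
    rw [hm'] at h1
    exact congrArg S h1.symm
  have hform : ∀ v w : TangentSpace 𝓘(ℝ, E) m, DiffForm.pullback 𝓘(ℝ, E) (𝓘(ℝ, E₀).prod 𝓘(ℝ, ℂ))
      (fun m => (φ₁ m, φ₂ m)) (DiffForm.prodSum 𝓘(ℝ, E₀) 𝓘(ℝ, ℂ) αF σ) m ![v, w] =
      Ω m ![v, w] := by
    intro v w
    have k1 := DiffForm.pullbackModel_comp_apply Ω (hG₁.mdifferentiableAt (by simp)) hq hid v w
    have k2 := DiffForm.pullbackModel_comp_apply αF (hG₂.mdifferentiableAt (by simp)) hq hfst v w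
    have k3 := DiffForm.pullbackModel_comp_apply σ (hG₃.mdifferentiableAt (by simp)) hq hsnd v w
    have k := radial_trivialization_pullback_eq hΩs hΩc hFs hFc hσs hσc hp hι hr hΩV hΦ hpΦ hΦ0
      hΦV hS hSσ hU hj hε hT hpos hx₀ (Ψ m).2 (mfderiv 𝓘(ℝ, E) 𝓘(ℝ, E₀ × ℂ) q m v)
      (mfderiv 𝓘(ℝ, E) 𝓘(ℝ, E₀ × ℂ) q m w)
    have d₁ : ∀ v : TangentSpace 𝓘(ℝ, E) m,
        (mfderiv (𝓘(ℝ, E₀).prod 𝓘(ℝ, ℂ)) 𝓘(ℝ, E₀) Prod.fst (φ₁ m, φ₂ m)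
          (mfderiv 𝓘(ℝ, E) (𝓘(ℝ, E₀).prod 𝓘(ℝ, ℂ)) (fun m => (φ₁ m, φ₂ m)) m v) : E₀) =
        mfderiv 𝓘(ℝ, E) 𝓘(ℝ, E₀) φ₁ m v := fun v =>
      congrArg (fun L : E →L[ℝ] E₀ => L v) (mfderiv_comp m (f := fun m => (φ₁ m, φ₂ m))
        (g := Prod.fst) mdifferentiableAt_fst ((hφ₁.prodMk hφ₂).mdifferentiable (by simp) m)).symm
    have d₂ : ∀ v : TangentSpace 𝓘(ℝ, E) m,
        (mfderiv (𝓘(ℝ, E₀).prod 𝓘(ℝ, ℂ)) 𝓘(ℝ, ℂ) Prod.snd (φ₁ m, φ₂ m)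
          (mfderiv 𝓘(ℝ, E) (𝓘(ℝ, E₀).prod 𝓘(ℝ, ℂ)) (fun m => (φ₁ m, φ₂ m)) m v) : ℂ) =
        mfderiv 𝓘(ℝ, E) 𝓘(ℝ, ℂ) φ₂ m v := fun v =>
      congrArg (fun L : E →L[ℝ] ℂ => L v) (mfderiv_comp m (f := fun m => (φ₁ m, φ₂ m))
        (g := Prod.snd) mdifferentiableAt_snd ((hφ₁.prodMk hφ₂).mdifferentiable (by simp) m)).symm
    have d₀ : ∀ v : TangentSpace 𝓘(ℝ, E) m, (mfderiv 𝓘(ℝ, E) 𝓘(ℝ, E) (id : M → M) m v : E) = v :=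
      fun v => congrArg (fun L : E →L[ℝ] E => L v) mfderiv_id
    have k1' : Ω m ![v, w] = _ := (congrArg₂ (fun a b : E => formFlat (E := E) (Ω m) a b)
      (d₀ v) (d₀ w)).symm.trans (k1.symm.trans k)
    refine Eq.trans ?_ (k1'.trans (congrArg₂ (· + ·) k2 k3)).symm
    refine (DiffForm.pullback_apply_two (I' := 𝓘(ℝ, E₀).prod 𝓘(ℝ, ℂ)) _ _ m v w).trans ?_
    refine congrArg₂ (· + ·) ((DiffForm.pullback_apply_two Prod.fst αF (φ₁ m, φ₂ m) _ _).trans ?_)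
      ((DiffForm.pullback_apply_two Prod.snd σ (φ₁ m, φ₂ m) _ _).trans ?_)
    · exact congrArg₂ (fun a b : E₀ => formFlat (E := E₀) (αF (φ₁ m)) a b) (d₁ v) (d₁ w)
    · exact congrArg₂ (fun a b : ℂ => formFlat (E := ℂ) (σ (φ₂ m)) a b) (d₂ v) (d₂ w)
  refine ContinuousAlternatingMap.ext fun v => ?_
  have hv : v = ![v 0, v 1] := by
    funext i
    fin_cases i <;> rfl
  rw [hv]
  exact hform (v 0) (v 1)

end Embedding

/-! ### Bijectivity of the differential -/

section Embedding

/-- A vector killed by `dφ` pairs to zero with everything under the pullback, which is the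
nondegenerate form `Ω`. -/
lemma DiffForm.mfderiv_injective_of_pullback_eq
    {E : Type*} [NormedAddCommGroup E] [NormedSpace ℝ E]
    {H : Type*} [TopologicalSpace H] {I : ModelWithCorners ℝ E H}
    {M : Type*} [TopologicalSpace M] [ChartedSpace H M]
    {E' : Type*} [NormedAddCommGroup E'] [NormedSpace ℝ E']
    {H' : Type*} [TopologicalSpace H'] {I' : ModelWithCorners ℝ E' H'}
    {M' : Type*} [TopologicalSpace M'] [ChartedSpace H' M']
    {Ω : DiffForm I M 2} (hΩ : IsSymplecticForm I Ω) {φ : M → M'} {α : DiffForm I' M' 2}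
    (h : DiffForm.pullback I I' φ α = Ω) (m : M) : Function.Injective (mfderiv I I' φ m) := by
  refine (injective_iff_map_eq_zero _).2 fun v hv => hΩ.nondegenerate m v fun w => ?_
  rw [← h]
  refine (DiffForm.pullback_apply_two φ α m v w).trans ?_
  rw [hv]
  exact (α (φ m)).map_coord_zero 0 rfl

/-- An injective differential into a manifold that is a smooth retract of the source is
bijective. -/
lemma mfderiv_bijective_of_injective_of_leftInverse
    {E : Type*} [NormedAddCommGroup E] [NormedSpace ℝ E] [FiniteDimensional ℝ E]
    {H : Type*} [TopologicalSpace H] {I : ModelWithCorners ℝ E H}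
    {M : Type*} [TopologicalSpace M] [ChartedSpace H M]
    {E' : Type*} [NormedAddCommGroup E'] [NormedSpace ℝ E'] [FiniteDimensional ℝ E']
    {H' : Type*} [TopologicalSpace H'] {I' : ModelWithCorners ℝ E' H'}
    {M' : Type*} [TopologicalSpace M'] [ChartedSpace H' M']
    {φ : M → M'} {m : M} (hφ : Function.Injective (mfderiv I I' φ m))
    {Φ : M' → M} {Ψ : M → M'} (hΦ : MDifferentiable I' I Φ) (hΨ : MDifferentiable I I' Ψ)
    (h : ∀ q, Ψ (Φ q) = q) : Function.Bijective (mfderiv I I' φ m) := by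
  have h1 : Function.Injective (mfderiv I' I Φ (Ψ m)) := by
    have h2 := mfderiv_comp (Ψ m) (hΨ (Φ (Ψ m))) (hΦ (Ψ m))
    rw [show Ψ ∘ Φ = id from funext h, mfderiv_id] at h2
    intro v w hvw
    have h3 : ∀ v : E', v = mfderiv I I' Ψ (Φ (Ψ m)) (mfderiv I' I Φ (Ψ m) v) := fun v =>
      congrArg (fun L : E' →L[ℝ] E' => L v) h2
    refine (h3 v).trans (Eq.trans ?_ (h3 w).symm)
    exact congrArg (fun a : E => (mfderiv I I' Ψ (Φ (Ψ m)) a : E')) hvw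
  let A : E →L[ℝ] E' := mfderiv I I' φ m
  let B : E' →L[ℝ] E := mfderiv I' I Φ (Ψ m)
  -- `dφ` and `dΦ` are injections in opposite directions, so the dimensions agree.
  have h4 : Module.finrank ℝ E = Module.finrank ℝ E' :=
    le_antisymm (LinearMap.finrank_le_finrank_of_injective (f := (A : E →ₗ[ℝ] E')) hφ)
      (LinearMap.finrank_le_finrank_of_injective (f := (B : E' →ₗ[ℝ] E)) h1)
  exact ⟨hφ, (LinearMap.injective_iff_surjective_of_finrank_eq_finrank (f := (A : E →ₗ[ℝ] E')) h4).1 hφ⟩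

end Embedding

/-! ### Assembly of the embedding -/

theorem mainTheorem9
    {E : Type*} [NormedAddCommGroup E] [NormedSpace ℝ E] [FiniteDimensional ℝ E]
    {M : Type*} [TopologicalSpace M] [ChartedSpace E M] [IsManifold 𝓘(ℝ, E) ∞ M]
    [T2Space M] [SecondCountableTopology M]
    {E₀ : Type*} [NormedAddCommGroup E₀] [NormedSpace ℝ E₀] [FiniteDimensional ℝ E₀]
    {F : Type*} [TopologicalSpace F] [ChartedSpace E₀ F] [IsManifold 𝓘(ℝ, E₀) ∞ F]
    [T2Space F] [CompactSpace F]
    -- the symplectic manifold `(M, Ω)` and the map `p : M → ℂ`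
    (Ω : DiffForm 𝓘(ℝ, E) M 2) (hΩ : IsSymplecticForm 𝓘(ℝ, E) Ω) (p : M → ℂ)
    -- `F` is the submanifold `p ⁻¹ {0}` of `M`, with inclusion `ι`
    (ι : F → M) (hι : Manifold.IsSmoothEmbedding 𝓘(ℝ, E₀) 𝓘(ℝ, E) ∞ ι)
    (hF : Set.range ι = p ⁻¹' {0})
    -- `(M, p, Ω)` is a Hamiltonian fibration with fibre `(F, Ω|_F)`
    (hp : IsHamiltonianFibration 𝓘(ℝ, E) 𝓘(ℝ, E₀) p Ω
      (DiffForm.pullback 𝓘(ℝ, E₀) 𝓘(ℝ, E) ι Ω))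
    -- the symplectic form `σ = d(f dθ)` on `ℂ`
    (f : ℝ → ℝ) (hf : ContDiffOn ℝ ∞ f (Set.Ici 0)) (hf0 : f 0 = 0)
    (hf2 : ∀ r : ℝ, 0 < r → 0 ≤ iteratedDeriv 2 f r)
    (σ : DiffForm 𝓘(ℝ, ℂ) ℂ 2) (hσ : IsSymplecticForm 𝓘(ℝ, ℂ) σ)
    (hσf : ∀ z : ℂ, z ≠ 0 → σ z = dRadialTheta f z) :
    ∃ φ : M → F × ℂ,
      Manifold.IsSmoothEmbedding 𝓘(ℝ, E) (𝓘(ℝ, E₀).prod 𝓘(ℝ, ℂ)) ∞ φ ∧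
      DiffForm.pullback 𝓘(ℝ, E) (𝓘(ℝ, E₀).prod 𝓘(ℝ, ℂ)) φ
        (DiffForm.prodSum 𝓘(ℝ, E₀) 𝓘(ℝ, ℂ)
          (DiffForm.pullback 𝓘(ℝ, E₀) 𝓘(ℝ, E) ι Ω) σ) = Ω ∧
      IsSmoothHomotopyEquiv 𝓘(ℝ, E) (𝓘(ℝ, E₀).prod 𝓘(ℝ, ℂ)) φ ∧
      ∀ x : F, φ (ι x) = (x, 0) := by
  obtain ⟨V, r, Φ, Ψ, hr, hr0, hΩV, hΦ, hΨ, hΨΦ, hΦΨ, hpΦ, hΦ0, hΦV⟩ :=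
    hp.exists_trivialization hΩ hι hF
  obtain ⟨S, hS, hSinj, hS0, hSσ⟩ := exists_area_normalization hσ hf hf2 hσf
  set C := radialCoordinate fun q => r (Φ q) with hCdef
  have hs : ContMDiff (𝓘(ℝ, E₀).prod 𝓘(ℝ, ℂ)) 𝓘(ℝ, ℝ) ∞ fun q => r (Φ q) := hr.comp hΦ
  have hC : ContMDiff (𝓘(ℝ, E₀).prod 𝓘(ℝ, ℂ)) 𝓘(ℝ, ℂ) ∞ C :=
    contMDiff_radialCoordinate hs fun q => hr0 _
  let φ : M → F × ℂ := fun m => ((Ψ m).1, S (C (Ψ m)))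
  have hιs := hι.isImmersion.contMDiff
  have hpull : DiffForm.pullback 𝓘(ℝ, E) (𝓘(ℝ, E₀).prod 𝓘(ℝ, ℂ)) φ
      (DiffForm.prodSum 𝓘(ℝ, E₀) 𝓘(ℝ, ℂ) (DiffForm.pullback 𝓘(ℝ, E₀) 𝓘(ℝ, E) ι Ω) σ) = Ω :=
    pullback_prodSum_radialCoordinate hΩ.smooth hΩ.closed hp.fibre_symplectic.smooth
      hp.fibre_symplectic.closed hσ.smooth hσ.closed hp.submersion.contMDiff hιs hr hr0 hΩV hΦ hΨ
      hΦΨ hpΦ hΦ0 hΦV hS hSσ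
  have hφ : ContMDiff 𝓘(ℝ, E) (𝓘(ℝ, E₀).prod 𝓘(ℝ, ℂ)) ∞ φ :=
    (contMDiff_fst.comp hΨ).prodMk (hS.contMDiff.comp (hC.comp hΨ))
  have hinj : Function.Injective φ := by
    intro m m' h
    obtain ⟨h1, h2⟩ := Prod.ext_iff.1 h
    change (Ψ m).1 = (Ψ m').1 at h1
    have h3 : (Ψ m).2 = (Ψ m').2 := by
      refine radialCoordinate_injective hs.continuous (fun q => hr0 _) (Ψ m).1 ?_
      change C (Ψ m) = C ((Ψ m).1, (Ψ m').2)
      rw [show ((Ψ m).1, (Ψ m').2) = Ψ m' from Prod.ext h1 rfl]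
      exact hSinj h2
    rw [← hΦΨ m, ← hΦΨ m', Prod.ext h1 h3]
  have hφι : ∀ x, φ (ι x) = (x, 0) := fun x => by
    have h1 : Ψ (ι x) = (x, 0) := by rw [← hΦ0, hΨΦ]
    simp only [φ, h1, hCdef, radialCoordinate_zero, hS0]
  -- The homotopy inverse is `ι ∘ pr₁`. Both homotopies multiply the `ℂ`-coordinate by the time, on
  -- `M` through `Φ` and `Ψ`: time `0` gives the projection to the core and time `1` the identity.
  refine ⟨φ, isSmoothEmbedding_of_bijective_mfderiv hφ hinj fun m =>
    mfderiv_bijective_of_injective_of_leftInverse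
      (DiffForm.mfderiv_injective_of_pullback_eq hΩ hpull m) (hΦ.mdifferentiable (by simp))
      (hΨ.mdifferentiable (by simp)) hΨΦ, hpull,
    ⟨hφ, fun q => ι q.1, hιs.comp contMDiff_fst,
      ⟨fun q => Φ ((Ψ q.2).1, q.1 • (Ψ q.2).2), ?_, fun m => ⟨?_, ?_⟩⟩,
      ⟨fun q => (q.2.1, q.1 • q.2.2), ?_, fun q => ⟨?_, ?_⟩⟩⟩, hφι⟩
  · have h1 : ContMDiff (𝓘(ℝ, ℝ).prod 𝓘(ℝ, E)) (𝓘(ℝ, E₀).prod 𝓘(ℝ, ℂ)) ∞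
        fun q : ℝ × M => Ψ q.2 := hΨ.comp contMDiff_snd
    exact hΦ.comp ((contMDiff_fst.comp h1).prodMk
      (contMDiff_fst.smul (contMDiff_snd.comp h1)))
  · simp [φ, hΦ0]
  · simp [hΦΨ]
  · exact (contMDiff_fst.comp contMDiff_snd).prodMk
      (contMDiff_fst.smul (contMDiff_snd.comp contMDiff_snd))
  · simp [hφι]
  · simp
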